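/- Let $\mathcal{C}=\{x_1,\dots,x_M\}\subseteq\{0,1\}^n$ be a codebook of $M$ distinct words, listed in any order. All $M$ codewords are sent independently over a binary erasure channel BEC$(p)$, which erases each symbol independently with probability $p$, and the decoder receives the $M$ outputs $y_1,\dots,y_M\in\{0,1,?\}^n$ in an arbitrary order (which may depend on the outputs). An output $y$ \emph{matches} a word $x$ if the two coincide at all positions where $y$ is not erased. The decoder JEDI works in two steps. Step 1: construct (list the edges of) the input-output graph $\mathcal{G}$, the bipartite graph with left nodes $x_1,\dots,x_M$, right nodes $y_1,\dots,y_M$, and an edge $x_iy_j$ if and only if $y_j$ matches $x_i$. Step 2: decide whether $\mathcal{G}$ has a unique perfect matching by peeling, that is, as long as there is a node of degree one, add its edge to the matching and remove the two end points of this edge; if the perfect matching of $\mathcal{G}$ is unique, return it (it is the matching found by peeling), otherwise declare failure. Running times are measured on a random access machine whose instructions are charged the bit lengths of the numbers and addresses they handle. The Reed--Muller code $\mathrm{RM}(r,m)$ consists of the evaluation vectors $(f(v))_{v\in\mathbb{F}_2^m}$ of the polynomials $f\in\mathbb{F}_2[X_1,\dots,X_m]$ of degree at most $r$, the points of $\mathbb{F}_2^m$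 being taken in their standard (binary) order. It has length $n=2^m$; let $M$ be its size and $d$ its minimum distance. \textbf{Theorem.} There is an implementation of JEDI (one program, correct for all codebooks) with the following property. Let $r\ge 1$ and $0\le p<1$ be fixed. Then $\binom{M}{2}p^{d}\to 0$ for the codes $\mathrm{RM}(r,m)$ as $m\to\infty$; and for every $\varepsilon>0$ there is a constant $K$, depending only on $r$, $p$ and $\varepsilon$, such that for all $m\ge r$ the expected running time of JEDI on $\mathrm{RM}(r,m)$ sent over the BEC$(p)$ is at most \[ \begin{cases} K\,M^{1+\varepsilon} & \text{if } r\ge 2,\\ K\,M^{2+\varepsilon} & \text{if } r=1.\end{cases} \] -/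

import Mathlib

open scoped ENNReal

/-! ## A random access machine with logarithmic cost -/

/-- Configuration of a random access machine: registers and an addressable memory, all cells of
both holding natural numbers. -/
@[ext]
structure RamState where
  reg : ℕ → ℕ
  mem : ℕ → ℕ

/-- Tests of a program: comparison of the contents of two registers. -/
inductive RamTest
  | eq (a b : ℕ)
  | lt (a b : ℕ)

/-- Programs of the machine (`a`, `b`, `d` are names of registers, `k` is a constant). -/
inductive RamProg
  /-- do nothing -/
  | skip
  /-- `reg d := k` -/
  | const (d k : ℕ)
  /-- `reg d := reg a` -/
  | copy (d a : ℕ)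
  /-- `reg d := reg a + reg b` -/
  | add (d a b : ℕ)
  /-- `reg d := reg a - reg b` (truncated at zero) -/
  | sub (d a b : ℕ)
  /-- `reg d := mem (reg a)` -/
  | load (d a : ℕ)
  /-- `mem (reg a) := reg b` -/
  | store (a b : ℕ)
  /-- first `P`, then `Q` -/
  | seq (P Q : RamProg)
  /-- `if c then P else Q` -/
  | cond (c : RamTest) (P Q : RamProg)
  /-- `while c do P` -/
  | loop (c : RamTest) (P : RamProg)

namespace RamState

def setReg (s : RamState) (d v : ℕ) : RamState := { s with reg := Function.update s.reg d v }

def setMem (s : RamState) (a v : ℕ) : RamState := { s with mem := Function.update s.mem a v }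

end RamState

namespace RamTest

def Holds : RamTest → RamState → Prop
  | eq a b, s => s.reg a = s.reg b
  | lt a b, s => s.reg a < s.reg b

/-- A test is charged the bit lengths of the numbers compared. -/
def cost : RamTest → RamState → ℕ
  | eq a b, s => 1 + (s.reg a).size + (s.reg b).size
  | lt a b, s => 1 + (s.reg a).size + (s.reg b).size

end RamTest

namespace RamProg

/-- `Exec P s s' t`: started in `s`, the program `P` halts in `s'`, and its running time is `t`.
Every instruction is charged the bit lengths of all numbers and addresses that it handles
(logarithmic cost), so that the running time is a number of bit operations. -/
inductive Exec : RamProg → RamState → RamState → ℕ → Prop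
  | skip (s : RamState) : Exec .skip s s 1
  | const (s : RamState) (d k : ℕ) : Exec (.const d k) s (s.setReg d k) (1 + k.size)
  | copy (s : RamState) (d a : ℕ) :
      Exec (.copy d a) s (s.setReg d (s.reg a)) (1 + (s.reg a).size)
  | add (s : RamState) (d a b : ℕ) :
      Exec (.add d a b) s (s.setReg d (s.reg a + s.reg b))
        (1 + (s.reg a).size + (s.reg b).size)
  | sub (s : RamState) (d a b : ℕ) :
      Exec (.sub d a b) s (s.setReg d (s.reg a - s.reg b))
        (1 + (s.reg a).size + (s.reg b).size)
  | load (s : RamState) (d a : ℕ) :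
      Exec (.load d a) s (s.setReg d (s.mem (s.reg a)))
        (1 + (s.reg a).size + (s.mem (s.reg a)).size)
  | store (s : RamState) (a b : ℕ) :
      Exec (.store a b) s (s.setMem (s.reg a) (s.reg b))
        (1 + (s.reg a).size + (s.reg b).size)
  | seq {P Q : RamProg} {s s₁ s₂ : RamState} {t₁ t₂ : ℕ} :
      Exec P s s₁ t₁ → Exec Q s₁ s₂ t₂ → Exec (.seq P Q) s s₂ (t₁ + t₂)
  | condTrue {c : RamTest} {P Q : RamProg} {s s' : RamState} {t : ℕ} :
      c.Holds s → Exec P s s' t → Exec (.cond c P Q) s s' (c.cost s + t)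
  | condFalse {c : RamTest} {P Q : RamProg} {s s' : RamState} {t : ℕ} :
      ¬ c.Holds s → Exec Q s s' t → Exec (.cond c P Q) s s' (c.cost s + t)
  | loopDone {c : RamTest} {P : RamProg} {s : RamState} :
      ¬ c.Holds s → Exec (.loop c P) s s (c.cost s)
  | loopStep {c : RamTest} {P : RamProg} {s s₁ s₂ : RamState} {t₁ t₂ : ℕ} :
      c.Holds s → Exec P s s₁ t₁ → Exec (.loop c P) s₁ s₂ t₂ →
        Exec (.loop c P) s s₂ (c.cost s + t₁ + t₂)

/-- The machine is deterministic. -/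
theorem Exec.deterministic {P : RamProg} {s s₁ s₂ : RamState} {t₁ t₂ : ℕ}
    (h₁ : Exec P s s₁ t₁) (h₂ : Exec P s s₂ t₂) : s₁ = s₂ ∧ t₁ = t₂ := by
  induction h₁ generalizing s₂ t₂ with
  | skip | const | copy | add | sub | load | store => cases h₂; exact ⟨rfl, rfl⟩
  | seq _ _ ih₁ ih₂ =>
    cases h₂ with
    | seq a b =>
      obtain ⟨rfl, rfl⟩ := ih₁ a
      obtain ⟨rfl, rfl⟩ := ih₂ b
      exact ⟨rfl, rfl⟩
  | condTrue hc _ ih =>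
    cases h₂ with
    | condTrue _ a => obtain ⟨rfl, rfl⟩ := ih a; exact ⟨rfl, rfl⟩
    | condFalse hn _ => exact absurd hc hn
  | condFalse hc _ ih =>
    cases h₂ with
    | condTrue hn _ => exact absurd hn hc
    | condFalse _ a => obtain ⟨rfl, rfl⟩ := ih a; exact ⟨rfl, rfl⟩
  | loopDone hc =>
    cases h₂ with
    | loopDone _ => exact ⟨rfl, rfl⟩
    | loopStep hn _ _ => exact absurd hn hc
  | loopStep hc _ _ ih₁ ih₂ =>
    cases h₂ with
    | loopDone hn => exact absurd hc hn
    | loopStep _ a b =>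
      obtain ⟨rfl, rfl⟩ := ih₁ a
      obtain ⟨rfl, rfl⟩ := ih₂ b
      exact ⟨rfl, rfl⟩

/-- The running time of `P` started in `s`, which is `∞` if `P` does not halt. -/
noncomputable def time (P : RamProg) (s : RamState) : ℝ≥0∞ :=
  ⨅ (s' : RamState) (t : ℕ) (_ : Exec P s s' t), (t : ℝ≥0∞)

theorem time_eq {P : RamProg} {s s' : RamState} {t : ℕ} (h : Exec P s s' t) :
    P.time s = t := by
  refine le_antisymm (iInf_le_of_le s' (iInf₂_le t h)) ?_
  refine le_iInf fun s'' => le_iInf₂ fun t' h' => ?_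
  rw [(h.deterministic h').2]

end RamProg

/-! ## The erasure channel and the input-output graph -/

/-- Binary words of length `n`. -/
abbrev BinWord (n : ℕ) : Type := Fin n → ZMod 2

/-- Channel outputs of length `n`; `none` is the erasure symbol. -/
abbrev ErasedWord (n : ℕ) : Type := Fin n → Option (ZMod 2)

/-- `y` matches `x`: they coincide on the positions that are not erased. -/
def Matches {n : ℕ} (y : ErasedWord n) (x : BinWord n) : Prop :=
  ∀ t, y t = none ∨ y t = some (x t)

/-- Transition probabilities of the binary erasure channel with erasure probability `p`. -/
noncomputable def becSymbolProb (p : ℝ) (a : ZMod 2) : Option (ZMod 2) → ℝ≥0∞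
  | none => ENNReal.ofReal p
  | some b => if b = a then ENNReal.ofReal (1 - p) else 0

/-- The probability `P(y | x)` that the memoryless channel turns `x` into `y`. -/
noncomputable def becProb (p : ℝ) {n : ℕ} (x : BinWord n) (y : ErasedWord n) : ℝ≥0∞ :=
  ∏ t, becSymbolProb p (x t) (y t)

/-- A balanced bipartite graph of order `M`: `G i j` says that there is an edge between the left
node `i` and the right node `j`. -/
abbrev BalBipGraph (M : ℕ) : Type := Fin M → Fin M → Prop

/-- The input-output graph: the left nodes are the codewords, the right nodes the outputs. -/
def ioGraph {M n : ℕ} (x : Fin M → BinWord n) (y : Fin M → ErasedWord n) : BalBipGraph M :=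
  fun i j => Matches (y j) (x i)

/-- The permutation `σ` is a perfect matching, with edges `(σ j, j)`. -/
def BalBipGraph.IsPerfectMatching {M : ℕ} (G : BalBipGraph M) (σ : Equiv.Perm (Fin M)) : Prop :=
  ∀ j, G (σ j) j

/-- When the nodes in `L` and `R` are left, `(i, j)` is an edge and one of its end points has
degree one. -/
def BalBipGraph.Peelable {M : ℕ} (G : BalBipGraph M) (L R : Finset (Fin M)) (i j : Fin M) : Prop :=
  i ∈ L ∧ j ∈ R ∧ G i j ∧ ((∀ j' ∈ R, G i j' → j' = j) ∨ (∀ i' ∈ L, G i' j → i' = i))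

/-- Runs of the peeling matching algorithm on the graph with remaining nodes `L` and `R`: as long
as there is a node of degree one, its edge is added to the matching and the two end points are
removed. The list holds the edges in the order in which they are added. -/
inductive BalBipGraph.PeelRun {M : ℕ} (G : BalBipGraph M) :
    Finset (Fin M) → Finset (Fin M) → List (Fin M × Fin M) → Prop
  | done {L R : Finset (Fin M)} : (∀ i j, ¬ G.Peelable L R i j) → G.PeelRun L R []
  | peel {L R : Finset (Fin M)} {i j : Fin M} {l : List (Fin M × Fin M)} :
      G.Peelable L R i j → G.PeelRun (L.erase i) (R.erase j) l → G.PeelRun L R ((i, j) :: l)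

/-! ## The joint erasure decoding identifier -/

/-- Numerical code of a channel symbol: `0`, `1`, and `2` for an erasure. -/
def symbolCode : Option (ZMod 2) → ℕ
  | none => 2
  | some b => b.val

/-- The initial configuration: `n` and `M` in the registers `0` and `1`, the codebook in the
cells `0, …, M n - 1` (symbol `t` of codeword `i` in cell `i n + t`), then the channel outputs in
the same manner in the next `M n` cells; everything else is zero. -/
def jediInput {M n : ℕ} (x : Fin M → BinWord n) (y : Fin M → ErasedWord n) : RamState where
  reg k := if k = 0 then n else if k = 1 then M else 0
  mem k :=
    if h : k < M * n then
      (x (finProdFinEquiv.symm ⟨k, h⟩).1 (finProdFinEquiv.symm ⟨k, h⟩).2).val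
    else if h : k - M * n < M * n then
      symbolCode (y (finProdFinEquiv.symm ⟨k - M * n, h⟩).1 (finProdFinEquiv.symm ⟨k - M * n, h⟩).2)
    else 0

/-- The list `l` of edges is stored in memory as consecutive pairs of numbers: register `a` holds
the address of the first pair and register `b` the number of edges. -/
def RamState.StoresEdges {M : ℕ} (s : RamState) (a b : ℕ) (l : List (Fin M × Fin M)) : Prop :=
  s.reg b = l.length ∧ ∀ (k : ℕ) (h : k < l.length),
    s.mem (s.reg a + 2 * k) = (l[k].1 : ℕ) ∧ s.mem (s.reg a + 2 * k + 1) = (l[k].2 : ℕ)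

/-- Step 1 is completed: the edges of `G` are listed, each of them once (see registers `2`, `3`). -/
def RamState.StoresGraph {M : ℕ} (s : RamState) (G : BalBipGraph M) : Prop :=
  ∃ l : List (Fin M × Fin M), l.Nodup ∧ (∀ i j, (i, j) ∈ l ↔ G i j) ∧ s.StoresEdges 2 3 l

open Classical in
/-- Step 2 is completed: the matching of a full run of the peeling matching algorithm on `G` is
stored (see registers `4`, `5`). If `G` has a unique perfect matching then this is it and
register `6` is `1`; otherwise register `6` is `0` (failure). -/
def RamState.StoresAnswer {M : ℕ} (s : RamState) (G : BalBipGraph M) : Prop :=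
  ∃ l : List (Fin M × Fin M), G.PeelRun Finset.univ Finset.univ l ∧ s.StoresEdges 4 5 l ∧
    (∀ σ, G.IsPerfectMatching σ → (∀ τ, G.IsPerfectMatching τ → τ = σ) →
      ∀ i j, (i, j) ∈ l ↔ i = σ j) ∧
    s.reg 6 = if ∃! σ, G.IsPerfectMatching σ then 1 else 0

/-- `step₁` followed by `step₂` is an implementation of JEDI: given any codebook `x` and any `M`
channel outputs, listed in any order, `step₁` constructs the input-output graph and `step₂`
determines by peeling whether this graph has a unique perfect matching, which is returned. -/
def ImplementsJEDI (step₁ step₂ : RamProg) : Prop :=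
  ∀ (M n : ℕ) (x : Fin M → BinWord n) (y : Fin M → ErasedWord n), Function.Injective x →
    (∃ π : Equiv.Perm (Fin M), ∀ j, Matches (y j) (x (π j))) →
    ∃ (s₁ s₂ : RamState) (t₁ t₂ : ℕ),
      step₁.Exec (jediInput x y) s₁ t₁ ∧ s₁.StoresGraph (ioGraph x y) ∧
      step₂.Exec s₁ s₂ t₂ ∧ s₂.StoresAnswer (ioGraph x y)

/-- The expected running time of `P` when all codewords `x i` are sent independently over the
erasure channel. If `y i` is the output for `x i`, then the decoder receives the outputs in the
order `y (order y 0), y (order y 1), …`, which may depend on the outputs. -/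
noncomputable def expectedTime (P : RamProg) (p : ℝ) {M n : ℕ} (x : Fin M → BinWord n)
    (order : (Fin M → ErasedWord n) → Equiv.Perm (Fin M)) : ℝ≥0∞ :=
  ∑ y : Fin M → ErasedWord n,
    (∏ i, becProb p (x i) (y i)) * P.time (jediInput x fun j => y (order y j))

/-! ## Reed-Muller codes -/

/-- The point of `𝔽₂ᵐ` whose coordinates are the binary digits of `t`. -/
def cubePoint (m : ℕ) (t : Fin (2 ^ m)) : Fin m → ZMod 2 :=
  fun i => if (t : ℕ).testBit i then 1 else 0

/-- The Reed-Muller code of order `r` and length `2 ^ m`: the evaluation vectors of the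
polynomials of degree at most `r` in `m` variables, the points of `𝔽₂ᵐ` being taken in their
standard order. -/
def reedMuller (r m : ℕ) : Set (BinWord (2 ^ m)) :=
  {c | ∃ f : MvPolynomial (Fin m) (ZMod 2), f.totalDegree ≤ r ∧
    ∀ t, c t = MvPolynomial.eval (cubePoint m t) f}

/-- The minimum distance of a code. -/
noncomputable def codeMinDist {n : ℕ} (C : Set (BinWord n)) : ℕ :=
  sInf {d | ∃ a ∈ C, ∃ b ∈ C, a ≠ b ∧ hammingDist a b = d}

/-! ## Step counts and verification conditions for machine programs -/

namespace RamState

/-! Testing all pairs of a codeword and an output takes time of order `M² n`, which is too slow for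
`r ≥ 2`. Instead, Step 1 stores the codebook in a binary trie and runs all outputs through it in
parallel, one position at a time. The work at depth `t` is proportional to the number of candidates,
that is, of pairs of a distinct codeword prefix of length `t` and an output that matches it so far.
Building the trie takes of order `M n` instructions. Peeling takes time linear in `M` plus the
number of edges, and the edges are the candidates of depth `n`. Hence the number of instructions is
at most a constant times `M n` plus the sum of all candidate counts (`Jedi.exists_runs`).

The output of a codeword `c` matches a prefix `u` of length `t` with probability `p ^ d`, where `d`
counts the differences of `u` and `c` in the first `t` positions. As the code is linear, the
differences run through the prefixes of codewords again, so the expected number of candidates at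
depth `t` is at most `M` times `prefixSum`, the sum of `p ^ weight` over the distinct prefixes of
length `t` (`Jedi.expected_candidateCount_le`).

The core of the proof is that `prefixSum` is bounded by a constant, uniformly in the length of the
code and in `t` (`ReedMuller.exists_prefixSum_le`). A codeword of length `2 ^ (m + 1)` is a
concatenation of `a` and `a + b`, with `a` of the same order and `b` of order one less. A prefix
within the first half is a prefix in the shorter code. A longer prefix with `a ≠ 0` has weight at
least the minimum distance of the code of `a`; there are only `2` to a polynomial in `m` many of
these, and `p` to a power exponential in `m` beats this number (`ReedMuller.tendsto_sq_mul_pow`). If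
`a = 0`, a prefix of `b` is left, and induction on the order applies. The same decay gives the limit
of `M.choose 2 * p ^ d`.

So the expected number of instructions is of order `M n`. All numbers handled are polynomial in `M`,
whence an instruction costs of order `log M`, which any power `M ^ δ` absorbs. It remains to compare
`n = 2 ^ m` with `M`: always `n ≤ M`, and for `r ≥ 2` the dimension is at least `m² / 2`, so that
`n` is at most a constant times `M ^ δ` (`Jedi.two_pow_le_rpow`).

Peeling is correct because the edge at a node of degree one lies in every perfect matching, while a
nonempty rest without such nodes permits an exchange along a cycle
(`BalBipGraph.PeelRun.isPerfectMatching_unique`). On the machine, loop-free pieces are verified by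
computing `RamProg.vc`, loops by induction, and untouched registers by `RamProg.Runs.reg_eq`. -/

@[simp] theorem setReg_reg (s : RamState) (d v k : ℕ) :
    (s.setReg d v).reg k = if k = d then v else s.reg k := by
  simp [setReg, Function.update_apply]

@[simp] theorem setReg_mem (s : RamState) (d v : ℕ) : (s.setReg d v).mem = s.mem := rfl

@[simp] theorem setMem_reg (s : RamState) (a v : ℕ) : (s.setMem a v).reg = s.reg := rfl

@[simp] theorem setMem_mem (s : RamState) (a v : ℕ) :
    (s.setMem a v).mem = Function.update s.mem a v := rfl

/-- All numbers held by the machine are at most `V`. -/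
def BoundedBy (s : RamState) (V : ℕ) : Prop := (∀ k, s.reg k ≤ V) ∧ ∀ k, s.mem k ≤ V

theorem BoundedBy.mono {s : RamState} {V W : ℕ} (h : s.BoundedBy V) (hVW : V ≤ W) :
    s.BoundedBy W :=
  ⟨fun k => (h.1 k).trans hVW, fun k => (h.2 k).trans hVW⟩

theorem BoundedBy.setReg {s : RamState} {V v : ℕ} (h : s.BoundedBy V) (hv : v ≤ V) (d : ℕ) :
    (s.setReg d v).BoundedBy V := by
  refine ⟨fun k => ?_, h.2⟩
  rw [setReg_reg]
  split_ifs
  exacts [hv, h.1 k]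

theorem BoundedBy.setMem {s : RamState} {V v : ℕ} (h : s.BoundedBy V) (hv : v ≤ V) (a : ℕ) :
    (s.setMem a v).BoundedBy V := by
  refine ⟨h.1, fun k => ?_⟩
  rw [setMem_mem, Function.update_apply]
  split_ifs
  exacts [hv, h.2 k]

end RamState

theorem RamTest.cost_le {c : RamTest} {s : RamState} {V : ℕ} (h : s.BoundedBy V) :
    c.cost s ≤ 1 + 2 * V.size := by
  cases c with
  | eq a b | lt a b =>
    have h₁ := Nat.size_le_size (h.1 a)
    have h₂ := Nat.size_le_size (h.1 b)
    simp only [RamTest.cost]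
    omega

namespace RamProg

/-- `P` halts after at most `N` instructions, starting in `s` and ending in `s'`, where every
addition and every constant increases the numbers held by the machine by at most `D`. The running
time is then controlled by `N`, `D` and the size of the numbers held by the machine at first. -/
def Runs (D : ℕ) (P : RamProg) (s s' : RamState) (N : ℕ) : Prop :=
  ∃ t, Exec P s s' t ∧ ∀ V, D ≤ V → s.BoundedBy V →
    s'.BoundedBy (V + N * D) ∧ t ≤ N * (1 + 2 * (V + N * D).size)

theorem Runs.mono {D N N' : ℕ} {P : RamProg} {s s' : RamState} (h : Runs D P s s' N)
    (hN : N ≤ N') : Runs D P s s' N' := by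
  obtain ⟨t, h, hV⟩ := h
  refine ⟨t, h, fun V hD hs => ?_⟩
  have hle : V + N * D ≤ V + N' * D := by gcongr
  exact ⟨(hV V hD hs).1.mono hle, (hV V hD hs).2.trans
    (Nat.mul_le_mul hN (by have := Nat.size_le_size hle; omega))⟩

/-- The bound in `Runs` is quantified over all `V ≥ D`, so the second program can be started with
the bound `V + N₁ * D` that the first one leaves behind. -/
theorem Runs.seq {D N₁ N₂ : ℕ} {P Q : RamProg} {s s₁ s₂ : RamState} (h₁ : Runs D P s s₁ N₁)
    (h₂ : Runs D Q s₁ s₂ N₂) : Runs D (P.seq Q) s s₂ (N₁ + N₂) := by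
  obtain ⟨t₁, e₁, b₁⟩ := h₁
  obtain ⟨t₂, e₂, b₂⟩ := h₂
  refine ⟨t₁ + t₂, e₁.seq e₂, fun V hD hs => ?_⟩
  obtain ⟨c₁, d₁⟩ := b₁ V hD hs
  obtain ⟨c₂, d₂⟩ := b₂ _ (by omega) c₁
  have e : V + N₁ * D + N₂ * D = V + (N₁ + N₂) * D := by ring
  rw [e] at c₂ d₂
  refine ⟨c₂, ?_⟩
  have := Nat.size_le_size (show V + N₁ * D ≤ V + (N₁ + N₂) * D by gcongr; omega)
  calc t₁ + t₂ ≤ N₁ * (1 + 2 * (V + (N₁ + N₂) * D).size)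
        + N₂ * (1 + 2 * (V + (N₁ + N₂) * D).size) :=
        add_le_add (d₁.trans (Nat.mul_le_mul le_rfl (by omega))) d₂
    _ = _ := by ring

theorem Runs.of_instr {D : ℕ} {P : RamProg} {s s' : RamState} {t : ℕ} (h : Exec P s s' t)
    (hs : ∀ V, D ≤ V → s.BoundedBy V → s'.BoundedBy (V + D) ∧ t ≤ 1 + 2 * V.size) :
    Runs D P s s' 1 := by
  refine ⟨t, h, fun V hD hV => ?_⟩
  rw [one_mul, one_mul]
  have := Nat.size_le_size (Nat.le_add_right V D)
  exact ⟨(hs V hD hV).1, (hs V hD hV).2.trans (by omega)⟩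

theorem runs_skip (D : ℕ) (s : RamState) : Runs D .skip s s 1 :=
  .of_instr (.skip s) fun V _ hV => ⟨hV.mono (by omega), by omega⟩

theorem runs_const {D k : ℕ} (hk : k ≤ D) (s : RamState) (d : ℕ) :
    Runs D (.const d k) s (s.setReg d k) 1 := by
  refine .of_instr (.const s d k) fun V hD hV => ⟨(hV.setReg (by omega) d).mono (by omega), ?_⟩
  have := Nat.size_le_size (hk.trans hD)
  omega

theorem runs_copy (D : ℕ) (s : RamState) (d a : ℕ) :
    Runs D (.copy d a) s (s.setReg d (s.reg a)) 1 := by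
  refine .of_instr (.copy s d a) fun V _ hV => ⟨(hV.setReg (hV.1 a) d).mono (by omega), ?_⟩
  have := Nat.size_le_size (hV.1 a)
  omega

/-- Addition is the only instruction that can push a number beyond `V`; the condition on the second
operand limits the growth to `D` per instruction, so that numbers grow linearly and not
exponentially. -/
theorem runs_add {D : ℕ} {s : RamState} {b : ℕ} (hb : s.reg b ≤ D) (d a : ℕ) :
    Runs D (.add d a b) s (s.setReg d (s.reg a + s.reg b)) 1 := by
  refine .of_instr (.add s d a b) fun V _ hV => ⟨?_, ?_⟩
  · exact (hV.mono (Nat.le_add_right V D)).setReg (add_le_add (hV.1 a) hb) d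
  · have := Nat.size_le_size (hV.1 a)
    have := Nat.size_le_size (hV.1 b)
    omega

theorem runs_sub (D : ℕ) (s : RamState) (d a b : ℕ) :
    Runs D (.sub d a b) s (s.setReg d (s.reg a - s.reg b)) 1 := by
  refine .of_instr (.sub s d a b) fun V _ hV => ⟨?_, ?_⟩
  · exact (hV.setReg ((Nat.sub_le _ _).trans (hV.1 a)) d).mono (by omega)
  · have := Nat.size_le_size (hV.1 a)
    have := Nat.size_le_size (hV.1 b)
    omega

theorem runs_load (D : ℕ) (s : RamState) (d a : ℕ) :
    Runs D (.load d a) s (s.setReg d (s.mem (s.reg a))) 1 := by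
  refine .of_instr (.load s d a) fun V _ hV => ⟨(hV.setReg (hV.2 _) d).mono (by omega), ?_⟩
  have := Nat.size_le_size (hV.1 a)
  have := Nat.size_le_size (hV.2 (s.reg a))
  omega

theorem runs_store (D : ℕ) (s : RamState) (a b : ℕ) :
    Runs D (.store a b) s (s.setMem (s.reg a) (s.reg b)) 1 := by
  refine .of_instr (.store s a b) fun V _ hV => ⟨(hV.setMem (hV.1 b) _).mono (by omega), ?_⟩
  have := Nat.size_le_size (hV.1 a)
  have := Nat.size_le_size (hV.1 b)
  omega

/-- Common core of conditionals and loops: the cost of a test is that of one more instruction. -/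
theorem Runs.after_test {D N : ℕ} {P P' : RamProg} {s s' : RamState} {c : RamTest}
    (h : Runs D P s s' N) (hc : ∀ t, Exec P s s' t → Exec P' s s' (c.cost s + t)) :
    Runs D P' s s' (N + 1) := by
  obtain ⟨t, e, b⟩ := h
  refine ⟨_, hc t e, fun V hD hV => ?_⟩
  obtain ⟨b₁, b₂⟩ := b V hD hV
  have hle : V + N * D ≤ V + (N + 1) * D := by gcongr; omega
  refine ⟨b₁.mono hle, ?_⟩
  have h₁ := Nat.size_le_size hle
  have h₂ := Nat.size_le_size (Nat.le_add_right V ((N + 1) * D))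
  have h₃ := RamTest.cost_le (c := c) hV
  calc c.cost s + t ≤ (1 + 2 * (V + (N + 1) * D).size) + N * (1 + 2 * (V + (N + 1) * D).size) :=
        add_le_add (by omega) (b₂.trans (Nat.mul_le_mul le_rfl (by omega)))
    _ = _ := by ring

theorem Runs.condTrue {D N : ℕ} {P Q : RamProg} {s s' : RamState} {c : RamTest}
    (hc : c.Holds s) (h : Runs D P s s' N) : Runs D (.cond c P Q) s s' (N + 1) :=
  h.after_test fun _ e => .condTrue hc e

theorem Runs.condFalse {D N : ℕ} {P Q : RamProg} {s s' : RamState} {c : RamTest}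
    (hc : ¬ c.Holds s) (h : Runs D Q s s' N) : Runs D (.cond c P Q) s s' (N + 1) :=
  h.after_test fun _ e => .condFalse hc e

theorem Runs.loopDone {D : ℕ} {P : RamProg} {s : RamState} {c : RamTest}
    (hc : ¬ c.Holds s) : Runs D (.loop c P) s s 1 :=
  .of_instr (.loopDone hc) fun _ _ hV => ⟨hV.mono (by omega), RamTest.cost_le hV⟩

theorem Runs.loopStep {D N₁ N₂ : ℕ} {P : RamProg} {s s₁ s₂ : RamState} {c : RamTest}
    (hc : c.Holds s) (h₁ : Runs D P s s₁ N₁) (h₂ : Runs D (.loop c P) s₁ s₂ N₂) :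
    Runs D (.loop c P) s s₂ (N₁ + N₂ + 1) := by
  refine (h₁.seq h₂).after_test (c := c) fun t e => ?_
  cases e with
  | seq e₁ e₂ => simpa [add_assoc] using Exec.loopStep hc e₁ e₂

/-- The registers that a program may write. -/
def written : RamProg → List ℕ
  | .skip | .store _ _ => []
  | .const d _ | .copy d _ | .add d _ _ | .sub d _ _ | .load d _ => [d]
  | .seq P Q | .cond _ P Q => P.written ++ Q.written
  | .loop _ P => P.written

/-- The frame rule for registers. For a concrete program its condition is settled by `decide`. -/
theorem Exec.reg_eq {P : RamProg} {s s' : RamState} {t : ℕ} (h : Exec P s s' t) {k : ℕ}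
    (hk : k ∉ P.written) : s'.reg k = s.reg k := by
  induction h with
  | skip | store => rfl
  | const | copy | add | sub | load =>
    simp only [written, List.mem_singleton] at hk
    simp [hk]
  | seq _ _ ih₁ ih₂ =>
    simp only [written, List.mem_append, not_or] at hk
    rw [ih₂ hk.2, ih₁ hk.1]
  | condTrue _ _ ih =>
    simp only [written, List.mem_append, not_or] at hk
    exact ih hk.1
  | condFalse _ _ ih =>
    simp only [written, List.mem_append, not_or] at hk
    exact ih hk.2
  | loopDone => rfl
  | loopStep _ _ _ ih₁ ih₂ => rw [ih₂ hk, ih₁ hk]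

theorem Runs.reg_eq {D N : ℕ} {P : RamProg} {s s' : RamState} (h : Runs D P s s' N) {k : ℕ}
    (hk : k ∉ P.written) : s'.reg k = s.reg k :=
  h.choose_spec.1.reg_eq hk

/-- Verification condition of a loop-free program for the postcondition `Q`. -/
def vc (D : ℕ) : RamProg → (RamState → Prop) → RamState → Prop
  | .skip, Q, s => Q s
  | .const d k, Q, s => k ≤ D ∧ Q (s.setReg d k)
  | .copy d a, Q, s => Q (s.setReg d (s.reg a))
  | .add d a b, Q, s => s.reg b ≤ D ∧ Q (s.setReg d (s.reg a + s.reg b))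
  | .sub d a b, Q, s => Q (s.setReg d (s.reg a - s.reg b))
  | .load d a, Q, s => Q (s.setReg d (s.mem (s.reg a)))
  | .store a b, Q, s => Q (s.setMem (s.reg a) (s.reg b))
  | .seq P P', Q, s => P.vc D (P'.vc D Q) s
  | .cond c P P', Q, s => (c.Holds s → P.vc D Q s) ∧ (¬ c.Holds s → P'.vc D Q s)
  | .loop _ _, _, _ => False

/-- A bound on the number of instructions executed by a loop-free program. -/
def length : RamProg → ℕ
  | .seq P Q => P.length + Q.length
  | .cond _ P Q => max P.length Q.length + 1
  | _ => 1

/-- Soundness of the verification conditions, which reduces loop-free code to `simp` and `omega`.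
Loops have the condition `False` and are treated by separate inductions. -/
theorem exists_runs_of_vc {D : ℕ} {P : RamProg} {Q : RamState → Prop} {s : RamState}
    (h : P.vc D Q s) : ∃ s', Runs D P s s' P.length ∧ Q s' := by
  induction P generalizing Q s with
  | skip => exact ⟨_, runs_skip D s, h⟩
  | const d k => exact ⟨_, runs_const h.1 s d, h.2⟩
  | copy d a => exact ⟨_, runs_copy D s d a, h⟩
  | add d a b => exact ⟨_, runs_add h.1 d a, h.2⟩
  | sub d a b => exact ⟨_, runs_sub D s d a b, h⟩
  | load d a => exact ⟨_, runs_load D s d a, h⟩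
  | store a b => exact ⟨_, runs_store D s a b, h⟩
  | seq P P' ih ih' =>
    obtain ⟨s₁, h₁, q₁⟩ := ih h
    obtain ⟨s₂, h₂, q₂⟩ := ih' q₁
    exact ⟨s₂, h₁.seq h₂, q₂⟩
  | cond c P P' ih ih' =>
    by_cases hc : c.Holds s
    · obtain ⟨s₁, h₁, q₁⟩ := ih (h.1 hc)
      exact ⟨s₁, (h₁.condTrue hc).mono (by simp [length]), q₁⟩
    · obtain ⟨s₁, h₁, q₁⟩ := ih' (h.2 hc)
      exact ⟨s₁, (h₁.condFalse hc).mono (by simp [length]), q₁⟩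
  | loop => exact h.elim

/-- Sequential composition of a list of programs. -/
def block : List RamProg → RamProg
  | [] => .skip
  | [P] => P
  | P :: l => .seq P (block l)

end RamProg

/-- The numbers in `l` are stored in the memory cells `a, a + 1, …`. -/
def Enc (mem : ℕ → ℕ) : ℕ → List ℕ → Prop
  | _, [] => True
  | a, x :: l => mem a = x ∧ Enc mem (a + 1) l

@[simp] theorem enc_nil (mem : ℕ → ℕ) (a : ℕ) : Enc mem a [] := trivial

@[simp] theorem enc_cons {mem : ℕ → ℕ} {a x : ℕ} {l : List ℕ} :
    Enc mem a (x :: l) ↔ mem a = x ∧ Enc mem (a + 1) l := Iff.rfl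

theorem enc_append {mem : ℕ → ℕ} {a : ℕ} {l l' : List ℕ} :
    Enc mem a (l ++ l') ↔ Enc mem a l ∧ Enc mem (a + l.length) l' := by
  induction l generalizing a with
  | nil => simp
  | cons x l ih => simp [ih, and_assoc, add_assoc, add_comm 1]

/-- The frame rule for lists in memory. -/
theorem Enc.congr {mem mem' : ℕ → ℕ} {a : ℕ} {l : List ℕ} (h : Enc mem a l)
    (h' : ∀ k, a ≤ k → k < a + l.length → mem' k = mem k) : Enc mem' a l := by
  induction l generalizing a with
  | nil => trivial
  | cons x l ih =>
    refine ⟨(h' a le_rfl (by simp)).trans h.1, ih h.2 fun k hk hk' => h' k (by omega) ?_⟩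
    simp only [List.length_cons]
    omega

/-! ## Construction of the input-output graph -/

namespace Jedi

open RamProg RamTest

/-- Cells from `B` to `H` hold a trie with node set `S`: the node `u` is a record of three cells
at the address `addr u`, namely the addresses of its two children (`0` if missing) and a label. -/
structure IsTrie (B H : ℕ) (S : Set (List ℕ)) (addr lab : List ℕ → ℕ) (mem : ℕ → ℕ) : Prop where
  nil_mem : [] ∈ S
  addr_nil : addr [] = B
  closed : ∀ u b, u ++ [b] ∈ S → u ∈ S
  range : ∀ u ∈ S, ∃ k, addr u = B + 3 * k ∧ addr u + 3 ≤ H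
  inj : ∀ u ∈ S, ∀ v ∈ S, addr u = addr v → u = v
  child : ∀ u ∈ S, ∀ b < 2, u ++ [b] ∈ S → mem (addr u + b) = addr (u ++ [b])
  no_child : ∀ u ∈ S, ∀ b < 2, u ++ [b] ∉ S → mem (addr u + b) = 0
  label : ∀ u ∈ S, mem (addr u + 2) = lab u
  zero : ∀ a, H ≤ a → mem a = 0
  next : ∃ k, H = B + 3 * k

namespace IsTrie

variable {B H : ℕ} {S : Set (List ℕ)} {addr lab : List ℕ → ℕ} {mem : ℕ → ℕ}

/-- Only the root can have address `0`, and the root is nobody's child. Hence `0` can serve as the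
null pointer even if the trie starts at `B = 0`. -/
theorem pos_of_append (h : IsTrie B H S addr lab mem) {u : List ℕ} {b : ℕ} (hu : u ++ [b] ∈ S) :
    addr (u ++ [b]) ≠ 0 := by
  intro h0
  obtain ⟨k, hk, -⟩ := h.range _ hu
  have := h.inj _ hu _ h.nil_mem (by rw [h.addr_nil]; omega)
  simp at this

/-- All addresses of records are congruent to `B` modulo `3`, so distinct records do not overlap. -/
theorem eq_of_addr_eq (h : IsTrie B H S addr lab mem) {u v : List ℕ} (hu : u ∈ S) (hv : v ∈ S)
    {b c : ℕ} (hb : b < 3) (hc : c < 3) (he : addr u + b = addr v + c) : u = v ∧ b = c := by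
  obtain ⟨k, hk, -⟩ := h.range u hu
  obtain ⟨l, hl, -⟩ := h.range v hv
  exact ⟨h.inj u hu v hv (by omega), by omega⟩

theorem setLabel (h : IsTrie B H S addr lab mem) {u : List ℕ} (hu : u ∈ S) (i : ℕ) :
    IsTrie B H S addr (Function.update lab u i) (Function.update mem (addr u + 2) i) where
  nil_mem := h.nil_mem
  addr_nil := h.addr_nil
  closed := h.closed
  range := h.range
  inj := h.inj
  child v hv b hb hvb := by
    rw [Function.update_of_ne, h.child v hv b hb hvb]
    intro he
    have := h.eq_of_addr_eq hv hu (by omega) (by omega) he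
    omega
  no_child v hv b hb hvb := by
    rw [Function.update_of_ne, h.no_child v hv b hb hvb]
    intro he
    have := h.eq_of_addr_eq hv hu (by omega) (by omega) he
    omega
  label v hv := by
    by_cases hvu : v = u
    · simp [hvu]
    · rw [Function.update_of_ne, Function.update_of_ne hvu, h.label v hv]
      exact fun he => hvu (h.eq_of_addr_eq hv hu (by omega) (by omega) he).1
  zero a ha := by
    obtain ⟨k, -, hk⟩ := h.range u hu
    rw [Function.update_of_ne (by omega), h.zero a ha]
  next := h.next

/-- The cells from `H` on are zero, so the three cells at `H` already form a record without children
and with label `0`; the pointer in the parent is the only cell to be written. -/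
theorem insertChild (h : IsTrie B H S addr lab mem) {u : List ℕ} (hu : u ∈ S) {b : ℕ}
    (hb : b < 2) (hub : u ++ [b] ∉ S) :
    IsTrie B (H + 3) (insert (u ++ [b]) S) (Function.update addr (u ++ [b]) H)
      (Function.update lab (u ++ [b]) 0) (Function.update mem (addr u + b) H) := by
  have hne : ∀ v ∈ S, v ≠ u ++ [b] := fun v hv he => hub (he ▸ hv)
  have hlt : ∀ v ∈ S, addr v + 3 ≤ H := fun v hv => (h.range v hv).choose_spec.2
  have hself : ∀ v : List ℕ, ∀ c, v ++ [c] ≠ v := fun v c he => by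
    simpa using congrArg List.length he
  have hnew : ∀ c, (u ++ [b]) ++ [c] ∉ insert (u ++ [b]) S := fun c hc => by
    rcases hc with hc | hc
    · exact hself _ _ hc
    · exact hub (h.closed _ _ hc)
  obtain ⟨K, hK⟩ := h.next
  refine ⟨Or.inr h.nil_mem, ?_, ?_, ?_, ?_, ?_, ?_, ?_, ?_, ⟨K + 1, by omega⟩⟩
  · rw [Function.update_of_ne (hne _ h.nil_mem), h.addr_nil]
  · rintro v c (hv | hv)
    · obtain ⟨rfl, -⟩ := List.append_inj' hv rfl
      exact Or.inr hu
    · exact Or.inr (h.closed v c hv)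
  · rintro v (rfl | hv)
    · exact ⟨K, by simp [hK]⟩
    · rw [Function.update_of_ne (hne v hv)]
      obtain ⟨k, hk, hk'⟩ := h.range v hv
      exact ⟨k, hk, by omega⟩
  · rintro v (rfl | hv) w (rfl | hw) he
    · rfl
    · rw [Function.update_self, Function.update_of_ne (hne w hw)] at he
      have := hlt w hw
      omega
    · rw [Function.update_self, Function.update_of_ne (hne v hv)] at he
      have := hlt v hv
      omega
    · rw [Function.update_of_ne (hne v hv), Function.update_of_ne (hne w hw)] at he
      exact h.inj v hv w hw he
  · rintro v (rfl | hv) c hc hvc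
    · exact absurd hvc (hnew c)
    · rw [Function.update_of_ne (hne v hv)]
      by_cases he : v ++ [c] = u ++ [b]
      · obtain ⟨rfl, hcb⟩ := List.append_inj' he rfl
        obtain rfl : c = b := by simpa using hcb
        simp
      · rw [Function.update_of_ne he, Function.update_of_ne]
        · exact h.child v hv c hc (hvc.resolve_left he)
        · intro ha
          obtain ⟨rfl, rfl⟩ := h.eq_of_addr_eq hv hu (by omega) (by omega) ha
          exact he rfl
  · rintro v (rfl | hv) c hc hvc
    · rw [Function.update_self, Function.update_of_ne, h.zero _ (by omega)]
      have := hlt u hu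
      omega
    · rw [Function.update_of_ne (hne v hv), Function.update_of_ne]
      · exact h.no_child v hv c hc fun hm => hvc (Or.inr hm)
      · intro ha
        obtain ⟨rfl, rfl⟩ := h.eq_of_addr_eq hv hu (by omega) (by omega) ha
        exact hvc (Or.inl rfl)
  · rintro v (rfl | hv)
    · rw [Function.update_self, Function.update_self, Function.update_of_ne, h.zero _ (by omega)]
      have := hlt u hu
      omega
    · rw [Function.update_of_ne (hne v hv), Function.update_of_ne (hne v hv),
        Function.update_of_ne, h.label v hv]
      intro ha
      have := h.eq_of_addr_eq hv hu (by omega) (by omega) ha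
      omega
  · intro a ha
    have := hlt u hu
    rw [Function.update_of_ne (by omega), h.zero a (by omega)]

theorem congr (h : IsTrie B H S addr lab mem) {mem' : ℕ → ℕ} (hm : ∀ a < H, mem' a = mem a)
    {u : List ℕ} (hu : u ∈ S) {b : ℕ} (hb : b < 3) : mem' (addr u + b) = mem (addr u + b) := by
  obtain ⟨k, -, hk⟩ := h.range u hu
  exact hm _ (by omega)

end IsTrie

/-- Descends in the trie along one symbol, with a new node if necessary. -/
def trieStep : RamProg := block [.load 19 16, .add 20 17 19, .load 21 20,
  .cond (.eq 21 7) (block [.copy 21 15, .store 20 15, .add 15 15 10]) .skip,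
  .copy 17 21, .add 16 16 8, .add 18 18 8]

/-- Either the pointer exists and memory is unchanged, or it is null and `IsTrie.insertChild`
applies. The new addresses and labels are existentially quantified to cover both cases. -/
theorem runs_trieStep {D : ℕ} (hD : 3 ≤ D) {B H : ℕ} {S : Set (List ℕ)}
    {addr lab : List ℕ → ℕ} {s : RamState} (h : IsTrie B H S addr lab s.mem) (h7 : s.reg 7 = 0)
    (h8 : s.reg 8 = 1) (h10 : s.reg 10 = 3) {u : List ℕ} (hu : u ∈ S) (h17 : s.reg 17 = addr u)
    (h15 : s.reg 15 = H) (hb : s.mem (s.reg 16) < 2) :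
    ∃ s', Runs D trieStep s s' 10 ∧ ∃ H' addr' lab',
      IsTrie B H' (insert (u ++ [s.mem (s.reg 16)]) S) addr' lab' s'.mem ∧
      (∀ v ∈ S, lab' v = lab v) ∧ (∀ a < B, s'.mem a = s.mem a) ∧
      s'.reg 17 = addr' (u ++ [s.mem (s.reg 16)]) ∧ s'.reg 15 = H' ∧
      s'.reg 16 = s.reg 16 + 1 ∧ s'.reg 18 = s.reg 18 + 1 := by
  set b := s.mem (s.reg 16) with hbdef
  by_cases hub : u ++ [b] ∈ S
  · have h0 := h.pos_of_append hub
    have hc := h.child u hu b hb hub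
    obtain ⟨s', hs', hm, r⟩ : ∃ s', Runs D trieStep s s' 10 ∧ s'.mem = s.mem ∧
        s'.reg 17 = addr (u ++ [b]) ∧ s'.reg 15 = H ∧ s'.reg 16 = s.reg 16 + 1 ∧
        s'.reg 18 = s.reg 18 + 1 := by
      refine exists_runs_of_vc (P := trieStep) ?_
      simp [trieStep, block, vc, Holds, ← hbdef, h7, h8, h15, h17, hc, h0]
      omega
    refine ⟨s', hs', H, addr, lab, ?_, fun _ _ => rfl, fun _ _ => by rw [hm], r⟩
    rwa [Set.insert_eq_of_mem hub, hm]
  · have hc := h.no_child u hu b hb hub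
    obtain ⟨s', hs', hm, r⟩ : ∃ s', Runs D trieStep s s' 10 ∧
        s'.mem = Function.update s.mem (addr u + b) H ∧
        s'.reg 17 = H ∧ s'.reg 15 = H + 3 ∧ s'.reg 16 = s.reg 16 + 1 ∧
        s'.reg 18 = s.reg 18 + 1 := by
      refine exists_runs_of_vc (P := trieStep) ?_
      simp [trieStep, block, vc, Holds, ← hbdef, h7, h8, h10, h15, h17, hc]
      omega
    refine ⟨s', hs', H + 3, _, _, hm ▸ h.insertChild hu hb hub, ?_, ?_, by simpa using r⟩
    · intro v hv
      rw [Function.update_of_ne fun he : v = u ++ [b] => hub (he ▸ hv)]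
    · intro a ha
      obtain ⟨k, hk, -⟩ := h.range u hu
      rw [hm, Function.update_of_ne (by omega)]

end Jedi

/-! ### Insertion of the codewords into the trie. -/

namespace Jedi

open RamProg RamTest

/-- The first `t` symbols of a word. -/
def pref (w : ℕ → ℕ) (t : ℕ) : List ℕ := (List.range t).map w

@[simp] theorem pref_zero (w : ℕ → ℕ) : pref w 0 = [] := rfl

theorem pref_succ (w : ℕ → ℕ) (t : ℕ) : pref w (t + 1) = pref w t ++ [w t] := by
  simp [pref, List.range_succ]

@[simp] theorem length_pref (w : ℕ → ℕ) (t : ℕ) : (pref w t).length = t := by simp [pref]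

theorem pref_inj {w w' : ℕ → ℕ} {t : ℕ} : pref w t = pref w' t ↔ ∀ k < t, w k = w' k := by
  simp [pref]

/-- Induction on the number `k` of symbols still to be read, for all tries at once, since every
symbol may change the trie. -/
theorem runs_trieLoop {D : ℕ} (hD : 3 ≤ D) {B n a : ℕ} {w : ℕ → ℕ} (hw : ∀ t < n, w t < 2)
    (ha : a + n ≤ B) (k : ℕ) : ∀ {t : ℕ}, t + k = n → ∀ {H : ℕ} {S : Set (List ℕ)}
    {addr lab : List ℕ → ℕ} {s : RamState}, IsTrie B H S addr lab s.mem → s.reg 0 = n →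
    s.reg 7 = 0 → s.reg 8 = 1 → s.reg 10 = 3 → pref w t ∈ S → s.reg 17 = addr (pref w t) →
    s.reg 15 = H → (∀ t < n, s.mem (a + t) = w t) → s.reg 16 = a + t → s.reg 18 = t →
    ∃ s', Runs D (.loop (.lt 18 0) trieStep) s s' (11 * k + 1) ∧ ∃ H' addr' lab',
      IsTrie B H' (S ∪ {u | ∃ t', t ≤ t' ∧ t' ≤ n ∧ u = pref w t'}) addr' lab' s'.mem ∧
      (∀ v ∈ S, lab' v = lab v) ∧ (∀ a < B, s'.mem a = s.mem a) ∧
      s'.reg 17 = addr' (pref w n) ∧ s'.reg 15 = H' ∧ s'.reg 16 = a + n := by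
  induction k with
  | zero =>
    intro t ht H S addr lab s h h0 h7 h8 h10 hu h17 h15 hm h16 h18
    obtain rfl : t = n := by omega
    refine ⟨s, .loopDone (by simp [Holds, h0, h18]), H, addr, lab, ?_, fun _ _ => rfl,
      fun _ _ => rfl, h17, h15, h16⟩
    convert h using 1
    ext u
    constructor
    · rintro (hu' | ⟨t', h₁, h₂, rfl⟩)
      · exact hu'
      · obtain rfl : t' = t := by omega
        exact hu
    · exact Or.inl
  | succ k ih =>
    intro t ht H S addr lab s h h0 h7 h8 h10 hu h17 h15 hm h16 h18
    have hmt : s.mem (s.reg 16) = w t := by rw [h16, hm t (by omega)]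
    obtain ⟨s₁, hs₁, H₁, addr₁, lab₁, h₁, hl₁, hm₁, r17, r15, r16, r18⟩ :=
      runs_trieStep hD h h7 h8 h10 hu h17 h15 (by rw [hmt]; exact hw t (by omega))
    rw [hmt, ← pref_succ] at h₁ r17
    obtain ⟨s₂, hs₂, H₂, addr₂, lab₂, h₂, hl₂, hm₂, q⟩ := ih (t := t + 1) (by omega) h₁
      (by rw [hs₁.reg_eq (by decide), h0]) (by rw [hs₁.reg_eq (by decide), h7])
      (by rw [hs₁.reg_eq (by decide), h8]) (by rw [hs₁.reg_eq (by decide), h10])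
      (Or.inl rfl) r17 r15 (fun t' ht' => by rw [hm₁ _ (by omega), hm t' ht'])
      (by rw [r16, h16]; ring) (by rw [r18, h18])
    refine ⟨s₂, (Runs.loopStep (by simp only [Holds]; omega) hs₁ hs₂).mono (by omega),
      H₂, addr₂, lab₂, ?_, fun v hv => ?_, fun a ha => ?_, q⟩
    · convert h₂ using 1
      ext u
      constructor
      · rintro (hu' | ⟨t', h₁, h₂, rfl⟩)
        · exact Or.inl (Or.inr hu')
        · rcases h₁.eq_or_lt with rfl | h₁
          · exact Or.inl (Or.inr hu)
          · exact Or.inr ⟨t', h₁, h₂, rfl⟩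
      · rintro ((rfl | hu') | ⟨t', h₁, h₂, rfl⟩)
        · exact Or.inr ⟨t + 1, by omega, by omega, rfl⟩
        · exact Or.inl hu'
        · exact Or.inr ⟨t', by omega, h₂, rfl⟩
    · rw [hl₂ v (Or.inr hv), hl₁ v hv]
    · rw [hm₂ a ha, hm₁ a ha]

/-- Inserts one word into the trie. -/
def insertWord : RamProg :=
  .seq (block [.copy 17 14, .const 18 0]) (.seq (.loop (.lt 18 0) trieStep)
    (block [.add 20 17 9, .store 20 11, .add 11 11 8]))

/-- The nodes of the trie of the first `i` words. -/
def prefixes (xs : ℕ → ℕ → ℕ) (n i : ℕ) : Set (List ℕ) :=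
  {u | u = [] ∨ ∃ i' < i, ∃ t ≤ n, u = pref (xs i') t}

/-- The trie of the words `xs 0, …, xs (i - 1)`, labelled by their numbers. -/
def IsWordTrie (B H : ℕ) (xs : ℕ → ℕ → ℕ) (n i : ℕ) (addr : List ℕ → ℕ) (mem : ℕ → ℕ) : Prop :=
  ∃ lab, IsTrie B H (prefixes xs n i) addr lab mem ∧ ∀ i' < i, lab (pref (xs i') n) = i'

/-- Since the codewords are distinct, the label written at the end of the new word does not
overwrite an earlier one. -/
theorem runs_insertWord {D : ℕ} (hD : 3 ≤ D) {B H n i : ℕ} {xs : ℕ → ℕ → ℕ}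
    (hxs : ∀ i' < i, pref (xs i') n ≠ pref (xs i) n) (hw : ∀ t < n, xs i t < 2)
    {addr : List ℕ → ℕ} {s : RamState} (h : IsWordTrie B H xs n i addr s.mem)
    (ha : i * n + n ≤ B) (h0 : s.reg 0 = n) (h7 : s.reg 7 = 0) (h8 : s.reg 8 = 1)
    (h9 : s.reg 9 = 2) (h10 : s.reg 10 = 3) (h11 : s.reg 11 = i) (h14 : s.reg 14 = B)
    (h15 : s.reg 15 = H) (hm : ∀ t < n, s.mem (i * n + t) = xs i t) (h16 : s.reg 16 = i * n) :
    ∃ s', Runs D insertWord s s' (11 * n + 6) ∧ ∃ H' addr',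
      IsWordTrie B H' xs n (i + 1) addr' s'.mem ∧ (∀ a < B, s'.mem a = s.mem a) ∧
      s'.reg 11 = i + 1 ∧ s'.reg 15 = H' ∧ s'.reg 16 = (i + 1) * n := by
  obtain ⟨lab, h, hlab⟩ := h
  obtain ⟨s₁, hs₁, m₁, r17, r18⟩ : ∃ s', Runs D (block [.copy 17 14, .const 18 0]) s s' 2 ∧
      s'.mem = s.mem ∧ s'.reg 17 = B ∧ s'.reg 18 = 0 := by
    refine exists_runs_of_vc (P := block [.copy 17 14, .const 18 0]) ?_
    simp [block, vc, h14]
  obtain ⟨s₂, hs₂, H', addr', lab', h', hl, m₂, q17, q15, q16⟩ :=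
    runs_trieLoop hD hw ha n (t := 0) (by omega) (m₁ ▸ h)
      (by rw [hs₁.reg_eq (by decide), h0]) (by rw [hs₁.reg_eq (by decide), h7])
      (by rw [hs₁.reg_eq (by decide), h8]) (by rw [hs₁.reg_eq (by decide), h10])
      (Or.inl rfl) (by rw [r17, pref_zero, h.addr_nil])
      (by rw [hs₁.reg_eq (by decide), h15]) (fun t ht => by rw [m₁, hm t ht])
      (by rw [hs₁.reg_eq (by decide), h16]; ring) r18
  obtain ⟨s₃, hs₃, m₃, p11⟩ : ∃ s', Runs D (block [.add 20 17 9, .store 20 11, .add 11 11 8]) s₂ s' 3 ∧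
      s'.mem = Function.update s₂.mem (addr' (pref (xs i) n) + 2) i ∧ s'.reg 11 = i + 1 := by
    refine exists_runs_of_vc (P := block [.add 20 17 9, .store 20 11, .add 11 11 8]) ?_
    have e9 : s₂.reg 9 = 2 := by rw [hs₂.reg_eq (by decide), hs₁.reg_eq (by decide), h9]
    have e8 : s₂.reg 8 = 1 := by rw [hs₂.reg_eq (by decide), hs₁.reg_eq (by decide), h8]
    have e11 : s₂.reg 11 = i := by rw [hs₂.reg_eq (by decide), hs₁.reg_eq (by decide), h11]
    simp [block, vc, q17, e9, e8, e11]
    omega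
  have hS : prefixes xs n i ∪ {u | ∃ t', 0 ≤ t' ∧ t' ≤ n ∧ u = pref (xs i) t'} =
      prefixes xs n (i + 1) := by
    ext u
    constructor
    · rintro ((rfl | ⟨i', hi', t, ht, rfl⟩) | ⟨t, -, ht, rfl⟩)
      · exact Or.inl rfl
      · exact Or.inr ⟨i', by omega, t, ht, rfl⟩
      · exact Or.inr ⟨i, by omega, t, ht, rfl⟩
    · rintro (rfl | ⟨i', hi', t, ht, rfl⟩)
      · exact Or.inl (Or.inl rfl)
      · rcases Nat.lt_succ_iff_lt_or_eq.1 hi' with hi' | rfl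
        · exact Or.inl (Or.inr ⟨i', hi', t, ht, rfl⟩)
        · exact Or.inr ⟨t, by omega, ht, rfl⟩
  rw [hS] at h'
  have hmem : pref (xs i) n ∈ prefixes xs n (i + 1) := Or.inr ⟨i, by omega, n, le_rfl, rfl⟩
  refine ⟨s₃, (hs₁.seq (hs₂.seq hs₃)).mono (by omega), H', addr', ⟨_, m₃ ▸ h'.setLabel hmem i, ?_⟩,
    fun a ha => ?_, p11, ?_, ?_⟩
  · intro i' hi'
    rcases Nat.lt_succ_iff_lt_or_eq.1 hi' with hi' | rfl
    · rw [Function.update_of_ne (hxs i' hi'), hl _ (Or.inr ⟨i', hi', n, le_rfl, rfl⟩), hlab i' hi']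
    · simp
  · obtain ⟨k, hk, -⟩ := h'.range _ hmem
    rw [m₃, Function.update_of_ne (by omega), m₂ a ha, m₁]
  · rw [hs₃.reg_eq (by decide), q15]
  · rw [hs₃.reg_eq (by decide), q16]
    ring

theorem runs_insertWords {D : ℕ} (hD : 3 ≤ D) {B n M : ℕ} {xs : ℕ → ℕ → ℕ}
    (hxs : ∀ i < M, ∀ i' < M, pref (xs i') n = pref (xs i) n → i' = i)
    (hw : ∀ i < M, ∀ t < n, xs i t < 2) (hB : M * n ≤ B) (k : ℕ) :
    ∀ {i : ℕ}, i + k = M → ∀ {H : ℕ} {addr : List ℕ → ℕ} {s : RamState},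
    IsWordTrie B H xs n i addr s.mem → s.reg 0 = n → s.reg 1 = M → s.reg 7 = 0 → s.reg 8 = 1 →
    s.reg 9 = 2 → s.reg 10 = 3 → s.reg 11 = i → s.reg 14 = B → s.reg 15 = H →
    (∀ i < M, ∀ t < n, s.mem (i * n + t) = xs i t) → s.reg 16 = i * n →
    ∃ s', Runs D (.loop (.lt 11 1) insertWord) s s' ((11 * n + 7) * k + 1) ∧ ∃ H' addr',
      IsWordTrie B H' xs n M addr' s'.mem ∧ (∀ a < B, s'.mem a = s.mem a) ∧
      s'.reg 15 = H' ∧ s'.reg 16 = M * n := by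
  induction k with
  | zero =>
    intro i hi H addr s h h0 h1 h7 h8 h9 h10 h11 h14 h15 hm h16
    obtain rfl : i = M := by omega
    exact ⟨s, .loopDone (by simp [Holds, h1, h11]), H, addr, h, fun _ _ => rfl, h15, h16⟩
  | succ k ih =>
    intro i hi H addr s h h0 h1 h7 h8 h9 h10 h11 h14 h15 hm h16
    have hle : ∀ i < M, i * n + n ≤ M * n := fun i hi => by
      rw [← Nat.succ_mul]
      exact Nat.mul_le_mul_right n hi
    obtain ⟨s₁, hs₁, H₁, addr₁, t₁, m₁, r11, r15, r16⟩ := runs_insertWord hD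
      (fun i' hi' he => hi'.ne (hxs i (by omega) i' (by omega) he)) (hw i (by omega)) h
      ((hle i (by omega)).trans hB) h0 h7 h8 h9 h10 h11 h14 h15 (hm i (by omega)) h16
    obtain ⟨s₂, hs₂, H₂, addr₂, t₂, m₂, q⟩ := ih (i := i + 1) (by omega) t₁
      (by rw [hs₁.reg_eq (by decide), h0]) (by rw [hs₁.reg_eq (by decide), h1])
      (by rw [hs₁.reg_eq (by decide), h7]) (by rw [hs₁.reg_eq (by decide), h8])
      (by rw [hs₁.reg_eq (by decide), h9]) (by rw [hs₁.reg_eq (by decide), h10])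
      r11 (by rw [hs₁.reg_eq (by decide), h14]) r15
      (fun i hi t ht => by
        have := hle i hi
        rw [m₁ _ (by omega), hm i hi t ht]) r16
    refine ⟨s₂, (Runs.loopStep (by simp only [Holds]; omega) hs₁ hs₂).mono (by ring_nf; omega),
      H₂, addr₂, t₂, fun a ha => by rw [m₂ a ha, m₁ a ha], q⟩

end Jedi

/-! ### One step of the search: continuations of a candidate. -/

namespace Jedi

open RamProg RamTest

/-- `mem'` arises from `mem` by appending the list `l` at the address `T`, all cells from there on
having been zero. -/
structure Appends (mem mem' : ℕ → ℕ) (T : ℕ) (l : List ℕ) : Prop where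
  enc : Enc mem' T l
  same : ∀ a < T, mem' a = mem a
  zero : (∀ a, T ≤ a → mem a = 0) → ∀ a, T + l.length ≤ a → mem' a = 0

theorem Appends.nil (mem : ℕ → ℕ) (T : ℕ) : Appends mem mem T [] :=
  ⟨trivial, fun _ _ => rfl, fun h a ha => h a (by simpa using ha)⟩

theorem Appends.trans {mem₁ mem₂ mem₃ : ℕ → ℕ} {T : ℕ} {l l' : List ℕ}
    (h : Appends mem₁ mem₂ T l) (h' : Appends mem₂ mem₃ (T + l.length) l') :
    Appends mem₁ mem₃ T (l ++ l') where
  enc := enc_append.2 ⟨h.enc.congr fun k _ hk => h'.same k hk, h'.enc⟩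
  same a ha := by rw [h'.same a (by omega), h.same a ha]
  zero hz a ha := h'.zero (fun a ha => h.zero hz a ha) a (by simpa [add_assoc] using ha)

theorem Appends.enc_of_le {mem mem' : ℕ → ℕ} {T : ℕ} {l : List ℕ} (h : Appends mem mem' T l)
    {a : ℕ} {l' : List ℕ} (he : Enc mem a l') (ha : a + l'.length ≤ T) : Enc mem' a l' :=
  he.congr fun k _ hk => h.same k (by omega)

theorem appends_one (mem : ℕ → ℕ) (T x : ℕ) : Appends mem (Function.update mem T x) T [x] where
  enc := by simp
  same a ha := Function.update_of_ne ha.ne _ _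
  zero hz a ha := by
    simp only [List.length_singleton] at ha
    rw [Function.update_of_ne (by omega), hz a (by omega)]

theorem appends_two (mem : ℕ → ℕ) (T x y : ℕ) :
    Appends mem (Function.update (Function.update mem T x) (T + 1) y) T [x, y] :=
  (appends_one mem T x).trans (appends_one _ _ y)

theorem appends_three (mem : ℕ → ℕ) (T x y z : ℕ) :
    Appends mem (Function.update (Function.update (Function.update mem T x) (T + 1) y)
      (T + 2) z) T [x, y, z] :=
  (appends_two mem T x y).trans (appends_one _ _ z)

/-- Appends the registers `a`, `16`, `11` to the list of candidates. -/
def pushCandidate (a : ℕ) : RamProg := block [.store 23 a, .add 23 23 8, .store 23 16,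
  .add 23 23 8, .store 23 11, .add 23 23 8]

theorem runs_pushCandidate {D : ℕ} (hD : 3 ≤ D) {s : RamState} (h8 : s.reg 8 = 1) (a : ℕ) :
    ∃ s', Runs D (pushCandidate a) s s' 6 ∧
      Appends s.mem s'.mem (s.reg 23) [s.reg a, s.reg 16, s.reg 11] ∧
      s'.reg 23 = s.reg 23 + 3 := by
  obtain ⟨s', hs', hm, r⟩ : ∃ s', Runs D (pushCandidate a) s s' 6 ∧
      s'.mem = Function.update (Function.update (Function.update s.mem (s.reg 23) (s.reg a))
        (s.reg 23 + 1) (s.reg 16)) (s.reg 23 + 2) (s.reg 11) ∧ s'.reg 23 = s.reg 23 + 3 := by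
    refine exists_runs_of_vc (P := pushCandidate a) ?_
    simp [pushCandidate, block, vc, h8]
    omega
  exact ⟨s', hs', hm ▸ appends_three _ _ _ _ _, r⟩

/-- One branch of the search: follows the child pointer in register `21` unless it is missing. -/
def tryChild : RamProg := .cond (.eq 21 7) .skip (pushCandidate 21)

theorem runs_tryChild {D : ℕ} (hD : 3 ≤ D) {s : RamState} (h7 : s.reg 7 = 0) (h8 : s.reg 8 = 1) :
    ∃ s', Runs D tryChild s s' 7 ∧ Appends s.mem s'.mem (s.reg 23)
      (if s.reg 21 = 0 then [] else [s.reg 21, s.reg 16, s.reg 11]) ∧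
      s'.reg 23 = s.reg 23 + (if s.reg 21 = 0 then [] else [s.reg 21, s.reg 16, s.reg 11]).length := by
  by_cases h : s.reg 21 = 0
  · refine ⟨s, (Runs.condTrue (by simp [Holds, h, h7]) (runs_skip D s)).mono (by omega), ?_, ?_⟩
    · simpa [h] using Appends.nil _ _
    · simp [h]
  · obtain ⟨s', hs', hm, r⟩ := runs_pushCandidate hD h8 21
    exact ⟨s', Runs.condFalse (by simp [Holds, h, h7]) hs', by simpa [h] using hm, by simp [h, r]⟩

/-- Replaces a candidate of the search by its matching continuations. -/
def searchStep : RamProg :=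
  .seq (block [.load 17 22, .add 22 22 8, .load 16 22, .add 22 22 8, .load 11 22, .add 22 22 8,
    .load 19 16, .add 16 16 8])
  (.seq (.cond (.eq 19 8) .skip (.seq (.load 21 17) tryChild))
    (.cond (.eq 19 7) .skip (.seq (block [.add 17 17 8, .load 21 17]) tryChild)))

open Classical in
/-- The child with symbol `b` of the candidate `x` for the output `x.2`, if it belongs to the node
set `S` and matches the symbol `t` of this output. -/
noncomputable def continuation (S : Set (List ℕ)) (ys : ℕ → ℕ → ℕ) (t b : ℕ)
    (x : List ℕ × ℕ) : List (List ℕ × ℕ) :=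
  if ys x.2 t ≠ 1 - b ∧ x.1 ++ [b] ∈ S then [(x.1 ++ [b], x.2)] else []

/-- The matching continuations of a candidate. -/
noncomputable def continuations (S : Set (List ℕ)) (ys : ℕ → ℕ → ℕ) (t : ℕ)
    (x : List ℕ × ℕ) : List (List ℕ × ℕ) :=
  continuation S ys t 0 x ++ continuation S ys t 1 x

/-- Representation in memory of a candidate at depth `t`. -/
def candidateCode (addr : List ℕ → ℕ) (base : ℕ → ℕ) (t : ℕ) (x : List ℕ × ℕ) : List ℕ :=
  [addr x.1, base x.2 + t, x.2]

/-- The branch with symbol `b` is skipped if and only if the output shows `1 - b`; an erasure, coded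
by `2`, therefore opens both branches. The pointers that are read lie below `H` and are not affected
by the candidates appended above. -/
theorem runs_searchStep {D : ℕ} (hD : 3 ≤ D) {B H t : ℕ} {S : Set (List ℕ)}
    {addr lab : List ℕ → ℕ} {base : ℕ → ℕ} {ys : ℕ → ℕ → ℕ} {mem₀ : ℕ → ℕ}
    (h : IsTrie B H S addr lab mem₀) {s : RamState} (hm : ∀ a < H, s.mem a = mem₀ a)
    (h7 : s.reg 7 = 0) (h8 : s.reg 8 = 1) {x : List ℕ × ℕ} (hx : x.1 ∈ S)
    (henc : Enc s.mem (s.reg 22) (candidateCode addr base t x))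
    (hy : s.mem (base x.2 + t) = ys x.2 t) (hT : H ≤ s.reg 23) :
    ∃ s', Runs D searchStep s s' 30 ∧
      Appends s.mem s'.mem (s.reg 23)
        ((continuations S ys t x).flatMap (candidateCode addr base (t + 1))) ∧
      s'.reg 22 = s.reg 22 + 3 ∧
      s'.reg 23 = s.reg 23 + 3 * (continuations S ys t x).length := by
  obtain ⟨u, j⟩ := x
  simp only [candidateCode, enc_cons, enc_nil, and_true] at henc hy hx
  obtain ⟨e0, e1, e2⟩ := henc
  obtain ⟨s₁, hs₁, m₁, r17, r16, r11, r19, r22⟩ : ∃ s', Runs D (block [.load 17 22, .add 22 22 8,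
      .load 16 22, .add 22 22 8, .load 11 22, .add 22 22 8, .load 19 16, .add 16 16 8]) s s' 8 ∧
      s'.mem = s.mem ∧ s'.reg 17 = addr u ∧ s'.reg 16 = base j + (t + 1) ∧ s'.reg 11 = j ∧
      s'.reg 19 = ys j t ∧ s'.reg 22 = s.reg 22 + 3 := by
    refine exists_runs_of_vc (P := block [.load 17 22, .add 22 22 8,
      .load 16 22, .add 22 22 8, .load 11 22, .add 22 22 8, .load 19 16, .add 16 16 8]) ?_
    simp only [add_assoc, Nat.reduceAdd] at e2
    simp [block, vc, h8, e0, e1, e2, hy, add_assoc]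
    omega
  have f7 : s₁.reg 7 = 0 := by rw [hs₁.reg_eq (by decide), h7]
  have f8 : s₁.reg 8 = 1 := by rw [hs₁.reg_eq (by decide), h8]
  have f23 : s₁.reg 23 = s.reg 23 := hs₁.reg_eq (by decide)
  -- Stated for every memory that agrees with that of `s` below the end of the queue, because the
  -- second pointer is read after the first branch has appended its candidate.
  have hchild : ∀ b < 2, ∀ m : ℕ → ℕ, (∀ a < s.reg 23, m a = s.mem a) →
      m (addr u + b) = mem₀ (addr u + b) := fun b hb m hm' =>
    h.congr (fun a ha => by rw [hm' a (by omega), hm a ha]) hx (by omega)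
  obtain ⟨s₂, hs₂, a₂, q23⟩ : ∃ s', Runs D (.cond (.eq 19 8) .skip (.seq (.load 21 17) tryChild))
      s₁ s' 9 ∧ Appends s₁.mem s'.mem (s₁.reg 23) 
        ((continuation S ys t 0 (u, j)).flatMap (candidateCode addr base (t + 1))) ∧
      s'.reg 23 = s₁.reg 23 + 3 * (continuation S ys t 0 (u, j)).length := by
    by_cases hy1 : ys j t = 1
    · refine ⟨s₁, (Runs.condTrue (by simp [Holds, r19, f8, hy1]) (runs_skip D s₁)).mono (by omega),
        ?_⟩
      simpa [hy1, continuation] using Appends.nil _ _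
    · have hl := runs_load D s₁ 21 17
      obtain ⟨s', hs', hm', r'⟩ := runs_tryChild hD (s := s₁.setReg 21 (s₁.mem (s₁.reg 17)))
        (by simpa using f7) (by simpa using f8)
      refine ⟨s', (Runs.condFalse (by simp [Holds, r19, f8, hy1]) (hl.seq hs')).mono (by omega), ?_⟩
      have hc : s₁.mem (addr u) = mem₀ (addr u) := by
        simpa using hchild 0 (by omega) s₁.mem fun a _ => by rw [m₁]
      by_cases hu : u ++ [0] ∈ S
      · have := h.child u hx 0 (by omega) hu
        simp only [add_zero] at this
        have h0 := h.pos_of_append hu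
        simpa [hu, hy1, r17, hc, this, h0, r16, r11, candidateCode, continuation] using And.intro hm' r'
      · have := h.no_child u hx 0 (by omega) hu
        simp only [add_zero] at this
        simpa [hu, hy1, r17, hc, this, r16, r11, candidateCode, continuation] using And.intro hm' r'
  have g7 : s₂.reg 7 = 0 := by rw [hs₂.reg_eq (by decide), f7]
  have g8 : s₂.reg 8 = 1 := by rw [hs₂.reg_eq (by decide), f8]
  have g17 : s₂.reg 17 = addr u := by rw [hs₂.reg_eq (by decide), r17]
  have g16 : s₂.reg 16 = base j + (t + 1) := by rw [hs₂.reg_eq (by decide), r16]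
  have g11 : s₂.reg 11 = j := by rw [hs₂.reg_eq (by decide), r11]
  have g19 : s₂.reg 19 = ys j t := by rw [hs₂.reg_eq (by decide), r19]
  obtain ⟨s₃, hs₃, a₃, p23⟩ : ∃ s', Runs D (.cond (.eq 19 7) .skip
        (.seq (block [.add 17 17 8, .load 21 17]) tryChild))
      s₂ s' 10 ∧ Appends s₂.mem s'.mem (s₂.reg 23) 
        ((continuation S ys t 1 (u, j)).flatMap (candidateCode addr base (t + 1))) ∧
      s'.reg 23 = s₂.reg 23 + 3 * (continuation S ys t 1 (u, j)).length := by
    by_cases hy1 : ys j t = 0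
    · refine ⟨s₂, (Runs.condTrue (by simp [Holds, g19, g7, hy1]) (runs_skip D s₂)).mono (by omega),
        ?_⟩
      simpa [hy1, continuation] using Appends.nil _ _
    · have hl := (runs_add (D := D) (s := s₂) (b := 8) (by omega) 17 17).seq
        (runs_load D (s₂.setReg 17 (s₂.reg 17 + s₂.reg 8)) 21 17)
      obtain ⟨s', hs', hm', r'⟩ := runs_tryChild hD (s := (s₂.setReg 17 (s₂.reg 17 + s₂.reg 8)).setReg
        21 (s₂.mem (s₂.reg 17 + s₂.reg 8))) (by simpa using g7) (by simpa using g8)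
      simp only [RamState.setReg_mem, RamState.setReg_reg, if_true] at hl
      refine ⟨s', (Runs.condFalse (by simp [Holds, g19, g7, hy1]) (hl.seq hs')).mono (by omega), ?_⟩
      have hc : s₂.mem (addr u + 1) = mem₀ (addr u + 1) :=
        hchild 1 (by omega) s₂.mem fun a ha => by rw [a₂.same a (by omega), m₁]
      by_cases hu : u ++ [1] ∈ S
      · have := h.child u hx 1 (by omega) hu
        have h0 := h.pos_of_append hu
        simpa [hu, hy1, g8, g17, hc, this, h0, g16, g11, candidateCode, continuation] using And.intro hm' r'
      · have := h.no_child u hx 1 (by omega) hu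
        simpa [hu, hy1, g8, g17, hc, this, g16, g11, candidateCode, continuation] using And.intro hm' r'
  refine ⟨s₃, (hs₁.seq (hs₂.seq hs₃)).mono (by omega), ?_, ?_, ?_⟩
  · rw [continuations, List.flatMap_append, ← m₁, ← f23]
    refine a₂.trans ?_
    convert a₃ using 1
    rw [q23]
    simp [candidateCode, List.length_flatMap, mul_comm]
  · rw [hs₃.reg_eq (by decide), hs₂.reg_eq (by decide), r22]
  · rw [p23, q23, f23, continuations, List.length_append]
    ring

end Jedi

/-! ### Breadth-first search through the trie. -/

namespace Jedi

open RamProg RamTest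

/-- Memory serves as a queue: register `22` is its front, `24` the end of the current level and `23`
its end. Candidates of the next level are appended beyond `24`, so those still to be processed stay
intact. -/
theorem runs_searchLoop {D : ℕ} (hD : 3 ≤ D) {B H t : ℕ} {S : Set (List ℕ)}
    {addr lab : List ℕ → ℕ} {base : ℕ → ℕ} {ys : ℕ → ℕ → ℕ} {mem₀ : ℕ → ℕ}
    (h : IsTrie B H S addr lab mem₀) (l : List (List ℕ × ℕ)) :
    (∀ x ∈ l, x.1 ∈ S ∧ base x.2 + t < H ∧ mem₀ (base x.2 + t) = ys x.2 t) →
    ∀ {s : RamState}, (∀ a < H, s.mem a = mem₀ a) → s.reg 7 = 0 → s.reg 8 = 1 →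
    Enc s.mem (s.reg 22) (l.flatMap (candidateCode addr base t)) →
    s.reg 24 = s.reg 22 + 3 * l.length → s.reg 24 ≤ s.reg 23 → H ≤ s.reg 23 →
    ∃ s', Runs D (.loop (.lt 22 24) searchStep) s s' (31 * l.length + 1) ∧
      Appends s.mem s'.mem (s.reg 23)
        ((l.flatMap (continuations S ys t)).flatMap (candidateCode addr base (t + 1))) ∧
      s'.reg 22 = s.reg 24 ∧
      s'.reg 23 = s.reg 23 + 3 * (l.flatMap (continuations S ys t)).length := by
  induction l with
  | nil =>
    intro _ s _ _ _ _ h24 _ _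
    exact ⟨s, .loopDone (by simpa [Holds] using h24.le), .nil _ _, by simpa using h24.symm, by simp⟩
  | cons x l ih =>
    intro hl s hm h7 h8 he h24 hle hH
    obtain ⟨hx, hb, hy⟩ := hl x (by simp)
    rw [List.flatMap_cons, enc_append] at he
    simp only [List.length_cons] at h24
    obtain ⟨s₁, hs₁, a₁, r22, r23⟩ := runs_searchStep hD h hm h7 h8 hx he.1
      (by rw [hm _ hb, hy]) hH
    have r24 : s₁.reg 24 = s.reg 24 := hs₁.reg_eq (by decide)
    obtain ⟨s₂, hs₂, a₂, q22, q23⟩ := ih (fun x hx => hl x (by simp [hx])) (s := s₁)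
      (fun a ha => by rw [a₁.same a (by omega), hm a ha])
      (by rw [hs₁.reg_eq (by decide), h7]) (by rw [hs₁.reg_eq (by decide), h8])
      (by
        rw [r22]
        refine a₁.enc_of_le he.2 ?_
        have : (l.flatMap (candidateCode addr base t)).length = 3 * l.length := by
          simp [candidateCode, List.length_flatMap, mul_comm]
        rw [this]
        omega)
      (by omega) (by omega) (by omega)
    refine ⟨s₂, (Runs.loopStep (by simp only [Holds]; omega) hs₁ hs₂).mono ?_, ?_, ?_, ?_⟩
    · simp only [List.length_cons]
      omega
    · rw [List.flatMap_cons, List.flatMap_append]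
      refine a₁.trans ?_
      convert a₂ using 1
      rw [r23]
      simp [candidateCode, List.length_flatMap, mul_comm]
    · rw [q22, r24]
    · rw [q23, r23, List.flatMap_cons, List.length_append]
      ring

/-- The candidates at depth `t`: pairs of a node `u` at depth `t` and the number `j` of an output
that matches `u` in the first `t` positions. -/
noncomputable def candidates (S : Set (List ℕ)) (ys : ℕ → ℕ → ℕ) (M : ℕ) :
    ℕ → List (List ℕ × ℕ)
  | 0 => (List.range M).map fun j => ([], j)
  | t + 1 => (candidates S ys M t).flatMap (continuations S ys t)

theorem mem_continuations {S : Set (List ℕ)} {ys : ℕ → ℕ → ℕ} {t : ℕ} {x y : List ℕ × ℕ} :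
    y ∈ continuations S ys t x ↔
      ∃ b < 2, ys x.2 t ≠ 1 - b ∧ x.1 ++ [b] ∈ S ∧ y = (x.1 ++ [b], x.2) := by
  have : ∀ b, y ∈ continuation S ys t b x ↔
      ys x.2 t ≠ 1 - b ∧ x.1 ++ [b] ∈ S ∧ y = (x.1 ++ [b], x.2) := fun b => by
    by_cases hc : ys x.2 t ≠ 1 - b ∧ x.1 ++ [b] ∈ S
    · rw [continuation, if_pos hc]
      simp only [List.mem_singleton]
      tauto
    · rw [continuation, if_neg hc]
      simp only [List.not_mem_nil, false_iff]
      tauto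
  rw [continuations, List.mem_append, this, this]
  constructor
  · rintro (h | h)
    exacts [⟨0, by omega, h⟩, ⟨1, by omega, h⟩]
  · rintro ⟨b, hb, h⟩
    interval_cases b
    exacts [Or.inl h, Or.inr h]

theorem nodup_continuations (S : Set (List ℕ)) (ys : ℕ → ℕ → ℕ) (t : ℕ) (x : List ℕ × ℕ) :
    (continuations S ys t x).Nodup := by
  unfold continuations continuation
  split_ifs <;> simp

/-- A continuation determines its parent, by dropping the last symbol. Thus every edge is listed
once, and lengths of these lists count pairs. -/
theorem nodup_candidates (S : Set (List ℕ)) (ys : ℕ → ℕ → ℕ) (M t : ℕ) :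
    (candidates S ys M t).Nodup := by
  induction t with
  | zero => exact List.nodup_range.map fun a b h => (Prod.mk.inj h).2
  | succ t ih =>
    rw [candidates, List.nodup_flatMap]
    refine ⟨fun x _ => nodup_continuations S ys t x, ih.imp fun {x y} hxy => ?_⟩
    intro z hzx hzy
    obtain ⟨b, -, -, -, rfl⟩ := mem_continuations.1 hzx
    obtain ⟨c, -, -, -, hz⟩ := mem_continuations.1 hzy
    obtain ⟨h₁, h₂⟩ := Prod.mk.inj hz
    exact hxy (Prod.ext (List.append_inj' h₁ rfl).1 h₂)

/-- The codeword behind a prefix may change when a symbol is appended, but the match on the earlier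
positions depends on the prefix only. -/
theorem mem_candidates {xs ys : ℕ → ℕ → ℕ} {n M t : ℕ} (hxs : ∀ i < M, ∀ t < n, xs i t < 2)
    (ht : t ≤ n) {x : List ℕ × ℕ} : x ∈ candidates (prefixes xs n M) ys M t ↔
      x.2 < M ∧ ∃ i < M, x.1 = pref (xs i) t ∧ ∀ k < t, ys x.2 k ≠ 1 - xs i k := by
  induction t generalizing x with
  | zero =>
    obtain ⟨u, j⟩ := x
    simp only [candidates, List.mem_map, List.mem_range, Prod.mk.injEq, pref_zero]
    constructor
    · rintro ⟨j, hj, rfl, rfl⟩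
      exact ⟨hj, j, hj, rfl, by simp⟩
    · rintro ⟨hj, -, -, rfl, -⟩
      exact ⟨j, hj, rfl, rfl⟩
  | succ t ih =>
    simp only [candidates, List.mem_flatMap, mem_continuations, ih (by omega : t ≤ n)]
    constructor
    · rintro ⟨y, ⟨hy, i, hi, hyi, hk⟩, b, hb, hne, hmem, rfl⟩
      refine ⟨hy, ?_⟩
      rcases hmem with hmem | ⟨i', hi', t', ht', he⟩
      · simp at hmem
      · have hlen := congrArg List.length he
        simp only [hyi, List.length_append, length_pref, List.length_singleton] at hlen
        subst hlen
        rw [pref_succ] at he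
        obtain ⟨h₁, h₂⟩ := List.append_inj' he rfl
        have h₂ : b = xs i' t := by simpa using h₂
        rw [hyi, pref_inj] at h₁
        refine ⟨i', hi', by rw [pref_succ]; exact he, fun k hkt => ?_⟩
        rcases Nat.lt_succ_iff_lt_or_eq.1 hkt with hkt | rfl
        · rw [← h₁ k hkt]
          exact hk k hkt
        · rw [← h₂]
          exact hne
    · obtain ⟨u, j⟩ := x
      rintro ⟨hj, i, hi, hu, hk⟩
      refine ⟨(pref (xs i) t, j), ⟨hj, i, hi, rfl, fun k hkt => hk k (by omega)⟩, xs i t,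
        hxs i hi t (by omega), hk t (by omega), ?_, ?_⟩
      · exact Or.inr ⟨i, hi, t + 1, ht, (pref_succ _ _).symm⟩
      · rw [← pref_succ]
        exact Prod.ext hu rfl

/-- Advances all candidates by one position. -/
def searchLevel : RamProg :=
  .seq (.copy 24 23) (.seq (.loop (.lt 22 24) searchStep) (.add 18 18 8))

/-- The instruction bound is the sum of the candidate counts over the depths, up to constants; this
is the quantity whose expectation is estimated later. -/
theorem runs_searchLevels {D : ℕ} (hD : 3 ≤ D) {B H n M : ℕ} {S : Set (List ℕ)}
    {addr lab : List ℕ → ℕ} {base : ℕ → ℕ} {ys : ℕ → ℕ → ℕ} {mem₀ : ℕ → ℕ}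
    (h : IsTrie B H S addr lab mem₀)
    (hc : ∀ t < n, ∀ x ∈ candidates S ys M t,
      x.1 ∈ S ∧ base x.2 + t < H ∧ mem₀ (base x.2 + t) = ys x.2 t) (k : ℕ) :
    ∀ {t : ℕ}, t + k = n → ∀ {s : RamState}, (∀ a < H, s.mem a = mem₀ a) → s.reg 0 = n →
    s.reg 7 = 0 → s.reg 8 = 1 → s.reg 18 = t →
    Enc s.mem (s.reg 22) ((candidates S ys M t).flatMap (candidateCode addr base t)) →
    s.reg 23 = s.reg 22 + 3 * (candidates S ys M t).length → H ≤ s.reg 22 →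
    (∀ a, s.reg 23 ≤ a → s.mem a = 0) →
    ∃ s', Runs D (.loop (.lt 18 0) searchLevel) s s'
        (∑ t' ∈ Finset.Ico t n, (31 * (candidates S ys M t').length + 4) + 1) ∧
      (∀ a < H, s'.mem a = mem₀ a) ∧
      Enc s'.mem (s'.reg 22) ((candidates S ys M n).flatMap (candidateCode addr base n)) ∧
      s'.reg 23 = s'.reg 22 + 3 * (candidates S ys M n).length ∧ H ≤ s'.reg 22 ∧
      ∀ a, s'.reg 23 ≤ a → s'.mem a = 0 := by
  induction k with
  | zero =>
    intro t ht s hm h0 h7 h8 h18 he h23 hH hz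
    obtain rfl : t = n := by omega
    exact ⟨s, by simpa using Runs.loopDone (by simp [Holds, h0, h18]), hm, he, h23, hH, hz⟩
  | succ k ih =>
    intro t ht s hm h0 h7 h8 h18 he h23 hH hz
    have c₁ := runs_copy D s 24 23
    obtain ⟨s₁, hs₁, a₁, r22, r23⟩ := runs_searchLoop hD h (candidates S ys M t)
      (hc t (by omega)) (s := s.setReg 24 (s.reg 23)) hm (by simpa using h7) (by simpa using h8)
      (by simpa using he) (by simpa using h23) (by simp) (by simpa using (by omega))
    simp only [RamState.setReg_reg, RamState.setReg_mem] at a₁ r22 r23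
    norm_num at a₁ r22 r23
    have e8 : s₁.reg 8 = 1 := by rw [hs₁.reg_eq (by decide)]; simpa using h8
    have e18 : s₁.reg 18 = t := by rw [hs₁.reg_eq (by decide)]; simpa using h18
    have c₂ := runs_add (D := D) (s := s₁) (b := 8) (by omega) 18 18
    have hr := c₁.seq (hs₁.seq c₂)
    obtain ⟨s₂, hs₂, q⟩ := ih (t := t + 1) (by omega)
      (s := s₁.setReg 18 (s₁.reg 18 + s₁.reg 8))
      (fun a ha => by simpa using (a₁.same a (by omega)).trans (hm a ha))
      (by rw [hr.reg_eq (by decide), h0]) (by rw [hr.reg_eq (by decide), h7])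
      (by rw [hr.reg_eq (by decide), h8]) (by simp [e8, e18])
      (by simpa [r22, candidates] using a₁.enc) (by simp [r22, r23, candidates])
      (by simp [r22]; omega)
      (fun a ha => by
        refine a₁.zero hz a ?_
        simp only [RamState.setReg_reg] at ha
        norm_num [r23] at ha
        refine le_trans (le_of_eq ?_) ha
        simp [candidateCode, List.length_flatMap, mul_comm])
    refine ⟨s₂, (Runs.loopStep (by simp only [Holds]; omega) hr hs₂).mono ?_, q⟩
    rw [Finset.sum_eq_sum_Ico_succ_bot (by omega : t < n)]
    omega

end Jedi

/-! ### Listing of the edges and assembly of Step 1. -/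

namespace Jedi

open RamProg RamTest

/-- Appends the edge that belongs to a candidate of full depth. -/
def emitEdge : RamProg := block [.load 17 22, .add 17 17 9, .load 21 17, .store 23 21,
  .add 23 23 8, .add 22 22 9, .load 11 22, .store 23 11, .add 23 23 8, .add 22 22 8, .add 3 3 8]

/-- At full depth a node is a codeword and its label is the number of this codeword, so a candidate
is turned into an edge by one look-up. -/
theorem runs_emitEdges {D : ℕ} (hD : 3 ≤ D) {B H n : ℕ} {S : Set (List ℕ)}
    {addr lab : List ℕ → ℕ} {base : ℕ → ℕ} {mem₀ : ℕ → ℕ}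
    (h : IsTrie B H S addr lab mem₀) (l : List (List ℕ × ℕ)) : (∀ x ∈ l, x.1 ∈ S) →
    ∀ {s : RamState}, (∀ a < H, s.mem a = mem₀ a) → s.reg 8 = 1 → s.reg 9 = 2 →
    Enc s.mem (s.reg 22) (l.flatMap (candidateCode addr base n)) →
    s.reg 24 = s.reg 22 + 3 * l.length → s.reg 24 ≤ s.reg 23 → H ≤ s.reg 22 →
    ∃ s', Runs D (.loop (.lt 22 24) emitEdge) s s' (12 * l.length + 1) ∧
      Appends s.mem s'.mem (s.reg 23) (l.flatMap fun x => [lab x.1, x.2]) ∧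
      s'.reg 23 = s.reg 23 + 2 * l.length ∧ s'.reg 3 = s.reg 3 + l.length := by
  induction l with
  | nil =>
    intro _ s _ _ _ _ h24 _ _
    exact ⟨s, .loopDone (by simpa [Holds] using h24.le), .nil _ _, by simp, by simp⟩
  | cons x l ih =>
    intro hl s hm h8 h9 he h24 hle hH
    simp only [List.flatMap_cons, candidateCode, List.cons_append, List.nil_append,
      enc_cons] at he
    simp only [List.length_cons] at h24
    obtain ⟨e0, -, e2, e3⟩ := he
    have hx := hl x (by simp)
    have hlab : s.mem (addr x.1 + 2) = lab x.1 := by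
      rw [h.congr hm hx (by omega), h.label _ hx]
    obtain ⟨s₁, hs₁, m₁, r22, r23, r3⟩ : ∃ s', Runs D emitEdge s s' 11 ∧
        s'.mem = Function.update (Function.update s.mem (s.reg 23) (lab x.1)) (s.reg 23 + 1) x.2 ∧
        s'.reg 22 = s.reg 22 + 3 ∧ s'.reg 23 = s.reg 23 + 2 ∧ s'.reg 3 = s.reg 3 + 1 := by
      refine exists_runs_of_vc (P := emitEdge) ?_
      have hne : s.reg 22 + 2 ≠ s.reg 23 := by omega
      have e2' : s.mem (s.reg 22 + 2) = x.2 := e2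
      simp [emitEdge, block, vc, h8, h9, e0, hlab, Function.update_of_ne hne, e2']
      omega
    have a₁ : Appends s.mem s₁.mem (s.reg 23) [lab x.1, x.2] := m₁ ▸ appends_two _ _ _ _
    have r24 : s₁.reg 24 = s.reg 24 := hs₁.reg_eq (by decide)
    obtain ⟨s₂, hs₂, a₂, q23, q3⟩ := ih (fun x hx => hl x (by simp [hx])) (s := s₁)
      (fun a ha => by rw [a₁.same a (by omega), hm a ha])
      (by rw [hs₁.reg_eq (by decide), h8]) (by rw [hs₁.reg_eq (by decide), h9])
      (by
        rw [r22]
        refine a₁.enc_of_le e3 ?_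
        have : (l.flatMap (candidateCode addr base n)).length = 3 * l.length := by
          simp [candidateCode, List.length_flatMap, mul_comm]
        have e : s.reg 22 + 1 + 1 + 1 = s.reg 22 + 3 := rfl
        rw [this]
        omega)
      (by omega) (by omega) (by omega)
    refine ⟨s₂, (Runs.loopStep (by simp only [Holds]; omega) hs₁ hs₂).mono ?_, ?_, ?_, ?_⟩
    · simp only [List.length_cons]
      omega
    · rw [List.flatMap_cons]
      refine a₁.trans ?_
      rw [r23] at a₂
      exact a₂
    · simp only [List.length_cons]
      omega
    · simp only [List.length_cons]
      omega

/-- Appends the candidate of depth zero for one output. -/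
def seedStep : RamProg := .seq (pushCandidate 14) (block [.add 16 16 0, .add 11 11 8])

theorem runs_seed {D : ℕ} (hD : 3 ≤ D) {n M a B : ℕ} (hn : n ≤ D) (addr : List ℕ → ℕ)
    (hB : addr [] = B) (k : ℕ) : ∀ {i : ℕ}, i + k = M → ∀ {s : RamState}, s.reg 0 = n →
    s.reg 1 = M → s.reg 8 = 1 → s.reg 11 = i → s.reg 14 = B → s.reg 16 = a + i * n →
    ∃ s', Runs D (.loop (.lt 11 1) seedStep) s s' (9 * k + 1) ∧
      Appends s.mem s'.mem (s.reg 23) (((List.range' i k).map fun j => (([] : List ℕ), j)).flatMap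
        (candidateCode addr (fun j => a + j * n) 0)) ∧ s'.reg 23 = s.reg 23 + 3 * k := by
  induction k with
  | zero =>
    intro i hi s h0 h1 h8 h11 h14 h16
    exact ⟨s, .loopDone (by simp only [Holds]; omega), .nil _ _, by simp⟩
  | succ k ih =>
    intro i hi s h0 h1 h8 h11 h14 h16
    obtain ⟨s₁, hs₁, a₁, r23⟩ := runs_pushCandidate hD h8 14
    have e0 : s₁.reg 0 = n := by rw [hs₁.reg_eq (by decide), h0]
    have e8 : s₁.reg 8 = 1 := by rw [hs₁.reg_eq (by decide), h8]
    have e11 : s₁.reg 11 = i := by rw [hs₁.reg_eq (by decide), h11]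
    have e16 : s₁.reg 16 = a + i * n := by rw [hs₁.reg_eq (by decide), h16]
    obtain ⟨s₂, hs₂, m₂, q16, q11⟩ : ∃ s', Runs D (block [.add 16 16 0, .add 11 11 8]) s₁ s' 2 ∧
        s'.mem = s₁.mem ∧ s'.reg 16 = a + (i + 1) * n ∧ s'.reg 11 = i + 1 := by
      refine exists_runs_of_vc (P := block [.add 16 16 0, .add 11 11 8]) ?_
      simp [block, vc, e0, e8, e11, e16]
      refine ⟨hn, by omega, by ring⟩
    have hr := hs₁.seq hs₂
    have p23 : s₂.reg 23 = s.reg 23 + 3 := by rw [hs₂.reg_eq (by decide), r23]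
    obtain ⟨s₃, hs₃, a₃, p⟩ := ih (i := i + 1) (by omega) (s := s₂)
      (by rw [hr.reg_eq (by decide), h0]) (by rw [hr.reg_eq (by decide), h1])
      (by rw [hr.reg_eq (by decide), h8]) q11 (by rw [hr.reg_eq (by decide), h14]) q16
    refine ⟨s₃, (Runs.loopStep (by simp only [Holds]; omega) hr hs₃).mono (by omega), ?_, by omega⟩
    rw [List.range'_succ, List.map_cons, List.flatMap_cons]
    rw [m₂, p23] at a₃
    rw [h14, h16, h11] at a₁
    simp only [candidateCode, hB, add_zero] at a₃ ⊢
    exact a₁.trans a₃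

/-- Step 1: the trie of the codebook is built, all outputs are run through it in parallel, and
the edges are listed. -/
def step₁ : RamProg :=
  .seq (block [.const 8 1, .const 9 2, .const 10 3])
  (.seq (.loop (.lt 11 1) (block [.add 12 12 0, .add 11 11 8]))
  (.seq (block [.add 14 12 12, .add 15 14 10, .const 11 0])
  (.seq (.loop (.lt 11 1) insertWord)
  (.seq (block [.copy 22 15, .copy 23 15, .const 11 0])
  (.seq (.loop (.lt 11 1) seedStep)
  (.seq (.const 18 0)
  (.seq (.loop (.lt 18 0) searchLevel)
  (.seq (block [.copy 24 23, .copy 2 23, .const 3 0])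
    (.loop (.lt 22 24) emitEdge)))))))))

/-- The machine cannot multiply; `M * n` is obtained by `M` additions. -/
theorem runs_multiply {D n M : ℕ} (hn : n ≤ D) (hD : 1 ≤ D) (k : ℕ) : ∀ {i : ℕ}, i + k = M →
    ∀ {s : RamState}, s.reg 0 = n → s.reg 1 = M → s.reg 8 = 1 → s.reg 11 = i →
    s.reg 12 = i * n → ∃ s', Runs D (.loop (.lt 11 1) (block [.add 12 12 0, .add 11 11 8])) s s'
      (3 * k + 1) ∧ s'.mem = s.mem ∧ s'.reg 12 = M * n := by
  induction k with
  | zero =>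
    intro i hi s h0 h1 h8 h11 h12
    obtain rfl : i = M := by omega
    exact ⟨s, .loopDone (by simp only [Holds]; omega), rfl, h12⟩
  | succ k ih =>
    intro i hi s h0 h1 h8 h11 h12
    obtain ⟨s₁, hs₁, m₁, r12, r11⟩ : ∃ s', Runs D (block [.add 12 12 0, .add 11 11 8]) s s' 2 ∧
        s'.mem = s.mem ∧ s'.reg 12 = (i + 1) * n ∧ s'.reg 11 = i + 1 := by
      refine exists_runs_of_vc (P := block [.add 12 12 0, .add 11 11 8]) ?_
      simp [block, vc, h0, h8, h11, h12]
      refine ⟨hn, by omega, by ring⟩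
    obtain ⟨s₂, hs₂, m₂, q⟩ := ih (i := i + 1) (by omega) (s := s₁)
      (by rw [hs₁.reg_eq (by decide), h0]) (by rw [hs₁.reg_eq (by decide), h1])
      (by rw [hs₁.reg_eq (by decide), h8]) r11 r12
    exact ⟨s₂, (Runs.loopStep (by simp only [Holds]; omega) hs₁ hs₂).mono (by omega),
      m₂.trans m₁, q⟩

theorem isWordTrie_zero {B n : ℕ} (xs : ℕ → ℕ → ℕ) {mem : ℕ → ℕ} (hz : ∀ a, B ≤ a → mem a = 0) :
    IsWordTrie B (B + 3) xs n 0 (fun _ => B) mem := by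
  have hS : ∀ u, u ∈ prefixes xs n 0 ↔ u = [] := fun u => by simp [prefixes]
  refine ⟨fun _ => 0, ⟨(hS _).2 rfl, rfl, ?_, ?_, ?_, ?_, ?_, ?_, ?_, ⟨1, by ring⟩⟩, by simp⟩
  · intro u b hu
    simp [hS] at hu
  · intro u _
    exact ⟨0, by simp⟩
  · intro u hu v hv _
    rw [(hS u).1 hu, (hS v).1 hv]
  · intro u _ b _ hu
    simp [hS] at hu
  · intro u _ b _ _
    exact hz _ (by omega)
  · intro u _
    exact hz _ (by omega)
  · intro a ha
    exact hz _ (by omega)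

/-- The input of the machine: the words `xs i` and the outputs `ys j` as sequences of numbers. -/
structure IsInput (xs ys : ℕ → ℕ → ℕ) (n M : ℕ) (s : RamState) : Prop where
  reg_zero : s.reg 0 = n
  reg_one : s.reg 1 = M
  reg_of_ne : ∀ k, k ≠ 0 → k ≠ 1 → s.reg k = 0
  word : ∀ i < M, ∀ t < n, s.mem (i * n + t) = xs i t
  output : ∀ j < M, ∀ t < n, s.mem (M * n + j * n + t) = ys j t
  zero : ∀ a, 2 * (M * n) ≤ a → s.mem a = 0

/-- The root of the trie is put into cell `2 * (M * n)`, the first one beyond the input. Beyond the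
trie follow the queue and then the edges; all cells after these are still zero, as Step 2 requires.
-/
theorem runs_step₁ {D n M : ℕ} (hD : 3 ≤ D) (hn : n ≤ D) (hMn : M * n ≤ D) {xs ys : ℕ → ℕ → ℕ}
    (hxs : ∀ i < M, ∀ i' < M, pref (xs i') n = pref (xs i) n → i' = i)
    (hw : ∀ i < M, ∀ t < n, xs i t < 2) {s : RamState} (h : IsInput xs ys n M s) :
    ∃ s', Runs D step₁ s s' (11 * (M * n) + 19 * M +
        43 * ∑ t ∈ Finset.range (n + 1), (candidates (prefixes xs n M) ys M t).length
          + 4 * n + 30) ∧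
      ∃ lab : List ℕ → ℕ, (∀ i < M, lab (pref (xs i) n) = i) ∧
      Enc s'.mem (s'.reg 2) ((candidates (prefixes xs n M) ys M n).flatMap
        fun x => [lab x.1, x.2]) ∧
      s'.reg 3 = (candidates (prefixes xs n M) ys M n).length ∧
      s'.reg 23 = s'.reg 2 + 2 * s'.reg 3 ∧ (∀ a, s'.reg 23 ≤ a → s'.mem a = 0) ∧
      s'.reg 1 = M ∧ s'.reg 7 = 0 ∧ s'.reg 8 = 1 := by
  obtain ⟨s₁, hs₁, m₁, h8, h9, h10, f₁⟩ : ∃ s', Runs D (block [.const 8 1, .const 9 2, .const 10 3])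
      s s' 3 ∧ s'.mem = s.mem ∧ s'.reg 8 = 1 ∧ s'.reg 9 = 2 ∧ s'.reg 10 = 3 ∧
      ∀ k, k ≠ 8 → k ≠ 9 → k ≠ 10 → s'.reg k = s.reg k := by
    refine exists_runs_of_vc (P := block [.const 8 1, .const 9 2, .const 10 3]) ?_
    simp only [block, vc, RamState.setReg_reg, RamState.setReg_mem]
    refine ⟨by omega, by omega, by omega, trivial, by norm_num, by norm_num, by norm_num, ?_⟩
    intro k h₁ h₂ h₃
    simp [h₁, h₂, h₃]
  have h0 : s₁.reg 0 = n := by rw [f₁ 0 (by omega) (by omega) (by omega), h.reg_zero]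
  have h1 : s₁.reg 1 = M := by rw [f₁ 1 (by omega) (by omega) (by omega), h.reg_one]
  have hk : ∀ k, k ≠ 0 → k ≠ 1 → k ≠ 8 → k ≠ 9 → k ≠ 10 → s₁.reg k = 0 := fun k a b c d e => by
    rw [f₁ k c d e, h.reg_of_ne k a b]
  obtain ⟨s₂, hs₂, m₂, r12⟩ := runs_multiply hn (by omega) M (i := 0) (by omega) h0 h1 h8
    (hk 11 (by omega) (by omega) (by omega) (by omega) (by omega))
    (by rw [hk 12 (by omega) (by omega) (by omega) (by omega) (by omega), zero_mul])
  have e10 : s₂.reg 10 = 3 := by rw [hs₂.reg_eq (by decide), h10]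
  obtain ⟨s₃, hs₃, m₃, r14, r15, r11⟩ : ∃ s', Runs D (block [.add 14 12 12, .add 15 14 10,
      .const 11 0]) s₂ s' 3 ∧ s'.mem = s₂.mem ∧ s'.reg 14 = 2 * (M * n) ∧
      s'.reg 15 = 2 * (M * n) + 3 ∧ s'.reg 11 = 0 := by
    refine exists_runs_of_vc (P := block [.add 14 12 12, .add 15 14 10, .const 11 0]) ?_
    simp [block, vc, r12, e10]
    omega
  have m₃' : s₃.mem = s.mem := by rw [m₃, m₂, m₁]
  have hr₃ := (hs₂.seq hs₃)
  obtain ⟨s₄, hs₄, H, addr, ⟨lab, t₄, hlab⟩, m₄, q15, q16⟩ := runs_insertWords hD hxs hw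
    (by omega : M * n ≤ 2 * (M * n)) M (i := 0) (by omega) (s := s₃)
    (isWordTrie_zero xs (by rw [m₃']; exact h.zero))
    (by rw [hr₃.reg_eq (by decide), h0]) (by rw [hr₃.reg_eq (by decide), h1])
    (by
      rw [hr₃.reg_eq (by decide)]
      exact hk 7 (by omega) (by omega) (by omega) (by omega) (by omega))
    (by rw [hr₃.reg_eq (by decide), h8])
    (by rw [hr₃.reg_eq (by decide), h9]) (by rw [hr₃.reg_eq (by decide), h10]) r11 r14 r15
    (by rw [m₃']; exact h.word)
    (by
      rw [hr₃.reg_eq (by decide), zero_mul]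
      exact hk 16 (by omega) (by omega) (by omega) (by omega) (by omega))
  have hr₄ := hr₃.seq hs₄
  obtain ⟨s₅, hs₅, m₅, p22, p23, p11⟩ : ∃ s', Runs D (block [.copy 22 15, .copy 23 15, .const 11 0])
      s₄ s' 3 ∧ s'.mem = s₄.mem ∧ s'.reg 22 = H ∧ s'.reg 23 = H ∧ s'.reg 11 = 0 := by
    refine exists_runs_of_vc (P := block [.copy 22 15, .copy 23 15, .const 11 0]) ?_
    simp [block, vc, q15]
  have hr₅ := hr₄.seq hs₅
  obtain ⟨s₆, hs₆, a₆, o23⟩ := runs_seed hD hn (M := M) (a := M * n) addr t₄.addr_nil M (i := 0)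
    (by omega) (s := s₅) (by rw [hr₅.reg_eq (by decide), h0]) (by rw [hr₅.reg_eq (by decide), h1])
    (by rw [hr₅.reg_eq (by decide), h8]) p11
    (by rw [hs₅.reg_eq (by decide), hs₄.reg_eq (by decide), r14])
    -- Having read all codewords, register `16` points to the first symbol of the first output.
    (by rw [hs₅.reg_eq (by decide), q16]; ring)
  have hr₆ := hr₅.seq hs₆
  have c₇ := runs_const (D := D) (k := 0) (by omega) s₆ 18
  have hr₇ := hr₆.seq c₇
  rw [p23, m₅] at a₆
  have hB : 2 * (M * n) + 3 ≤ H := by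
    obtain ⟨k, hk, hk'⟩ := t₄.range [] t₄.nil_mem
    rw [t₄.addr_nil] at hk'
    exact hk'
  have hcode : ((candidates (prefixes xs n M) ys M 0).flatMap
      (candidateCode addr (fun j => M * n + j * n) 0)).length = 3 * M := by
    simp [candidates, candidateCode, List.length_flatMap, Function.comp_def, mul_comm]
  have o22 : s₆.reg 22 = H := by rw [hs₆.reg_eq (by decide), p22]
  rw [← List.range_eq_range'] at a₆
  obtain ⟨s₈, hs₈, m₈, e₈, n23, hH, z₈⟩ := runs_searchLevels hD t₄ (n := n) (M := M) (ys := ys)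
    (base := fun j => M * n + j * n) (by
      intro t ht x hx
      rw [mem_candidates hw ht.le] at hx
      obtain ⟨hj, i, hi, hu, -⟩ := hx
      have hle : x.2 * n + n ≤ M * n := by
        rw [← Nat.succ_mul]
        exact Nat.mul_le_mul_right n hj
      refine ⟨Or.inr ⟨i, hi, t, ht.le, hu⟩, by omega, ?_⟩
      rw [m₄ _ (by omega), m₃', h.output _ hj t ht]) n (t := 0) (by omega)
    (s := s₆.setReg 18 0) (fun a ha => a₆.same a ha)
    (by rw [hr₇.reg_eq (by decide), h0])
    (by
      rw [hr₇.reg_eq (by decide)]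
      exact hk 7 (by omega) (by omega) (by omega) (by omega) (by omega))
    (by rw [hr₇.reg_eq (by decide), h8]) (by simp)
    (by simpa [o22, candidates] using a₆.enc)
    (by simp [o22, o23, p23, candidates]) (by simp [o22])
    (fun a ha => by
      refine a₆.zero t₄.zero a ?_
      rw [show ((List.range M).map fun j => (([] : List ℕ), j)) =
        candidates (prefixes xs n M) ys M 0 from rfl, hcode]
      simpa [o23, p23] using ha)
  obtain ⟨s₉, hs₉, m₉, l24, l2, l3⟩ : ∃ s', Runs D (block [.copy 24 23, .copy 2 23, .const 3 0])
      s₈ s' 3 ∧ s'.mem = s₈.mem ∧ s'.reg 24 = s₈.reg 23 ∧ s'.reg 2 = s₈.reg 23 ∧ s'.reg 3 = 0 := by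
    refine exists_runs_of_vc (P := block [.copy 24 23, .copy 2 23, .const 3 0]) ?_
    simp [block, vc]
  have l22 : s₉.reg 22 = s₈.reg 22 := hs₉.reg_eq (by decide)
  have l23 : s₉.reg 23 = s₈.reg 23 := hs₉.reg_eq (by decide)
  have hr₉ := hr₇.seq (hs₈.seq hs₉)
  obtain ⟨s', hs', a', k23, k3⟩ := runs_emitEdges hD t₄ (candidates (prefixes xs n M) ys M n)
    (base := fun j => M * n + j * n) (n := n) (fun x hx => by
      rw [mem_candidates hw le_rfl] at hx
      obtain ⟨hj, i, hi, hu, -⟩ := hx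
      exact Or.inr ⟨i, hi, n, le_rfl, hu⟩) (s := s₉) (fun a ha => by rw [m₉, m₈ a ha])
    (by rw [hr₉.reg_eq (by decide), h8]) (by rw [hr₉.reg_eq (by decide), h9])
    (by rw [m₉, l22]; exact e₈) (by rw [l24, l22, n23]) (by rw [l24, l23]) (by rw [l22]; exact hH)
  have hr := hr₉.seq hs'
  have k2 : s'.reg 2 = s₈.reg 23 := by rw [hs'.reg_eq (by decide), l2]
  refine ⟨s', (hs₁.seq (hs₂.seq (hs₃.seq (hs₄.seq (hs₅.seq (hs₆.seq (c₇.seq (hs₈.seq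
    (hs₉.seq hs'))))))))).mono ?_, lab, hlab, ?_, ?_, ?_, ?_, ?_, ?_, ?_⟩
  · have e : ∑ t ∈ Finset.Ico 0 n, (31 * (candidates (prefixes xs n M) ys M t).length + 4) =
        31 * ∑ t ∈ Finset.range n, (candidates (prefixes xs n M) ys M t).length + 4 * n := by
      simp [Finset.sum_add_distrib, Finset.mul_sum, mul_comm]
    rw [e, Finset.sum_range_succ]
    have e' : (11 * n + 7) * M = 11 * (M * n) + 7 * M := by ring
    rw [e']
    omega
  · rw [k2, ← l23]
    exact a'.enc
  · omega
  · omega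
  · intro a ha
    refine a'.zero (by rw [m₉, l23]; exact z₈) a (le_trans (le_of_eq ?_) ha)
    rw [k23]
    simp [List.length_flatMap, mul_comm]
  · rw [hr.reg_eq (by decide), h1]
  · rw [hr.reg_eq (by decide)]
    exact hk 7 (by omega) (by omega) (by omega) (by omega) (by omega)
  · rw [hr.reg_eq (by decide), h8]

end Jedi

/-! ## Peeling on the machine -/

namespace Jedi

open RamProg RamTest

/-- A linked list of records `value, next` at addresses between `lo` and `hi`; the null pointer
is `0`. -/
def Chain (mem : ℕ → ℕ) (lo hi : ℕ) : ℕ → List ℕ → Prop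
  | p, [] => p = 0
  | p, w :: l => p ≠ 0 ∧ lo ≤ p ∧ p + 2 ≤ hi ∧ mem p = w ∧ Chain mem lo hi (mem (p + 1)) l

theorem Chain.congr {mem mem' : ℕ → ℕ} {lo hi hi' p : ℕ} {l : List ℕ} (h : Chain mem lo hi p l)
    (hm : ∀ a, lo ≤ a → a < hi → mem' a = mem a) (hle : hi ≤ hi') : Chain mem' lo hi' p l := by
  induction l generalizing p with
  | nil => exact h
  | cons w l ih =>
    obtain ⟨h0, h₁, h₂, h₃, h₄⟩ := h
    refine ⟨h0, h₁, by omega, by rw [hm p h₁ (by omega), h₃], ?_⟩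
    rw [hm (p + 1) (by omega) (by omega)]
    exact ih h₄

/-- The adjacency lists `adj v`, `v < 2 * M`, are stored as linked lists, together with arrays of
their lengths, sums and first records, which start at `dg`, `dg + 2 * M` and `dg + 4 * M`. -/
structure AdjStored (M dg hi : ℕ) (adj : ℕ → List ℕ) (mem : ℕ → ℕ) : Prop where
  deg : ∀ v < 2 * M, mem (dg + v) = (adj v).length
  sum : ∀ v < 2 * M, mem (dg + 2 * M + v) = (adj v).sum
  chain : ∀ v < 2 * M, Chain mem (dg + 8 * M) hi (mem (dg + 4 * M + v)) (adj v)
  zero : ∀ a, hi ≤ a → mem a = 0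
  le : dg + 8 * M ≤ hi

/-- The base addresses of the arrays are in their registers. -/
structure HasBases (M dg : ℕ) (s : RamState) : Prop where
  reg_one : s.reg 1 = M
  zero : s.reg 7 = 0
  one : s.reg 8 = 1
  deg : s.reg 25 = dg
  sum : s.reg 26 = dg + 2 * M
  head : s.reg 27 = dg + 4 * M

theorem HasBases.of_runs {M dg D N : ℕ} {s s' : RamState} (h : HasBases M dg s) {P : RamProg}
    (hP : Runs D P s s' N) (hw : ∀ k ∈ [1, 7, 8, 25, 26, 27], k ∉ P.written) :
    HasBases M dg s' := by
  refine ⟨?_, ?_, ?_, ?_, ?_, ?_⟩ <;> rw [hP.reg_eq (hw _ (by simp))]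
  exacts [h.1, h.2, h.3, h.4, h.5, h.6]

/-- Adds the node in register `w` to the adjacency list of the node in register `u`. -/
def addArc (u w : ℕ) : RamProg := block [.add 31 25 u, .load 32 31, .add 32 32 8, .store 31 32,
  .add 31 26 u, .load 32 31, .add 32 32 w, .store 31 32, .store 28 w, .add 31 27 u, .load 32 31,
  .store 31 28, .add 28 28 8, .store 28 32, .add 28 28 8]

/-- The new record is allocated at the free cell `p` and put at the front of the list, so that
constantly many instructions suffice. -/
theorem runs_addArc {D : ℕ} {M dg : ℕ} (hD : 2 * M + 1 ≤ D) {s : RamState} (hb : HasBases M dg s)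
    {adj : ℕ → List ℕ} (h : AdjStored M dg (s.reg 28) adj s.mem) {u w : ℕ}
    (hu : u = 29 ∨ u = 30) (hw : w = 29 ∨ w = 30) (hu' : s.reg u < 2 * M)
    (hw' : s.reg w < 2 * M) :
    ∃ s', Runs D (addArc u w) s s' 15 ∧ s'.reg 28 = s.reg 28 + 2 ∧
      AdjStored M dg (s'.reg 28) (Function.update adj (s.reg u) (s.reg w :: adj (s.reg u))) s'.mem ∧
      ∀ a < dg, s'.mem a = s.mem a := by
  obtain ⟨b1, b7, b8, b25, b26, b27⟩ := hb
  obtain ⟨hdeg, hsum, hch, hz, hle⟩ := h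
  set p := s.reg 28 with hp
  set x := s.reg u with hx
  set y := s.reg w with hy
  obtain ⟨s', hs', hm, r28⟩ : ∃ s', Runs D (addArc u w) s s' 15 ∧
      s'.mem = Function.update (Function.update (Function.update (Function.update
        (Function.update s.mem (dg + x) ((adj x).length + 1)) (dg + 2 * M + x) ((adj x).sum + y))
        p y) (dg + 4 * M + x) p) (p + 1) (s.mem (dg + 4 * M + x)) ∧ s'.reg 28 = p + 2 := by
    refine exists_runs_of_vc (P := addArc u w) ?_
    have n₁ : dg + 2 * M + x ≠ dg + x := by omega
    have n₂ : dg + 4 * M + x ≠ p := by omega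
    have n₃ : dg + 4 * M + x ≠ dg + 2 * M + x := by omega
    have n₄ : dg + 4 * M + x ≠ dg + x := by omega
    have u₁ : u ≠ 31 := by omega
    have u₂ : u ≠ 32 := by omega
    have w₁ : w ≠ 31 := by omega
    have w₂ : w ≠ 32 := by omega
    simp [addArc, block, vc, b8, b25, b26, b27, hdeg x hu', hsum x hu', Function.update_of_ne n₁,
      Function.update_of_ne n₂, Function.update_of_ne n₃, Function.update_of_ne n₄, u₁, u₂, w₁, w₂,
      ← hp, ← hx, ← hy]
    omega
  have hv : ∀ a, a ≠ dg + x → a ≠ dg + 2 * M + x → a ≠ p → a ≠ dg + 4 * M + x → a ≠ p + 1 →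
      s'.mem a = s.mem a := fun a h₁ h₂ h₃ h₄ h₅ => by
    rw [hm, Function.update_of_ne h₅, Function.update_of_ne h₄, Function.update_of_ne h₃,
      Function.update_of_ne h₂, Function.update_of_ne h₁]
  refine ⟨s', hs', r28, ?_, fun a ha => hv a (by omega) (by omega) (by omega) (by omega) (by omega)⟩
  rw [r28]
  have hchain : ∀ v < 2 * M,
      Chain s'.mem (dg + 8 * M) (p + 2) (s.mem (dg + 4 * M + v)) (adj v) := fun v hv' =>
    (hch v hv').congr (fun a _ _ => hv a (by omega) (by omega) (by omega) (by omega) (by omega))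
      (by omega)
  refine ⟨fun v hv' => ?_, fun v hv' => ?_, fun v hv' => ?_, fun a ha => ?_, by omega⟩
  · by_cases hvx : v = x
    · rw [hvx, hm, Function.update_of_ne (by omega), Function.update_of_ne (by omega),
        Function.update_of_ne (by omega), Function.update_of_ne (by omega)]
      simp
    · rw [hv _ (by omega) (by omega) (by omega) (by omega) (by omega), hdeg v hv',
        Function.update_of_ne hvx]
  · by_cases hvx : v = x
    · rw [hvx, hm, Function.update_of_ne (by omega), Function.update_of_ne (by omega),
        Function.update_of_ne (by omega)]
      simp [add_comm]
    · rw [hv _ (by omega) (by omega) (by omega) (by omega) (by omega), hsum v hv',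
        Function.update_of_ne hvx]
  · by_cases hvx : v = x
    · rw [hvx]
      have e₁ : s'.mem (dg + 4 * M + x) = p := by
        rw [hm, Function.update_of_ne (by omega), Function.update_self]
      have e₂ : s'.mem p = y := by
        rw [hm, Function.update_of_ne (by omega), Function.update_of_ne (by omega),
          Function.update_self]
      have e₃ : s'.mem (p + 1) = s.mem (dg + 4 * M + x) := by rw [hm, Function.update_self]
      rw [e₁, Function.update_self]
      refine ⟨by omega, by omega, le_rfl, e₂, ?_⟩
      rw [e₃]
      exact hchain x hu'
    · rw [hv _ (by omega) (by omega) (by omega) (by omega) (by omega), Function.update_of_ne hvx]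
      exact hchain v hv'
  · rw [hv _ (by omega) (by omega) (by omega) (by omega) (by omega), hz a (by omega)]

/-- Adds the edge between the left node `e.1` and the right node `e.2`, which is numbered
`M + e.2`, to the adjacency lists. -/
def addEdge (M : ℕ) (adj : ℕ → List ℕ) (e : ℕ × ℕ) : ℕ → List ℕ :=
  Function.update (Function.update adj e.1 ((M + e.2) :: adj e.1)) (M + e.2)
    (e.1 :: Function.update adj e.1 ((M + e.2) :: adj e.1) (M + e.2))

/-- Reads an edge and adds it to the adjacency lists. -/
def readEdge : RamProg :=
  .seq (block [.load 29 22, .add 22 22 8, .load 30 22, .add 30 30 1, .add 22 22 8])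
    (.seq (addArc 29 30) (addArc 30 29))

theorem runs_readEdges {D M dg : ℕ} (hD : 2 * M + 1 ≤ D) (l : List (ℕ × ℕ)) :
    (∀ e ∈ l, e.1 < M ∧ e.2 < M) → ∀ {s : RamState} {adj : ℕ → List ℕ}, HasBases M dg s →
    AdjStored M dg (s.reg 28) adj s.mem → Enc s.mem (s.reg 22) (l.flatMap fun e => [e.1, e.2]) →
    s.reg 22 + 2 * l.length = dg →
    ∃ s', Runs D (.loop (.lt 22 25) readEdge) s s' (36 * l.length + 1) ∧
      AdjStored M dg (s'.reg 28) (l.foldl (addEdge M) adj) s'.mem := by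
  induction l with
  | nil =>
    intro _ s adj hb h _ h22
    have := hb.deg
    simp only [List.length_nil] at h22
    exact ⟨s, .loopDone (by simp only [Holds]; omega), h⟩
  | cons e l ih =>
    intro hl s adj hb h he h22
    obtain ⟨i, j⟩ := e
    obtain ⟨hi, hj⟩ : i < M ∧ j < M := hl (i, j) (by simp)
    simp only [List.flatMap_cons, List.cons_append, List.nil_append, enc_cons] at he
    simp only [List.length_cons] at h22
    obtain ⟨e0, e1, e2⟩ := he
    obtain ⟨s₁, hs₁, m₁, r29, r30, r22⟩ : ∃ s', Runs D (block [.load 29 22, .add 22 22 8,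
        .load 30 22, .add 30 30 1, .add 22 22 8]) s s' 5 ∧ s'.mem = s.mem ∧ s'.reg 29 = i ∧
        s'.reg 30 = M + j ∧ s'.reg 22 = s.reg 22 + 2 := by
      refine exists_runs_of_vc (P := block [.load 29 22, .add 22 22 8,
        .load 30 22, .add 30 30 1, .add 22 22 8]) ?_
      simp [block, vc, e0, e1, hb.one, hb.reg_one, add_comm j M]
      omega
    have f28 : s₁.reg 28 = s.reg 28 := hs₁.reg_eq (by decide)
    have hb₁ := hb.of_runs hs₁ (by decide)
    obtain ⟨s₂, hs₂, r28, h₂, m₂⟩ := runs_addArc (u := 29) (w := 30) hD hb₁ (by rw [m₁, f28]; exact h)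
      (Or.inl rfl) (Or.inr rfl) (by omega) (by omega)
    have hb₂ := hb₁.of_runs hs₂ (by decide)
    have f29 : s₂.reg 29 = i := by rw [hs₂.reg_eq (by decide), r29]
    have f30 : s₂.reg 30 = M + j := by rw [hs₂.reg_eq (by decide), r30]
    obtain ⟨s₃, hs₃, q28, h₃, m₃⟩ := runs_addArc (u := 30) (w := 29) hD hb₂ h₂
      (Or.inr rfl) (Or.inl rfl) (by omega) (by omega)
    have hb₃ := hb₂.of_runs hs₃ (by decide)
    have f22 : s₃.reg 22 = s.reg 22 + 2 := by
      rw [hs₃.reg_eq (by decide), hs₂.reg_eq (by decide), r22]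
    rw [f29, f30, r29, r30] at h₃
    obtain ⟨s₄, hs₄, h₄⟩ := ih (fun e he => hl e (by simp [he])) hb₃ h₃
      (by
        rw [f22]
        refine e2.congr fun k hk hk' => ?_
        have : (l.flatMap fun e => [e.1, e.2]).length = 2 * l.length := by
          simp [List.length_flatMap, mul_comm]
        rw [this] at hk'
        have e : s.reg 22 + 1 + 1 = s.reg 22 + 2 := rfl
        rw [m₃ k (by omega), m₂ k (by omega), m₁])
      (by omega)
    have := hb.deg
    refine ⟨s₄, (Runs.loopStep (by simp only [Holds]; omega) (hs₁.seq (hs₂.seq hs₃)) hs₄).mono ?_,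
      h₄⟩
    simp only [List.length_cons]
    omega

/-- Properties of the adjacency lists of a bipartite graph with left nodes below `M` and right
nodes from `M` to `2 * M`. -/
structure IsBipAdj (M : ℕ) (adj : ℕ → List ℕ) : Prop where
  nodup : ∀ v, (adj v).Nodup
  symm : ∀ v w, w ∈ adj v → v ∈ adj w
  bip : ∀ v w, w ∈ adj v → v < M ∧ M ≤ w ∧ w < 2 * M ∨ w < M ∧ M ≤ v ∧ v < 2 * M

/-- The induction removes the last edge, because this is the one that `foldl` adds last. Left and
right numbers are disjoint, so the two updates of `addEdge` concern different nodes. -/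
theorem mem_foldl_addEdge {M : ℕ} {l : List (ℕ × ℕ)} (hl : ∀ e ∈ l, e.1 < M ∧ e.2 < M) {v w : ℕ} :
    w ∈ l.foldl (addEdge M) (fun _ => []) v ↔
      ∃ e ∈ l, v = e.1 ∧ w = M + e.2 ∨ v = M + e.2 ∧ w = e.1 := by
  induction l using List.reverseRecOn with
  | nil => simp
  | append_singleton l e ih =>
    have ih := ih fun e he => hl e (by simp [he])
    obtain ⟨h₁, h₂⟩ := hl e (by simp)
    rw [List.foldl_append]
    simp only [List.foldl_cons, List.foldl_nil, addEdge, List.mem_append, List.mem_singleton]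
    have hne : M + e.2 ≠ e.1 := by omega
    rw [Function.update_of_ne hne]
    by_cases hv : v = M + e.2
    · rw [hv, Function.update_self, List.mem_cons, ← hv, ih]
      constructor
      · rintro (rfl | ⟨f, hf, h⟩)
        · exact ⟨e, Or.inr rfl, Or.inr ⟨hv, rfl⟩⟩
        · exact ⟨f, Or.inl hf, h⟩
      · rintro ⟨f, hf | rfl, h⟩
        · exact Or.inr ⟨f, hf, h⟩
        · rcases h with h | h
          · omega
          · exact Or.inl h.2
    · rw [Function.update_of_ne hv]
      by_cases hv' : v = e.1
      · rw [hv', Function.update_self, List.mem_cons, ← hv', ih]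
        constructor
        · rintro (rfl | ⟨f, hf, h⟩)
          · exact ⟨e, Or.inr rfl, Or.inl ⟨hv', rfl⟩⟩
          · exact ⟨f, Or.inl hf, h⟩
        · rintro ⟨f, hf | rfl, h⟩
          · exact Or.inr ⟨f, hf, h⟩
          · rcases h with h | h
            · exact Or.inl h.2
            · omega
      · rw [Function.update_of_ne hv', ih]
        constructor
        · rintro ⟨f, hf, h⟩
          exact ⟨f, Or.inl hf, h⟩
        · rintro ⟨f, hf | rfl, h⟩
          · exact ⟨f, hf, h⟩
          · omega

theorem isBipAdj_foldl_addEdge {M : ℕ} {l : List (ℕ × ℕ)} (hl : ∀ e ∈ l, e.1 < M ∧ e.2 < M)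
    (hn : l.Nodup) : IsBipAdj M (l.foldl (addEdge M) (fun _ => [])) where
  nodup := by
    induction l using List.reverseRecOn with
    | nil => simp
    | append_singleton l e ih =>
      have hl' : ∀ e ∈ l, e.1 < M ∧ e.2 < M := fun e he => hl e (by simp [he])
      obtain ⟨h₁, h₂⟩ := hl e (by simp)
      rw [List.nodup_append] at hn
      have ih := ih hl' hn.1
      have hel : e ∉ l := fun he => hn.2.2 e he e (by simp) rfl
      intro v
      rw [List.foldl_append]
      simp only [List.foldl_cons, List.foldl_nil, addEdge]
      have hne : M + e.2 ≠ e.1 := by omega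
      rw [Function.update_of_ne hne]
      by_cases hv : v = M + e.2
      · rw [hv, Function.update_self, List.nodup_cons, mem_foldl_addEdge hl']
        refine ⟨?_, ih _⟩
        rintro ⟨f, hf, h | h⟩
        · have := hl' f hf
          omega
        · exact hel ((Prod.ext (by omega) (by omega) : e = f) ▸ hf)
      · rw [Function.update_of_ne hv]
        by_cases hv' : v = e.1
        · rw [hv', Function.update_self, List.nodup_cons, mem_foldl_addEdge hl']
          refine ⟨?_, ih _⟩
          rintro ⟨f, hf, h | h⟩
          · exact hel ((Prod.ext (by omega) (by omega) : e = f) ▸ hf)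
          · have := hl' f hf
            omega
        · rw [Function.update_of_ne hv']
          exact ih v
  symm v w := by
    rw [mem_foldl_addEdge hl, mem_foldl_addEdge hl]
    rintro ⟨e, he, h⟩
    exact ⟨e, he, by tauto⟩
  bip v w := by
    rw [mem_foldl_addEdge hl]
    rintro ⟨e, he, h⟩
    have := hl e he
    omega

/-- The handshake identity, by which the cost of peeling is linear in the number of edges. -/
theorem sum_length_foldl_addEdge {M : ℕ} {l : List (ℕ × ℕ)} (hl : ∀ e ∈ l, e.1 < M ∧ e.2 < M) :
    ∑ v ∈ Finset.range (2 * M), (l.foldl (addEdge M) (fun _ => []) v).length = 2 * l.length := by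
  induction l using List.reverseRecOn with
  | nil => simp
  | append_singleton l e ih =>
    have ih := ih fun e he => hl e (by simp [he])
    obtain ⟨h₁, h₂⟩ := hl e (by simp)
    have hne : M + e.2 ≠ e.1 := by omega
    have hc : ∀ v, (((l ++ [e]).foldl (addEdge M) (fun _ => [])) v).length =
        (l.foldl (addEdge M) (fun _ => []) v).length + (if v = M + e.2 then 1 else 0) +
          (if v = e.1 then 1 else 0) := fun v => by
      rw [List.foldl_append]
      simp only [List.foldl_cons, List.foldl_nil, addEdge]
      rw [Function.update_of_ne hne]
      by_cases hv : v = M + e.2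
      · subst hv
        simp [hne]
      · by_cases hv' : v = e.1
        · subst hv'
          simp [hv]
        · simp [hv, hv']
    rw [Finset.sum_congr rfl fun v _ => hc v, Finset.sum_add_distrib, Finset.sum_add_distrib, ih,
      Finset.sum_ite_eq', Finset.sum_ite_eq', if_pos (by simp; omega), if_pos (by simp; omega),
      List.length_append, List.length_singleton]
    ring

end Jedi

/-! ### The peeling loop. -/

namespace Jedi

open RamProg RamTest

/-- Removes the node in register `30` from the degree and the sum of a neighbour, which is put on
the stack. -/
def dropArc : RamProg := block [.load 29 38, .add 31 25 29, .load 32 31, .sub 32 32 8,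
  .store 31 32, .add 31 26 29, .load 32 31, .sub 32 32 30, .store 31 32, .store 34 29,
  .add 34 34 8, .add 38 38 8, .load 38 38]

/-- Adjacency lists are never shortened: deleting `w` only lowers the degrees and sums of its
neighbours. All these neighbours, including nodes removed before, go onto the stack; for removed
nodes truncated subtraction keeps the degree at `0`. -/
theorem runs_dropArcs {D M dg hi w : ℕ} (hD : 2 * M + 1 ≤ D) (l : List ℕ) :
    ∀ {s : RamState}, HasBases M dg s → s.reg 30 = w → Chain s.mem (dg + 8 * M) hi (s.reg 38) l →
    (∀ u ∈ l, u < 2 * M) → l.Nodup → hi ≤ s.reg 34 → dg + 8 * M ≤ hi →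
    ∃ s', Runs D (.loop (.lt 7 38) dropArc) s s' (14 * l.length + 1) ∧
      (∀ u < 2 * M, s'.mem (dg + u) = s.mem (dg + u) - if u ∈ l then 1 else 0) ∧
      (∀ u < 2 * M, s'.mem (dg + 2 * M + u) = s.mem (dg + 2 * M + u) - if u ∈ l then w else 0) ∧
      (∀ a, a < dg ∨ dg + 4 * M ≤ a → a < s.reg 34 → s'.mem a = s.mem a) ∧
      Enc s'.mem (s.reg 34) l ∧ s'.reg 34 = s.reg 34 + l.length := by
  induction l with
  | nil =>
    intro s hb _ hc _ _ _ _
    have h0 : s.reg 38 = 0 := hc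
    refine ⟨s, .loopDone (by simp [Holds, h0]), ?_, ?_, fun _ _ _ => rfl, trivial, rfl⟩ <;> simp
  | cons u l ih =>
    intro s hb h30 hc hl hn hs hd
    obtain ⟨h0, h₁, h₂, h₃, h₄⟩ := hc
    have hu : u < 2 * M := hl u (by simp)
    rw [List.nodup_cons] at hn
    set p := s.reg 38 with hp
    set q := s.reg 34 with hq
    have hbs := hb
    obtain ⟨b1, b7, b8, b25, b26, b27⟩ := hb
    obtain ⟨s₁, hs₁, m₁, r34, r38⟩ : ∃ s', Runs D dropArc s s' 13 ∧
        s'.mem = Function.update (Function.update (Function.update s.mem (dg + u)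
          (s.mem (dg + u) - 1)) (dg + 2 * M + u) (s.mem (dg + 2 * M + u) - w)) q u ∧
        s'.reg 34 = q + 1 ∧ s'.reg 38 = s.mem (p + 1) := by
      refine exists_runs_of_vc (P := dropArc) ?_
      have n₁ : dg + 2 * M + u ≠ dg + u := by omega
      have n₂ : p + 1 ≠ q := by omega
      have n₃ : p + 1 ≠ dg + 2 * M + u := by omega
      have n₄ : p + 1 ≠ dg + u := by omega
      simp [dropArc, block, vc, b8, b25, b26, h30, ← hp, ← hq, h₃, Function.update_of_ne n₁,
        Function.update_of_ne n₂, Function.update_of_ne n₃, Function.update_of_ne n₄]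
      omega
    have hv : ∀ a, a ≠ dg + u → a ≠ dg + 2 * M + u → a ≠ q → s₁.mem a = s.mem a :=
      fun a h₁ h₂ h₃ => by
        rw [m₁, Function.update_of_ne h₃, Function.update_of_ne h₂, Function.update_of_ne h₁]
    have e₁ : s₁.mem (dg + u) = s.mem (dg + u) - 1 := by
      rw [m₁, Function.update_of_ne (by omega), Function.update_of_ne (by omega),
        Function.update_self]
    have e₂ : s₁.mem (dg + 2 * M + u) = s.mem (dg + 2 * M + u) - w := by
      rw [m₁, Function.update_of_ne (by omega), Function.update_self]
    have e₃ : s₁.mem q = u := by rw [m₁, Function.update_self]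
    obtain ⟨s₂, hs₂, d₂, c₂, f₂, a₂, q34⟩ := ih (s := s₁) (hbs.of_runs hs₁ (by decide))
      (by rw [hs₁.reg_eq (by decide), h30])
      (by
        rw [r38]
        exact h₄.congr (fun a _ _ => hv a (by omega) (by omega) (by omega)) le_rfl)
      (fun u hu => hl u (by simp [hu])) hn.2 (by omega) hd
    refine ⟨s₂, (Runs.loopStep (by simp only [Holds]; omega) hs₁ hs₂).mono ?_, ?_, ?_, ?_, ?_, ?_⟩
    · simp only [List.length_cons]
      omega
    · intro v hv'
      rw [d₂ v hv']
      by_cases huv : v = u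
      · rw [huv, e₁]
        simp [hn.1]
      · rw [hv _ (by omega) (by omega) (by omega)]
        simp [huv]
    · intro v hv'
      rw [c₂ v hv']
      by_cases huv : v = u
      · rw [huv, e₂]
        simp [hn.1]
      · rw [hv _ (by omega) (by omega) (by omega)]
        simp [huv]
    · intro a ha ha'
      rw [f₂ a ha (by omega), hv a (by omega) (by omega) (by omega)]
    · refine ⟨by rw [f₂ q (by omega) (by omega), e₃], ?_⟩
      rw [r34] at a₂
      exact a₂
    · rw [q34, r34, List.length_cons]
      ring

/-- The edge with end points `v` and `w`, as a pair of a left and a right node. -/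
def edgeOf (M v w : ℕ) : ℕ × ℕ := if v < w then (v, w - M) else (w, v - M)

/-- Partial runs of the peeling algorithm: `A` is the set of the nodes left, and `out` the list
of the edges found so far. -/
inductive Peeled (M : ℕ) (adj : ℕ → List ℕ) : Finset ℕ → List (ℕ × ℕ) → Prop
  | start : Peeled M adj (Finset.range (2 * M)) []
  | step {A : Finset ℕ} {out : List (ℕ × ℕ)} {v w : ℕ} : Peeled M adj A out → v ∈ A →
      (adj v).filter (· ∈ A) = [w] → Peeled M adj ((A.erase v).erase w) (out ++ [edgeOf M v w])

theorem Peeled.subset {M : ℕ} {adj : ℕ → List ℕ} {A : Finset ℕ} {out : List (ℕ × ℕ)}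
    (h : Peeled M adj A out) : A ⊆ Finset.range (2 * M) := by
  induction h with
  | start => exact subset_rfl
  | step _ _ _ ih => exact ((Finset.erase_subset _ _).trans (Finset.erase_subset _ _)).trans ih

theorem mem_of_filter_eq_singleton {A : Finset ℕ} {l : List ℕ} {w : ℕ}
    (h : l.filter (· ∈ A) = [w]) : w ∈ l ∧ w ∈ A := by
  have : w ∈ l.filter (· ∈ A) := by rw [h]; simp
  simpa using this

/-- Every step removes two distinct nodes and adds one edge. This keeps the output within its `2 *
M` cells. -/
theorem Peeled.card {M : ℕ} {adj : ℕ → List ℕ} (hadj : IsBipAdj M adj) {A : Finset ℕ}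
    {out : List (ℕ × ℕ)} (h : Peeled M adj A out) : A.card + 2 * out.length = 2 * M := by
  induction h with
  | start => simp
  | @step A out v w _ hv hw ih =>
    obtain ⟨h₁, h₂⟩ := mem_of_filter_eq_singleton hw
    have hne : w ≠ v := by have := hadj.bip _ _ h₁; omega
    have hc₁ := Finset.card_erase_add_one hv
    have hc₂ := Finset.card_erase_add_one (Finset.mem_erase.2 ⟨hne, h₂⟩)
    simp only [List.length_append, List.length_singleton]
    omega

/-- The invariant of the peeling loop. -/
structure PeelInv (M dg hi : ℕ) (adj : ℕ → List ℕ) (A : Finset ℕ) (out : List (ℕ × ℕ))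
    (stk : List ℕ) (s : RamState) : Prop where
  bases : HasBases M dg s
  peeled : Peeled M adj A out
  le : dg + 8 * M ≤ hi
  reg_out : s.reg 4 = dg + 6 * M
  reg_len : s.reg 5 = out.length
  reg_stk : s.reg 33 = hi
  reg_top : s.reg 34 = hi + stk.length
  reg_next : s.reg 36 = dg + 6 * M + 2 * out.length
  deg : ∀ v < 2 * M, s.mem (dg + v) = if v ∈ A then ((adj v).filter (· ∈ A)).length else 0
  sum : ∀ v ∈ A, s.mem (dg + 2 * M + v) = ((adj v).filter (· ∈ A)).sum
  chain : ∀ v < 2 * M, Chain s.mem (dg + 8 * M) hi (s.mem (dg + 4 * M + v)) (adj v)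
  stack : Enc s.mem hi stk
  stack_lt : ∀ v ∈ stk, v < 2 * M
  mem_stack : ∀ v ∈ A, ((adj v).filter (· ∈ A)).length = 1 → v ∈ stk
  output : Enc s.mem (dg + 6 * M) (out.flatMap fun e => [e.1, e.2])

/-- Appends the edge between the nodes in the registers `a` (left) and `b` (right). -/
def recordEdge (a b : ℕ) : RamProg :=
  block [.store 36 a, .add 36 36 8, .sub 37 b 1, .store 36 37, .add 36 36 8]

/-- Peels the edge of the node of degree one in register `29`. -/
def peelNode : RamProg :=
  .seq (block [.add 31 26 29, .load 30 31])
  (.seq (.cond (.lt 29 30) (recordEdge 29 30) (recordEdge 30 29))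
  (.seq (block [.add 5 5 8, .add 31 25 30, .store 31 7, .add 31 27 30, .load 38 31])
    (.loop (.lt 7 38) dropArc)))

/-- The sum of the remaining neighbours of a node of degree one is the number of its only neighbour
`w`, which is thus found without a search. The node `w` gets degree `0` directly, and `v` does so as
a neighbour of `w`. The node `v` has just been popped, so the invariant is assumed for the stack
with `v` put back. -/
theorem runs_peelNode {D M dg hi : ℕ} (hD : 2 * M + 1 ≤ D) {adj : ℕ → List ℕ}
    (hadj : IsBipAdj M adj) {A : Finset ℕ} {out : List (ℕ × ℕ)} {stk : List ℕ} {s : RamState}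
    {v w : ℕ} (hv : v ∈ A) (hw : (adj v).filter (· ∈ A) = [w]) (h29 : s.reg 29 = v)
    (h : ∀ v' ∈ A, v' ≠ v → ((adj v').filter (· ∈ A)).length = 1 → v' ∈ stk)
    (hs : PeelInv M dg hi adj A out (stk ++ [v]) (s.setReg 34 (s.reg 34 + 1))) :
    ∃ s', Runs D peelNode s s' (14 * (adj w).length + 14) ∧
      PeelInv M dg hi adj ((A.erase v).erase w) (out ++ [edgeOf M v w]) (stk ++ adj w) s' := by
  obtain ⟨hwv, hwA⟩ := mem_of_filter_eq_singleton hw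
  have hvw := hadj.symm _ _ hwv
  have hbip := hadj.bip _ _ hwv
  have hcard := hs.peeled.card hadj
  have hAlt : ∀ u ∈ A, u < 2 * M := fun u hu => by simpa using hs.peeled.subset hu
  have hout : out.length < M := by
    have := Finset.card_pos.2 ⟨v, hv⟩
    omega
  have hpeel := hs.peeled.step hv hw
  obtain ⟨hb, -, hle, h4, h5, h33, h34, h36, hdeg, hsum, hch, hstk, hlt, -, henc⟩ := hs
  have hb : HasBases M dg s := by
    obtain ⟨a, b, c, d, e, f⟩ := hb
    simp only [RamState.setReg_reg] at a b c d e f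
    norm_num at a b c d e f
    exact ⟨a, b, c, d, e, f⟩
  simp only [RamState.setReg_reg] at h4 h5 h33 h34 h36
  norm_num at h4 h5 h33 h34 h36
  simp only [RamState.setReg_mem] at hdeg hsum hch hstk henc
  rw [enc_append] at hstk
  have h34 : s.reg 34 = hi + stk.length := by omega
  obtain ⟨b1, b7, b8, b25, b26, b27⟩ := id hb
  obtain ⟨s₁, hs₁, m₁, r30⟩ : ∃ s', Runs D (block [.add 31 26 29, .load 30 31]) s s' 2 ∧
      s'.mem = s.mem ∧ s'.reg 30 = w := by
    refine exists_runs_of_vc (P := block [.add 31 26 29, .load 30 31]) ?_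
    have := hsum v hv
    rw [hw] at this
    simp [block, vc, b26, h29, this]
    omega
  have hb₁ := hb.of_runs hs₁ (by decide)
  have f29 : s₁.reg 29 = v := by rw [hs₁.reg_eq (by decide), h29]
  have f36 : s₁.reg 36 = dg + 6 * M + 2 * out.length := by rw [hs₁.reg_eq (by decide), h36]
  have hrec : ∀ a b : ℕ, a ≠ 36 → b ≠ 36 → ∃ s', Runs D (recordEdge a b) s₁ s' 5 ∧
      s'.mem = Function.update (Function.update s.mem (s₁.reg 36) (s₁.reg a)) (s₁.reg 36 + 1)
        (s₁.reg b - M) ∧ s'.reg 36 = s₁.reg 36 + 2 := fun a b ha hb' => by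
    refine exists_runs_of_vc (P := recordEdge a b) ?_
    simp [recordEdge, block, vc, hb₁.one, hb₁.reg_one, m₁, hb']
    omega
  obtain ⟨s₂, hs₂, m₂, r36⟩ : ∃ s', Runs D (.cond (.lt 29 30) (recordEdge 29 30)
      (recordEdge 30 29)) s₁ s' 6 ∧
      s'.mem = Function.update (Function.update s.mem (s₁.reg 36) (edgeOf M v w).1)
        (s₁.reg 36 + 1) (edgeOf M v w).2 ∧ s'.reg 36 = s₁.reg 36 + 2 := by
    by_cases hlt : v < w
    · obtain ⟨s', h₁, h₂⟩ := hrec 29 30 (by omega) (by omega)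
      refine ⟨s', h₁.condTrue (by simpa [Holds, f29, r30] using hlt), ?_⟩
      simpa [edgeOf, hlt, f29, r30] using h₂
    · obtain ⟨s', h₁, h₂⟩ := hrec 30 29 (by omega) (by omega)
      refine ⟨s', h₁.condFalse (by simpa [Holds, f29, r30] using hlt), ?_⟩
      simpa [edgeOf, hlt, f29, r30] using h₂
  rw [f36] at m₂ r36
  have hb₂ := hb₁.of_runs hs₂ (by decide)
  have g30 : s₂.reg 30 = w := by rw [hs₂.reg_eq (by decide), r30]
  have g5 : s₂.reg 5 = out.length := by
    rw [hs₂.reg_eq (by decide), hs₁.reg_eq (by decide), h5]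
  obtain ⟨s₃, hs₃, m₃, r5, r38⟩ : ∃ s', Runs D (block [.add 5 5 8, .add 31 25 30, .store 31 7,
      .add 31 27 30, .load 38 31]) s₂ s' 5 ∧ s'.mem = Function.update s₂.mem (dg + w) 0 ∧
      s'.reg 5 = out.length + 1 ∧ s'.reg 38 = s.mem (dg + 4 * M + w) := by
    refine exists_runs_of_vc (P := block [.add 5 5 8, .add 31 25 30, .store 31 7,
      .add 31 27 30, .load 38 31]) ?_
    have hx : s₂.mem (dg + 4 * M + w) = s.mem (dg + 4 * M + w) := by
      rw [m₂, Function.update_of_ne (by omega), Function.update_of_ne (by omega)]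
    have n₁ : dg + 4 * M + w ≠ dg + w := by omega
    simp [block, vc, hb₂.one, hb₂.zero, hb₂.deg, hb₂.head, g30, g5, Function.update_of_ne n₁, hx]
    omega
  have hb₃ := hb₂.of_runs hs₃ (by decide)
  have hm₃ : ∀ a, a ≠ dg + w → a ≠ dg + 6 * M + 2 * out.length →
      a ≠ dg + 6 * M + 2 * out.length + 1 → s₃.mem a = s.mem a := fun a h₁ h₂ h₃ => by
    rw [m₃, Function.update_of_ne h₁, m₂, Function.update_of_ne h₃, Function.update_of_ne h₂]
  have p34 : s₃.reg 34 = hi + stk.length := by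
    rw [hs₃.reg_eq (by decide), hs₂.reg_eq (by decide), hs₁.reg_eq (by decide), h34]
  have hwlt := hAlt w hwA
  obtain ⟨s₄, hs₄, d₄, c₄, f₄, a₄, q34⟩ := runs_dropArcs hD (adj w) (hi := hi) (w := w) hb₃
    (by rw [hs₃.reg_eq (by decide), g30])
    (by
      rw [r38]
      exact (hch w hwlt).congr (fun a _ _ => hm₃ a (by omega) (by omega) (by omega)) le_rfl)
    (fun u hu => by have := hadj.bip _ _ hu; omega) (hadj.nodup w) (by omega) hle
  have hf : ∀ a, a < dg ∨ dg + 4 * M ≤ a → a < hi + stk.length →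
      a ≠ dg + 6 * M + 2 * out.length → a ≠ dg + 6 * M + 2 * out.length + 1 →
      s₄.mem a = s.mem a := fun a h₁ h₂ h₃ h₄ => by
    rw [f₄ a h₁ (by omega), hm₃ a (by omega) h₃ h₄]
  -- No such `u` is adjacent to `v`, whose only remaining neighbour is `w`; so at most `w`
  -- disappears from the neighbours of `u`.
  have hfil : ∀ u, u ∈ A → u ≠ v → u ≠ w → (adj u).filter (· ∈ (A.erase v).erase w) =
      ((adj u).filter (· ∈ A)).erase w := fun u hu huv huw => by
    rw [((hadj.nodup u).filter _).erase_eq_filter, List.filter_filter]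
    refine List.filter_congr fun x hx => ?_
    have hxv : x ≠ v := by
      rintro rfl
      have : u ∈ (adj x).filter (· ∈ A) := by simp [hu, hadj.symm _ _ hx]
      rw [hw] at this
      exact huw (by simpa using this)
    rw [Bool.eq_iff_iff]
    simp [hxv]
  have hmemf : ∀ u, u ∈ A → (w ∈ (adj u).filter (· ∈ A) ↔ u ∈ adj w) := fun u hu => by
    simp only [List.mem_filter, hwA, decide_true, and_true]
    exact ⟨hadj.symm _ _, hadj.symm _ _⟩
  have hrun : Runs D peelNode s s₄ (14 * (adj w).length + 14) :=
    (hs₁.seq (hs₂.seq (hs₃.seq hs₄))).mono (by omega)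
  have hdegmem : ∀ u < 2 * M, s₄.mem (dg + u) = if u = w then 0 else
      s.mem (dg + u) - if u ∈ adj w then 1 else 0 := fun u hu => by
    rw [d₄ u hu]
    split_ifs with h₁ h₂ h₂
    · subst h₂
      rw [m₃, Function.update_self]
    · rw [hm₃ _ (by omega) (by omega) (by omega)]
    · subst h₂
      rw [m₃, Function.update_self]
    · rw [hm₃ _ (by omega) (by omega) (by omega)]
  have hedge : s₄.mem (dg + 6 * M + 2 * out.length) = (edgeOf M v w).1 ∧
      s₄.mem (dg + 6 * M + 2 * out.length + 1) = (edgeOf M v w).2 := by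
    constructor
    · rw [f₄ _ (by omega) (by omega), m₃, Function.update_of_ne (by omega), m₂,
        Function.update_of_ne (by omega), Function.update_self]
    · rw [f₄ _ (by omega) (by omega), m₃, Function.update_of_ne (by omega), m₂,
        Function.update_self]
  refine ⟨s₄, hrun, hb₃.of_runs hs₄ (by decide), hpeel, hle, ?_, ?_, ?_, ?_, ?_, ?_, ?_, ?_, ?_,
    ?_, ?_, ?_⟩
  · rw [hrun.reg_eq (by decide), h4]
  · rw [hs₄.reg_eq (by decide), r5]
    simp
  · rw [hrun.reg_eq (by decide), h33]
  · rw [q34, p34, List.length_append, add_assoc]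
  · rw [hs₄.reg_eq (by decide), hs₃.reg_eq (by decide), r36]
    simp only [List.length_append, List.length_singleton]
    ring
  · intro u hu
    rw [hdegmem u hu, hdeg u hu]
    by_cases huw : u = w
    · simp [huw]
    by_cases huv : u = v
    · have hn : u ∉ (A.erase v).erase w := by simp [huv]
      rw [if_neg huw, if_neg hn, huv, if_pos hv, hw, if_pos hvw, List.length_singleton]
    by_cases huA : u ∈ A
    · have hn : u ∈ (A.erase v).erase w := by simp [huw, huv, huA]
      rw [if_neg huw, if_pos huA, if_pos hn, hfil u huA huv huw]
      by_cases hx : u ∈ adj w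
      · rw [if_pos hx, List.length_erase_of_mem ((hmemf u huA).2 hx)]
      · rw [if_neg hx, List.erase_of_not_mem (fun hc => hx ((hmemf u huA).1 hc)), tsub_zero]
    · have hn : u ∉ (A.erase v).erase w := by simp [huA]
      rw [if_neg huw, if_neg huA, if_neg hn, zero_tsub]
  · intro u hu
    simp only [Finset.mem_erase] at hu
    obtain ⟨huw, huv, huA⟩ := hu
    have hul := hAlt u huA
    rw [c₄ u hul, hm₃ _ (by omega) (by omega) (by omega), hsum u huA, hfil u huA huv huw]
    by_cases hx : u ∈ adj w
    · rw [if_pos hx, ← List.sum_erase ((hmemf u huA).2 hx)]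
      omega
    · rw [if_neg hx, List.erase_of_not_mem (fun hc => hx ((hmemf u huA).1 hc))]
      rfl
  · intro u hu
    rw [hf _ (by omega) (by omega) (by omega) (by omega)]
    exact (hch u hu).congr (fun a _ _ => hf a (by omega) (by omega) (by omega) (by omega)) le_rfl
  · rw [enc_append]
    refine ⟨hstk.1.congr fun k _ _ => hf k (by omega) (by omega) (by omega) (by omega), ?_⟩
    rw [← p34]
    exact a₄
  · intro u hu
    rcases List.mem_append.1 hu with hu | hu
    · exact hlt u (by simp [hu])
    · have := hadj.bip _ _ hu
      omega
  -- A node that has degree one now is either a neighbour of `w`, and has just been pushed, or had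
  -- degree one before.
  · intro u hu hlen
    simp only [Finset.mem_erase] at hu
    obtain ⟨huw, huv, huA⟩ := hu
    rw [hfil u huA huv huw] at hlen
    by_cases hx : u ∈ adj w
    · simp [hx]
    · rw [List.erase_of_not_mem (fun hc => hx ((hmemf u huA).1 hc))] at hlen
      simp [h u huA huv hlen]
  · have hlen : (out.flatMap fun e => [e.1, e.2]).length = 2 * out.length := by
      simp [List.length_flatMap, mul_comm]
    rw [List.flatMap_append, enc_append]
    refine ⟨henc.congr fun k _ hk => ?_, ?_⟩
    · rw [hlen] at hk
      exact hf k (by omega) (by omega) (by omega) (by omega)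
    · rw [hlen]
      simpa using hedge

/-- Takes a node from the stack, and peels its edge if the degree is one. -/
def peelStep : RamProg :=
  .seq (block [.sub 34 34 8, .load 29 34, .add 31 25 29, .load 32 31])
    (.cond (.eq 32 8) peelNode .skip)

/-- Amortized analysis: the potential is the stack length plus the sum of the original degrees of
the remaining nodes. Peeling `v` and `w` pops one entry and pushes those of `adj w`, but removes
both degrees from the sum, that of `v` being positive. Each unit of the sum carries `34 = 20 + 14`
instructions, `20` for a later pop and `14` for a pass of `dropArc`. -/
theorem runs_peel {D M dg hi : ℕ} (hD : 2 * M + 1 ≤ D) {adj : ℕ → List ℕ}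
    (hadj : IsBipAdj M adj) (k : ℕ) : ∀ {A : Finset ℕ} {out : List (ℕ × ℕ)} {stk : List ℕ}
    {s : RamState}, PeelInv M dg hi adj A out stk s →
    stk.length + ∑ v ∈ A, (adj v).length = k →
    ∃ s', Runs D (.loop (.lt 33 34) peelStep) s s'
        (20 * stk.length + 34 * ∑ v ∈ A, (adj v).length + 1) ∧
      ∃ A' out', PeelInv M dg hi adj A' out' [] s' := by
  induction k using Nat.strong_induction_on with
  | _ k ih =>
    intro A out stk s hs hk
    rcases List.eq_nil_or_concat stk with rfl | ⟨stk, v, rfl⟩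
    · have h₁ := hs.reg_stk
      have h₂ := hs.reg_top
      refine ⟨s, (Runs.loopDone ?_).mono (by omega), A, out, hs⟩
      simp only [Holds, h₁, h₂]
      simp
    · rw [List.concat_eq_append] at hs hk ⊢
      have hstack := hs.stack
      rw [enc_append] at hstack
      have hv : s.mem (hi + stk.length) = v := hstack.2.1
      have hvlt : v < 2 * M := hs.stack_lt v (by simp)
      have htop := hs.reg_top
      simp only [List.length_append, List.length_singleton] at htop hk ⊢
      obtain ⟨s₁, hs₁, m₁, r34, r29, r32⟩ : ∃ s', Runs D (block [.sub 34 34 8, .load 29 34,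
          .add 31 25 29, .load 32 31]) s s' 4 ∧ s'.mem = s.mem ∧ s'.reg 34 = hi + stk.length ∧
          s'.reg 29 = v ∧ s'.reg 32 = s.mem (dg + v) := by
        refine exists_runs_of_vc (P := block [.sub 34 34 8, .load 29 34,
          .add 31 25 29, .load 32 31]) ?_
        have e : hi + (stk.length + 1) - 1 = hi + stk.length := by omega
        simp [block, vc, hs.bases.one, hs.bases.deg, htop, e, hv]
        omega
      have hb₁ := hs.bases.of_runs hs₁ (by decide)
      have q8 := hb₁.one
      rw [hs.deg v hvlt] at r32
      have hloop : RamTest.Holds (.lt 33 34) s := by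
        have := hs.reg_stk
        simp only [Holds]
        omega
      have e4 : s₁.reg 4 = s.reg 4 := hs₁.reg_eq (by decide)
      have e5 : s₁.reg 5 = s.reg 5 := hs₁.reg_eq (by decide)
      have e33 : s₁.reg 33 = s.reg 33 := hs₁.reg_eq (by decide)
      have e36 : s₁.reg 36 = s.reg 36 := hs₁.reg_eq (by decide)
      by_cases hd : v ∈ A ∧ ((adj v).filter (· ∈ A)).length = 1
      · obtain ⟨hvA, hd⟩ := hd
        obtain ⟨w, hw⟩ := List.length_eq_one_iff.1 hd
        have hinv : PeelInv M dg hi adj A out (stk ++ [v])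
            (s₁.setReg 34 (s₁.reg 34 + 1)) := by
          obtain ⟨a, b, c, d, e, f⟩ := hb₁
          refine ⟨⟨?_, ?_, ?_, ?_, ?_, ?_⟩, hs.peeled, hs.le, ?_, ?_, ?_, ?_, ?_,
            by simpa [m₁] using hs.deg, by simpa [m₁] using hs.sum, by simpa [m₁] using hs.chain,
            by simpa [m₁] using hs.stack, hs.stack_lt, hs.mem_stack,
            by simpa [m₁] using hs.output⟩
          · simpa using a
          · simpa using b
          · simpa using c
          · simpa using d
          · simpa using e
          · simpa using f
          · simpa [e4] using hs.reg_out
          · simpa [e5] using hs.reg_len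
          · simpa [e33] using hs.reg_stk
          · simp [r34, add_assoc]
          · simpa [e36] using hs.reg_next
        obtain ⟨s₂, hs₂, h₂⟩ := runs_peelNode hD hadj hvA hw r29
          (fun u hu huv hl => by simpa [huv] using hs.mem_stack u hu hl) hinv
        obtain ⟨hwv, hwA⟩ := mem_of_filter_eq_singleton hw
        have hne : w ≠ v := by have := hadj.bip _ _ hwv; omega
        have hsum : ∑ u ∈ (A.erase v).erase w, (adj u).length + (adj w).length + (adj v).length =
            ∑ u ∈ A, (adj u).length := by
          rw [Finset.sum_erase_add _ _ (Finset.mem_erase.2 ⟨hne, hwA⟩),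
            Finset.sum_erase_add _ _ hvA]
        have hc := hs₂.condTrue (c := .eq 32 8) (Q := .skip) (by
          simp only [Holds, r32, q8, hvA, if_true, hd])
        obtain ⟨s₃, hs₃, h₃⟩ := ih ((stk ++ adj w).length + ∑ u ∈ (A.erase v).erase w,
          (adj u).length) (by
            have : 0 < (adj v).length := List.length_pos_of_mem hwv
            rw [List.length_append]
            omega) h₂ rfl
        refine ⟨s₃, (Runs.loopStep hloop (hs₁.seq hc) hs₃).mono ?_, h₃⟩
        rw [List.length_append]
        omega
      · have hinv : PeelInv M dg hi adj A out stk s₁ := by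
          refine ⟨hb₁, hs.peeled, hs.le, by rw [e4, hs.reg_out], by rw [e5, hs.reg_len],
            by rw [e33, hs.reg_stk], r34, by rw [e36, hs.reg_next], m₁ ▸ hs.deg, m₁ ▸ hs.sum,
            m₁ ▸ hs.chain, m₁ ▸ hstack.1, fun u hu => hs.stack_lt u (by simp [hu]), ?_,
            m₁ ▸ hs.output⟩
          intro u hu hl
          have := hs.mem_stack u hu hl
          rw [List.mem_append, List.mem_singleton] at this
          rcases this with h | rfl
          · exact h
          · exact absurd ⟨hu, hl⟩ hd
        obtain ⟨s₃, hs₃, h₃⟩ := ih (stk.length + ∑ u ∈ A, (adj u).length) (by omega) hinv rfl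
        have hc := (runs_skip D s₁).condFalse (c := .eq 32 8) (P := peelNode) (by
          simp only [Holds, r32, q8]
          split_ifs with hvA
          · exact fun hl => hd ⟨hvA, hl⟩
          · simp)
        exact ⟨s₃, (Runs.loopStep hloop (hs₁.seq hc) hs₃).mono (by omega), h₃⟩

end Jedi

/-! ### Assembly of Step 2. -/

namespace Jedi

open RamProg RamTest

/-- Puts a node on the stack. -/
def pushNode : RamProg := block [.store 34 29, .add 34 34 8, .add 29 29 8]

theorem runs_pushNodes {D m : ℕ} (hD : 1 ≤ D) (k : ℕ) : ∀ {v : ℕ}, v + k = m →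
    ∀ {s : RamState}, s.reg 8 = 1 → s.reg 29 = v → s.reg 35 = m →
    ∃ s', Runs D (.loop (.lt 29 35) pushNode) s s' (4 * k + 1) ∧
      Appends s.mem s'.mem (s.reg 34) (List.range' v k) ∧ s'.reg 34 = s.reg 34 + k := by
  induction k with
  | zero =>
    intro v hv s h8 h29 h35
    exact ⟨s, .loopDone (by simp only [Holds]; omega), .nil _ _, by simp⟩
  | succ k ih =>
    intro v hv s h8 h29 h35
    obtain ⟨s₁, hs₁, m₁, r34, r29⟩ : ∃ s', Runs D pushNode s s' 3 ∧
        s'.mem = Function.update s.mem (s.reg 34) v ∧ s'.reg 34 = s.reg 34 + 1 ∧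
        s'.reg 29 = v + 1 := by
      refine exists_runs_of_vc (P := pushNode) ?_
      simp [pushNode, block, vc, h8, h29]
      omega
    obtain ⟨s₂, hs₂, a₂, q34⟩ := ih (v := v + 1) (by omega) (s := s₁)
      (by rw [hs₁.reg_eq (by decide), h8]) r29 (by rw [hs₁.reg_eq (by decide), h35])
    have a₁ : Appends s.mem s₁.mem (s.reg 34) [v] := m₁ ▸ appends_one _ _ _
    rw [r34] at a₂
    exact ⟨s₂, (Runs.loopStep (by simp only [Holds]; omega) hs₁ hs₂).mono (by omega),
      a₁.trans a₂, by omega⟩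

/-- Step 2: adjacency lists are built, and the graph is peeled with the help of a stack that
holds all nodes of degree one. -/
def step₂ : RamProg :=
  .seq (block [.copy 25 23, .add 26 25 1, .add 26 26 1, .add 27 26 1, .add 27 27 1, .add 4 27 1,
    .add 4 4 1, .add 28 4 1, .add 28 28 1, .copy 22 2])
  (.seq (.loop (.lt 22 25) readEdge)
  (.seq (block [.copy 33 28, .copy 34 28, .const 29 0, .add 35 1 1, .copy 36 4, .const 5 0])
  (.seq (.loop (.lt 29 35) pushNode)
  (.seq (.loop (.lt 33 34) peelStep)
    (.cond (.eq 5 1) (.const 6 1) (.const 6 0))))))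

/-- With all `2 * M` nodes on the stack at first, the invariant that nodes of degree one are on the
stack holds trivially; an empty stack at the end then says that no such node is left. The factor
`104 = 36 + 2 * 34` charges an edge for being read and for its two ends. -/
theorem runs_step₂ {D M : ℕ} (hD : 2 * M + 1 ≤ D) {l : List (ℕ × ℕ)}
    (hl : ∀ e ∈ l, e.1 < M ∧ e.2 < M) (hn : l.Nodup) {s : RamState}
    (he : Enc s.mem (s.reg 2) (l.flatMap fun e => [e.1, e.2]))
    (h23 : s.reg 23 = s.reg 2 + 2 * l.length) (hz : ∀ a, s.reg 23 ≤ a → s.mem a = 0)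
    (h1 : s.reg 1 = M) (h7 : s.reg 7 = 0) (h8 : s.reg 8 = 1) :
    ∃ s', Runs D step₂ s s' (48 * M + 104 * l.length + 21) ∧ ∃ A out,
      Peeled M (l.foldl (addEdge M) fun _ => []) A out ∧
      (∀ v ∈ A, ((l.foldl (addEdge M) (fun _ => []) v).filter (· ∈ A)).length ≠ 1) ∧
      Enc s'.mem (s'.reg 4) (out.flatMap fun e => [e.1, e.2]) ∧ s'.reg 5 = out.length ∧
      s'.reg 6 = if out.length = M then 1 else 0 := by
  set dg := s.reg 23 with hdg
  set adj := l.foldl (addEdge M) fun _ => [] with hadj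
  have hbip : IsBipAdj M adj := isBipAdj_foldl_addEdge hl hn
  obtain ⟨s₁, hs₁, m₁, r25, r26, r27, r4, r28, r22⟩ : ∃ s', Runs D (block [.copy 25 23,
      .add 26 25 1, .add 26 26 1, .add 27 26 1, .add 27 27 1, .add 4 27 1,
      .add 4 4 1, .add 28 4 1, .add 28 28 1, .copy 22 2]) s s' 10 ∧ s'.mem = s.mem ∧
      s'.reg 25 = dg ∧ s'.reg 26 = dg + 2 * M ∧ s'.reg 27 = dg + 4 * M ∧ s'.reg 4 = dg + 6 * M ∧
      s'.reg 28 = dg + 8 * M ∧ s'.reg 22 = s.reg 2 := by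
    refine exists_runs_of_vc (P := block [.copy 25 23, .add 26 25 1, .add 26 26 1, .add 27 26 1,
      .add 27 27 1, .add 4 27 1, .add 4 4 1, .add 28 4 1, .add 28 28 1, .copy 22 2]) ?_
    simp [block, vc, h1, ← hdg]
    omega
  have hb₁ : HasBases M dg s₁ := ⟨by rw [hs₁.reg_eq (by decide), h1],
    by rw [hs₁.reg_eq (by decide), h7], by rw [hs₁.reg_eq (by decide), h8], r25, r26, r27⟩
  obtain ⟨s₂, hs₂, h₂⟩ := runs_readEdges hD l hl hb₁ (adj := fun _ => [])
    ⟨fun v _ => by rw [m₁, hz _ (by omega)]; rfl, fun v _ => by rw [m₁, hz _ (by omega)]; rfl,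
      fun v _ => by rw [m₁, hz _ (by omega)]; rfl, fun a ha => by rw [m₁, hz _ (by omega)],
      by omega⟩ (by rw [m₁, r22]; exact he) (by omega)
  rw [← hadj] at h₂
  have hb₂ := hb₁.of_runs hs₂ (by decide)
  set hi := s₂.reg 28 with hhi
  have f4 : s₂.reg 4 = dg + 6 * M := by rw [hs₂.reg_eq (by decide), r4]
  obtain ⟨s₃, hs₃, m₃, q33, q34, q29, q35, q36, q5⟩ : ∃ s', Runs D (block [.copy 33 28,
      .copy 34 28, .const 29 0, .add 35 1 1, .copy 36 4, .const 5 0]) s₂ s' 6 ∧ s'.mem = s₂.mem ∧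
      s'.reg 33 = hi ∧ s'.reg 34 = hi ∧ s'.reg 29 = 0 ∧ s'.reg 35 = 2 * M ∧
      s'.reg 36 = dg + 6 * M ∧ s'.reg 5 = 0 := by
    refine exists_runs_of_vc (P := block [.copy 33 28,
      .copy 34 28, .const 29 0, .add 35 1 1, .copy 36 4, .const 5 0]) ?_
    simp [block, vc, hb₂.reg_one, f4, ← hhi]
    omega
  have hb₃ := hb₂.of_runs hs₃ (by decide)
  obtain ⟨s₄, hs₄, a₄, p34⟩ := runs_pushNodes (D := D) (by omega) (2 * M) (v := 0) (by omega) hb₃.one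
    q29 q35
  rw [q34, m₃, ← List.range_eq_range'] at a₄
  rw [q34] at p34
  have hb₄ := hb₃.of_runs hs₄ (by decide)
  have hle := h₂.le
  have hsame : ∀ a < hi, s₄.mem a = s₂.mem a := a₄.same
  have hall : ∀ v, (adj v).filter (· ∈ Finset.range (2 * M)) = adj v := fun v => by
    rw [List.filter_eq_self]
    intro w hw
    have := hbip.bip _ _ hw
    simp only [Finset.mem_range, decide_eq_true_eq]
    omega
  have hinv : PeelInv M dg hi adj (Finset.range (2 * M)) [] (List.range (2 * M)) s₄ := by
    refine ⟨hb₄, .start, hle, ?_, ?_, ?_, ?_, ?_, ?_, ?_, ?_, a₄.enc, ?_, ?_, trivial⟩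
    · rw [hs₄.reg_eq (by decide), hs₃.reg_eq (by decide), f4]
    · rw [hs₄.reg_eq (by decide), q5]
      rfl
    · rw [hs₄.reg_eq (by decide), q33]
    · rw [p34, List.length_range]
    · rw [hs₄.reg_eq (by decide), q36]
      rfl
    · intro v hv
      rw [hsame _ (by omega), h₂.deg v hv, if_pos (Finset.mem_range.2 hv), hall]
    · intro v hv
      have hv' := Finset.mem_range.1 hv
      rw [hsame _ (by omega), h₂.sum v hv', hall]
    · intro v hv
      rw [hsame _ (by omega)]
      exact (h₂.chain v hv).congr (fun a _ ha => hsame a ha) le_rfl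
    · intro v hv
      exact List.mem_range.1 hv
    · intro v hv _
      exact List.mem_range.2 (Finset.mem_range.1 hv)
  obtain ⟨s₅, hs₅, A, out, h₅⟩ := runs_peel hD hbip _ hinv rfl
  rw [hadj, sum_length_foldl_addEdge hl, List.length_range] at hs₅
  obtain ⟨s₆, hs₆, m₆, r6⟩ : ∃ s', Runs D (.cond (.eq 5 1) (.const 6 1) (.const 6 0)) s₅ s' 2 ∧
      s'.mem = s₅.mem ∧ s'.reg 6 = if out.length = M then 1 else 0 := by
    refine exists_runs_of_vc (P := .cond (.eq 5 1) (.const 6 1) (.const 6 0)) ?_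
    simp only [vc, Holds, h₅.reg_len, h₅.bases.reg_one, RamState.setReg_reg, if_true,
      RamState.setReg_mem, true_and]
    refine ⟨fun h => ⟨by omega, by rw [if_pos h]⟩, fun h => ⟨by omega, by rw [if_neg h]⟩⟩
  have e4 : s₆.reg 4 = dg + 6 * M := by rw [hs₆.reg_eq (by decide), h₅.reg_out]
  refine ⟨s₆, (hs₁.seq (hs₂.seq (hs₃.seq (hs₄.seq (hs₅.seq hs₆))))).mono (by omega), A, out,
    h₅.peeled, ?_, ?_, ?_, r6⟩
  · intro v hv hl
    have := h₅.mem_stack v hv hl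
    simp at this
  · rw [e4, m₆]
    exact h₅.output
  · rw [hs₆.reg_eq (by decide), h₅.reg_len]

end Jedi

/-! ## Peeling and unique perfect matchings -/

namespace BalBipGraph

variable {M : ℕ} {G : BalBipGraph M}

/-- The nodes that remain after a run of the peeling algorithm. -/
theorem PeelRun.exists_rest {L R : Finset (Fin M)} {l : List (Fin M × Fin M)}
    (h : G.PeelRun L R l) : ∃ L' R' : Finset (Fin M), (∀ i j, ¬ G.Peelable L' R' i j) ∧
      R'.card + l.length = R.card ∧ (∀ j ∈ R, j ∉ R' → ∃ i, (i, j) ∈ l) ∧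
      ∀ σ : Equiv.Perm (Fin M), G.IsPerfectMatching σ → (∀ j, j ∈ R ↔ σ j ∈ L) →
        (∀ j, j ∈ R' ↔ σ j ∈ L') ∧ ∀ i j, (i, j) ∈ l → i = σ j := by
  induction h with
  | @done L R h => exact ⟨L, R, h, by simp, fun j hj hj' => absurd hj hj', fun σ _ hσ => ⟨hσ, by simp⟩⟩
  | @peel L R i j l hp _ ih =>
    obtain ⟨L', R', h₁, h₂, h₃, h₄⟩ := ih
    refine ⟨L', R', h₁, ?_, ?_, ?_⟩
    · have := Finset.card_erase_add_one hp.2.1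
      rw [List.length_cons]
      omega
    · intro j' hj' hn
      by_cases hjj : j' = j
      · exact ⟨i, by simp [hjj]⟩
      · obtain ⟨i', hi'⟩ := h₃ j' (Finset.mem_erase.2 ⟨hjj, hj'⟩) hn
        exact ⟨i', List.mem_cons_of_mem _ hi'⟩
    · intro σ hσ hLR
      -- The edge is forced: the partners under `σ` of remaining nodes remain, and one of the two
      -- ends has no other remaining neighbour.
      have hij : i = σ j := by
        obtain ⟨hi, hj, -, h | h⟩ := hp
        · have h₅ := h (σ.symm i) ((hLR _).2 (by simpa using hi)) (by simpa using hσ (σ.symm i))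
          rw [← h₅, Equiv.apply_symm_apply]
        · exact (h (σ j) ((hLR j).1 hj) (hσ j)).symm
      obtain ⟨h₅, h₆⟩ := h₄ σ hσ fun j' => by
        simp only [Finset.mem_erase, hLR j', hij, ne_eq, EmbeddingLike.apply_eq_iff_eq]
      refine ⟨h₅, fun i' j' h => ?_⟩
      rcases List.mem_cons.1 h with h | h
      · obtain ⟨rfl, rfl⟩ := Prod.mk.inj h
        exact hij
      · exact h₆ i' j' h

/-- If the edges of a perfect matching can be exchanged along `f`, then there is another perfect
matching. -/
theorem exists_ne_of_exchange {σ : Equiv.Perm (Fin M)} (hσ : G.IsPerfectMatching σ)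
    {R : Finset (Fin M)} (hR : R.Nonempty) {f : Fin M → Fin M} (hf : ∀ j ∈ R, f j ∈ R)
    (hne : ∀ j ∈ R, f j ≠ j) (hG : ∀ j ∈ R, G (σ (f j)) j) :
    ∃ τ, G.IsPerfectMatching τ ∧ τ ≠ σ := by
  classical
  obtain ⟨j₀, hj₀⟩ := hR
  have hit : ∀ k, f^[k] j₀ ∈ R := fun k => by
    induction k with
    | zero => exact hj₀
    | succ k ih =>
      rw [Function.iterate_succ_apply']
      exact hf _ ih
  obtain ⟨a, b, hab, he⟩ := Finite.exists_ne_map_eq_of_infinite fun k => f^[k] j₀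
  wlog hlt : a < b generalizing a b
  · exact this b a hab.symm he.symm (by omega)
  -- The orbit of `j₀` is finite and runs into a cycle. Only on periodic points is `f` a bijection,
  -- so the exchange is restricted to those in `R`.
  have hper : f^[a] j₀ ∈ Function.periodicPts f := by
    refine ⟨b - a, by omega, ?_⟩
    rw [Function.IsPeriodicPt, Function.IsFixedPt, ← Function.iterate_add_apply,
      Nat.sub_add_cancel hlt.le]
    exact he.symm
  set S : Set (Fin M) := {j | j ∈ Function.periodicPts f ∧ j ∈ R} with hS
  have hbij := Function.bijOn_periodicPts (f := f)
  have hmaps : ∀ j ∈ S, f j ∈ S := fun j hj => ⟨hbij.mapsTo hj.1, hf j hj.2⟩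
  have hinj : Function.Injective fun j => if j ∈ S then f j else j := by
    intro j k hjk
    by_cases hj : j ∈ S <;> by_cases hk : k ∈ S <;> simp only [hj, hk, if_true, if_false] at hjk
    · exact hbij.injOn hj.1 hk.1 hjk
    · exact absurd (hjk ▸ hmaps j hj) hk
    · exact absurd (hjk ▸ hmaps k hk) hj
    · exact hjk
  let g : Equiv.Perm (Fin M) := Equiv.ofBijective _ (Finite.injective_iff_bijective.1 hinj)
  have hg : ∀ j, g j = if j ∈ S then f j else j := fun j => rfl
  refine ⟨g.trans σ, fun j => ?_, fun h => ?_⟩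
  · rw [Equiv.trans_apply, hg]
    split_ifs with hj
    · exact hG j hj.2
    · exact hσ j
  · have h₁ := DFunLike.congr_fun h (f^[a] j₀)
    rw [Equiv.trans_apply, EmbeddingLike.apply_eq_iff_eq, hg, if_pos ⟨hper, hit a⟩] at h₁
    exact hne _ (hit a) h₁

/-- A full run of the peeling algorithm finds the perfect matching if it is unique, and stops
early if it is not. -/
theorem PeelRun.isPerfectMatching_unique {l : List (Fin M × Fin M)}
    (h : G.PeelRun Finset.univ Finset.univ l) {σ₀ : Equiv.Perm (Fin M)}
    (hσ₀ : G.IsPerfectMatching σ₀) :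
    (∀ σ, G.IsPerfectMatching σ → (∀ τ, G.IsPerfectMatching τ → τ = σ) →
      ∀ i j, (i, j) ∈ l ↔ i = σ j) ∧ (l.length = M ↔ ∃! σ, G.IsPerfectMatching σ) := by
  obtain ⟨L', R', h₁, h₂, h₃, h₄⟩ := h.exists_rest
  have hempty : ∀ σ, G.IsPerfectMatching σ → (∀ τ, G.IsPerfectMatching τ → τ = σ) → R' = ∅ := by
    intro σ hσ hu
    by_contra hR
    obtain ⟨h₅, -⟩ := h₄ σ hσ (by simp)
    -- The edge from `σ j` to `j` is not peelable, so `j` has a second remaining neighbour, which is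
    -- written as `σ k`. The exchange sends `j` to `k`.
    have hex : ∀ j : Fin M, ∃ k : Fin M, j ∈ R' → k ∈ R' ∧ k ≠ j ∧ G (σ k) j := by
      intro j
      by_cases hj : j ∈ R'
      · have := h₁ (σ j) j
        simp only [Peelable, not_and, not_or] at this
        obtain ⟨-, h₆⟩ := this ((h₅ j).1 hj) hj (hσ j)
        push Not at h₆
        obtain ⟨i, hi, hG, hne⟩ := h₆
        refine ⟨σ.symm i, fun _ => ⟨(h₅ _).2 (by simpa using hi), ?_, by simpa using hG⟩⟩
        rintro rfl
        simp at hne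
      · exact ⟨j, fun hj' => absurd hj' hj⟩
    choose f hf using hex
    obtain ⟨τ, hτ, hne⟩ := exists_ne_of_exchange hσ (Finset.nonempty_iff_ne_empty.2 hR)
      (fun j hj => (hf j hj).1) (fun j hj => (hf j hj).2.1) fun j hj => (hf j hj).2.2
    exact hne (hu τ hτ)
  rw [Finset.card_univ, Fintype.card_fin] at h₂
  refine ⟨fun σ hσ hu i j => ⟨(h₄ σ hσ (by simp)).2 i j, ?_⟩, ?_, ?_⟩
  · rintro rfl
    obtain ⟨i, hi⟩ := h₃ j (Finset.mem_univ j) (by simp [hempty σ hσ hu])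
    rwa [← (h₄ σ hσ (by simp)).2 i j hi]
  · intro hl
    have hR : R' = ∅ := Finset.card_eq_zero.1 (by omega)
    refine ⟨σ₀, hσ₀, fun τ hτ => Equiv.ext fun j => ?_⟩
    obtain ⟨i, hi⟩ := h₃ j (Finset.mem_univ j) (by simp [hR])
    rw [← (h₄ τ hτ (by simp)).2 i j hi, ← (h₄ σ₀ hσ₀ (by simp)).2 i j hi]
  · rintro ⟨σ, hσ, hu⟩
    rw [hempty σ hσ hu, Finset.card_empty] at h₂
    omega

end BalBipGraph

/-! ### From adjacency lists to runs of the abstract peeling algorithm. -/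

namespace Jedi

open RamProg BalBipGraph

/-- An edge as a pair of numbers. -/
def edgeVal {M : ℕ} (e : Fin M × Fin M) : ℕ × ℕ := (e.1, e.2)

theorem edgeVal_injective {M : ℕ} : Function.Injective (edgeVal (M := M)) := fun e f h => by
  obtain ⟨h₁, h₂⟩ := Prod.mk.inj h
  exact Prod.ext (Fin.ext h₁) (Fin.ext h₂)

theorem exists_map_edgeVal {M : ℕ} {l : List (ℕ × ℕ)} (hl : ∀ e ∈ l, e.1 < M ∧ e.2 < M) :
    ∃ l' : List (Fin M × Fin M), l'.map edgeVal = l := by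
  induction l with
  | nil => exact ⟨[], rfl⟩
  | cons e l ih =>
    obtain ⟨l', hl'⟩ := ih fun e he => hl e (by simp [he])
    obtain ⟨h₁, h₂⟩ := hl e (by simp)
    exact ⟨(⟨e.1, h₁⟩, ⟨e.2, h₂⟩) :: l', by simp [hl', edgeVal]⟩

theorem storesEdges_of_enc {M : ℕ} {s : RamState} {a b : ℕ} {l : List (Fin M × Fin M)}
    (h : Enc s.mem (s.reg a) ((l.map edgeVal).flatMap fun e => [e.1, e.2]))
    (hb : s.reg b = l.length) : s.StoresEdges a b l := by
  refine ⟨hb, ?_⟩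
  generalize s.reg a = p at h
  clear hb
  induction l generalizing p with
  | nil => simp
  | cons e l ih =>
    simp only [List.map_cons, List.flatMap_cons, List.cons_append, List.nil_append, enc_cons] at h
    obtain ⟨h₁, h₂, h₃⟩ := h
    intro k hk
    cases k with
    | zero => exact ⟨h₁, h₂⟩
    | succ k =>
      have := ih (p + 1 + 1) h₃ k (by simpa using hk)
      rw [show p + 2 * (k + 1) = p + 1 + 1 + 2 * k by ring]
      exact this

/-- The adjacency lists represent the graph `G`. -/
def Represents {M : ℕ} (adj : ℕ → List ℕ) (G : BalBipGraph M) : Prop :=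
  ∀ i j : Fin M, M + (j : ℕ) ∈ adj i ↔ G i j

/-- The left nodes in a set of nodes. -/
def leftNodes (M : ℕ) (A : Finset ℕ) : Finset (Fin M) := Finset.univ.filter fun i => (i : ℕ) ∈ A

/-- The right nodes in a set of nodes. -/
def rightNodes (M : ℕ) (A : Finset ℕ) : Finset (Fin M) :=
  Finset.univ.filter fun j => M + (j : ℕ) ∈ A

/-- A partial run grows at the end of its list, whereas `PeelRun` is built from the front. The
statement bridges this by quantifying over the continuation `l'`. -/
theorem Peeled.peelRun {M : ℕ} {adj : ℕ → List ℕ} (hadj : IsBipAdj M adj) {G : BalBipGraph M}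
    (hG : Represents adj G) {A : Finset ℕ} {out : List (ℕ × ℕ)} (h : Peeled M adj A out) :
    ∃ l : List (Fin M × Fin M), l.map edgeVal = out ∧
      ∀ l', G.PeelRun (leftNodes M A) (rightNodes M A) l' →
        G.PeelRun Finset.univ Finset.univ (l ++ l') := by
  induction h with
  | start =>
    refine ⟨[], rfl, fun l' h => ?_⟩
    convert h using 1
    · ext i
      simp only [leftNodes, Finset.mem_filter, Finset.mem_univ, true_and, true_iff,
        Finset.mem_range]
      omega
    · ext i
      simp only [rightNodes, Finset.mem_filter, Finset.mem_univ, true_and, true_iff,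
        Finset.mem_range]
      omega
    · rfl
  | @step A out v w _ hv hw ih =>
    obtain ⟨l, hl, hrun⟩ := ih
    obtain ⟨hwv, hwA⟩ := mem_of_filter_eq_singleton hw
    have hdeg : ∀ u ∈ adj v, u ∈ A → u = w := fun u hu huA => by
      have : u ∈ (adj v).filter (· ∈ A) := by simp [hu, huA]
      rw [hw] at this
      simpa using this
    -- Common to both cases below, in which the node `v` of degree one is the left or the right end
    -- of the edge.
    have key : ∀ i j : Fin M, edgeOf M v w = edgeVal (i, j) →
        (A.erase v).erase w = (A.erase i).erase (M + j) → G.Peelable (leftNodes M A)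
        (rightNodes M A) i j → ∃ l : List (Fin M × Fin M), l.map edgeVal = out ++ [edgeOf M v w] ∧
          ∀ l', G.PeelRun (leftNodes M ((A.erase v).erase w))
            (rightNodes M ((A.erase v).erase w)) l' →
            G.PeelRun Finset.univ Finset.univ (l ++ l') := by
      intro i j he hA hp
      refine ⟨l ++ [(i, j)], by simp [hl, he], fun l' h => ?_⟩
      rw [List.append_assoc]
      refine hrun _ (PeelRun.peel hp ?_)
      rw [hA] at h
      convert h using 1
      · ext k
        have hk : (k : ℕ) ≠ M + j := by omega
        simp [leftNodes, Fin.ext_iff, hk]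
      · ext k
        have hk : M + (k : ℕ) ≠ i := by omega
        simp [rightNodes, Fin.ext_iff, hk]
      · rfl
    rcases hadj.bip _ _ hwv with ⟨h₁, h₂, h₃⟩ | ⟨h₁, h₂, h₃⟩
    · refine key ⟨v, h₁⟩ ⟨w - M, by omega⟩ ?_ ?_ ⟨?_, ?_, ?_, Or.inl ?_⟩
      · simp [edgeOf, edgeVal, show v < w by omega]
      · simp [Nat.add_sub_cancel' h₂]
      · simpa [leftNodes] using hv
      · simpa [rightNodes, Nat.add_sub_cancel' h₂] using hwA
      · rw [← hG]
        simpa [Nat.add_sub_cancel' h₂] using hwv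
      · intro j hj hGj
        rw [← hG] at hGj
        have := hdeg _ hGj (by simpa [rightNodes] using hj)
        exact Fin.ext (by simp only; omega)
    · refine key ⟨w, h₁⟩ ⟨v - M, by omega⟩ ?_ ?_ ⟨?_, ?_, ?_, Or.inr ?_⟩
      · simp [edgeOf, edgeVal, show ¬ v < w by omega]
      · simp [Nat.add_sub_cancel' h₂, Finset.erase_right_comm]
      · simpa [leftNodes] using hwA
      · simpa [rightNodes, Nat.add_sub_cancel' h₂] using hv
      · rw [← hG]
        simpa [Nat.add_sub_cancel' h₂] using hadj.symm _ _ hwv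
      · intro i hi hGi
        rw [← hG] at hGi
        simp only [Nat.add_sub_cancel' h₂] at hGi
        exact Fin.ext (hdeg _ (hadj.symm _ _ hGi) (by simpa [leftNodes] using hi))

theorem not_peelable_of_length_ne_one {M : ℕ} {adj : ℕ → List ℕ} (hadj : IsBipAdj M adj)
    {G : BalBipGraph M} (hG : Represents adj G) {A : Finset ℕ}
    (h : ∀ v ∈ A, ((adj v).filter (· ∈ A)).length ≠ 1) (i j : Fin M) :
    ¬ G.Peelable (leftNodes M A) (rightNodes M A) i j := by
  rintro ⟨hi, hj, hij, hd⟩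
  have hone : ∀ v w, w ∈ adj v → w ∈ A → (∀ u ∈ adj v, u ∈ A → u = w) →
      ((adj v).filter (· ∈ A)).length = 1 := by
    intro v w h₁ h₂ h₃
    rw [← List.toFinset_card_of_nodup ((hadj.nodup v).filter _), Finset.card_eq_one]
    refine ⟨w, Finset.ext fun u => ?_⟩
    simp only [List.mem_toFinset, List.mem_filter, decide_eq_true_eq, Finset.mem_singleton]
    exact ⟨fun hu => h₃ u hu.1 hu.2, fun hu => hu ▸ ⟨h₁, h₂⟩⟩
  have hiA : (i : ℕ) ∈ A := by simpa [leftNodes] using hi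
  have hjA : M + (j : ℕ) ∈ A := by simpa [rightNodes] using hj
  have hmem := (hG i j).2 hij
  rcases hd with hd | hd
  · refine h i hiA (hone i (M + j) hmem hjA fun u hu huA => ?_)
    have hb := hadj.bip _ _ hu
    have hu' : M + (u - M) = u := by omega
    have := hd ⟨u - M, by omega⟩ (by simpa [rightNodes, hu'] using huA)
      ((hG _ _).1 (by simpa [hu'] using hu))
    rw [← this]
    exact hu'.symm
  · refine h (M + j) hjA (hone (M + j) i (hadj.symm _ _ hmem) hiA fun u hu huA => ?_)
    have hb := hadj.bip _ _ hu
    have := hd ⟨u, by omega⟩ (by simpa [leftNodes] using huA)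
      ((hG _ _).1 (hadj.symm _ _ hu))
    rw [← this]

end Jedi

/-! ## Correctness and running time of the implementation -/

namespace Jedi

open RamProg BalBipGraph

/-- The symbols of the codewords as numbers. -/
def wordVal {M n : ℕ} (x : Fin M → BinWord n) (i t : ℕ) : ℕ :=
  if h : i < M ∧ t < n then (x ⟨i, h.1⟩ ⟨t, h.2⟩).val else 0

/-- The symbols of the outputs as numbers. -/
def outVal {M n : ℕ} (y : Fin M → ErasedWord n) (j t : ℕ) : ℕ :=
  if h : j < M ∧ t < n then symbolCode (y ⟨j, h.1⟩ ⟨t, h.2⟩) else 0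

theorem wordVal_eq {M n : ℕ} (x : Fin M → BinWord n) (i : Fin M) (t : Fin n) :
    wordVal x i t = (x i t).val := by simp [wordVal]

theorem outVal_eq {M n : ℕ} (y : Fin M → ErasedWord n) (j : Fin M) (t : Fin n) :
    outVal y j t = symbolCode (y j t) := by simp [outVal]

theorem wordVal_lt {M n : ℕ} (x : Fin M → BinWord n) (i t : ℕ) : wordVal x i t < 2 := by
  unfold wordVal
  split_ifs
  · exact ZMod.val_lt _
  · omega

/-- An erasure has code `2`, which differs from `1 - a.val` for both bits; so one inequality of
numbers expresses a match. -/
theorem symbolCode_ne_iff (a : ZMod 2) (b : Option (ZMod 2)) :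
    symbolCode b ≠ 1 - a.val ↔ b = none ∨ b = some a := by
  cases b with
  | none =>
    have := ZMod.val_lt a
    simp only [symbolCode, true_or, iff_true]
    omega
  | some b =>
    simp only [symbolCode, reduceCtorEq, false_or, Option.some.injEq]
    revert a b
    decide

theorem matches_iff {M n : ℕ} (x : Fin M → BinWord n) (y : Fin M → ErasedWord n) (i j : Fin M) :
    Matches (y j) (x i) ↔ ∀ t < n, outVal y j t ≠ 1 - wordVal x i t := by
  constructor
  · intro h t ht
    rw [wordVal_eq x i ⟨t, ht⟩, outVal_eq y j ⟨t, ht⟩, symbolCode_ne_iff]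
    exact h ⟨t, ht⟩
  · intro h t
    have := h t t.2
    rwa [wordVal_eq, outVal_eq, symbolCode_ne_iff] at this

theorem pref_wordVal_injective {M n : ℕ} {x : Fin M → BinWord n} (hx : Function.Injective x)
    {i i' : ℕ} (hi : i < M) (hi' : i' < M) (h : pref (wordVal x i') n = pref (wordVal x i) n) :
    i' = i := by
  rw [pref_inj] at h
  have : x ⟨i', hi'⟩ = x ⟨i, hi⟩ := by
    funext t
    have := h t t.2
    rw [wordVal_eq x ⟨i', hi'⟩ t, wordVal_eq x ⟨i, hi⟩ t] at this
    exact ZMod.val_injective 2 this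
  exact congrArg Fin.val (hx this)

theorem isInput_jediInput {M n : ℕ} (x : Fin M → BinWord n) (y : Fin M → ErasedWord n) :
    IsInput (wordVal x) (outVal y) n M (jediInput x y) := by
  have hlt : ∀ i < M, ∀ t < n, i * n + t < M * n := fun i hi t ht => by
    have : (i + 1) * n ≤ M * n := Nat.mul_le_mul_right n hi
    rw [Nat.succ_mul] at this
    omega
  have hsymm : ∀ (i : Fin M) (t : Fin n) (h : (i : ℕ) * n + t < M * n),
      finProdFinEquiv.symm ⟨(i : ℕ) * n + t, h⟩ = (i, t) := fun i t h => by
    rw [Equiv.symm_apply_eq]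
    ext
    simp [finProdFinEquiv, mul_comm, add_comm]
  refine ⟨rfl, rfl, fun k h₀ h₁ => by simp [jediInput, h₀, h₁], ?_, ?_, ?_⟩
  · intro i hi t ht
    have h := hlt i hi t ht
    simp only [jediInput, h, dif_pos]
    rw [hsymm ⟨i, hi⟩ ⟨t, ht⟩ h, ← wordVal_eq]
  · intro j hj t ht
    have h := hlt j hj t ht
    have h₁ : ¬ M * n + j * n + t < M * n := by omega
    have h₂ : M * n + j * n + t - M * n = j * n + t := by omega
    simp only [jediInput, h₁, h₂, h, dif_pos, dif_neg, not_false_eq_true]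
    rw [hsymm ⟨j, hj⟩ ⟨t, ht⟩ h, ← outVal_eq]
  · intro a ha
    have h₁ : ¬ a < M * n := by omega
    have h₂ : ¬ a - M * n < M * n := by omega
    simp [jediInput, h₁, h₂]

/-- The number of pairs of a prefix of length `t` of a codeword and an output matching it. -/
noncomputable def candidateCount {M n : ℕ} (x : Fin M → BinWord n) (y : Fin M → ErasedWord n)
    (t : ℕ) : ℕ :=
  (candidates (prefixes (wordVal x) n M) (outVal y) M t).length

/-- A bound for the number of instructions executed by JEDI. -/
noncomputable def stepCount {M n : ℕ} (x : Fin M → BinWord n) (y : Fin M → ErasedWord n) : ℕ :=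
  11 * (M * n) + 67 * M + 4 * n + 51 + 147 * ∑ t ∈ Finset.range (n + 1), candidateCount x y t

/-- A bound for the increments of the numbers handled by JEDI. -/
def increment (M n : ℕ) : ℕ := 2 * ((M + 2) * (n + 1))

/-- Only the correctness of the answer requires a perfect matching to exist. The step bound holds
for all outputs, so it can be summed over all `y` in the expectation, including those of probability
zero. -/
theorem exists_runs {M n : ℕ} {x : Fin M → BinWord n} (hx : Function.Injective x)
    (y : Fin M → ErasedWord n) : ∃ s₁ s₂ N₁ N₂, N₁ + N₂ ≤ stepCount x y ∧
      Runs (increment M n) step₁ (jediInput x y) s₁ N₁ ∧ s₁.StoresGraph (ioGraph x y) ∧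
      Runs (increment M n) step₂ s₁ s₂ N₂ ∧
      ((∃ σ, (ioGraph x y).IsPerfectMatching σ) → s₂.StoresAnswer (ioGraph x y)) := by
  have hD : M * n + M + 2 * n + M + 3 ≤ increment M n := by
    unfold increment
    nlinarith [Nat.zero_le (M * n)]
  have hw : ∀ i < M, ∀ t < n, wordVal x i t < 2 := fun i _ t _ => wordVal_lt x i t
  obtain ⟨s₁, hs₁, lab, hlab, he, h3, h23, hz, h1, h7, h8⟩ := runs_step₁ (D := increment M n)
    (by omega) (by omega)
    (by omega) (fun i hi i' hi' h => pref_wordVal_injective hx hi hi' h)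
    hw (isInput_jediInput x y)
  set l := (candidates (prefixes (wordVal x) n M) (outVal y) M n).map
    (fun u => (lab u.1, u.2)) with hl
  have he' : Enc s₁.mem (s₁.reg 2) (l.flatMap fun e => [e.1, e.2]) := by
    rw [hl, List.flatMap_map]
    exact he
  have hlen : l.length = candidateCount x y n := by simp [hl, candidateCount]
  have hmem : ∀ i j : ℕ, (i, j) ∈ l ↔ ∃ (hi : i < M) (hj : j < M),
      ioGraph x y ⟨i, hi⟩ ⟨j, hj⟩ := by
    intro i j
    simp only [hl, List.mem_map, mem_candidates hw le_rfl, Prod.mk.injEq]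
    constructor
    · rintro ⟨u, ⟨hj, i', hi', hu, hm⟩, rfl, rfl⟩
      rw [hu, hlab i' hi']
      exact ⟨hi', hj, (matches_iff x y ⟨i', hi'⟩ ⟨u.2, hj⟩).2 hm⟩
    · rintro ⟨hi, hj, hm⟩
      exact ⟨(pref (wordVal x i) n, j), ⟨hj, i, hi, rfl, (matches_iff x y ⟨i, hi⟩ ⟨j, hj⟩).1 hm⟩,
        hlab i hi, rfl⟩
  have hnd : l.Nodup := by
    refine List.Nodup.map_on ?_ (nodup_candidates _ _ _ _)
    intro u hu v hv huv
    rw [mem_candidates hw le_rfl] at hu hv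
    obtain ⟨-, i, hi, hu, -⟩ := hu
    obtain ⟨-, i', hi', hv, -⟩ := hv
    obtain ⟨h₁, h₂⟩ := Prod.mk.inj huv
    rw [hu, hv, hlab i hi, hlab i' hi'] at h₁
    subst h₁
    exact Prod.ext (hu.trans hv.symm) h₂
  have hlt : ∀ e ∈ l, e.1 < M ∧ e.2 < M := fun e he => by
    obtain ⟨h₁, h₂, -⟩ := (hmem e.1 e.2).1 he
    exact ⟨h₁, h₂⟩
  obtain ⟨l', hl'⟩ := exists_map_edgeVal hlt
  have hlen' : l'.length = l.length := by rw [← hl', List.length_map]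
  have h3' : s₁.reg 3 = l.length := by rw [h3, hlen]; rfl
  obtain ⟨s₂, hs₂, A, out, hpeel, hterm, henc, h5, h6⟩ := runs_step₂ (D := increment M n) (M := M)
    (by omega) hlt hnd he' (by omega) hz h1 h7 h8
  refine ⟨s₁, s₂, _, _, ?_, hs₁, ⟨l', ?_, fun i j => ?_, ?_⟩, hs₂, ?_⟩
  · have : candidateCount x y n ≤ ∑ t ∈ Finset.range (n + 1), candidateCount x y t :=
      Finset.single_le_sum (f := candidateCount x y) (fun _ _ => Nat.zero_le _) (by simp)
    unfold stepCount
    rw [hlen]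
    unfold candidateCount at this ⊢
    omega
  · rw [← hl'] at hnd
    exact hnd.of_map
  · have := hmem i j
    rw [← hl', show ((i : ℕ), (j : ℕ)) = edgeVal (i, j) from rfl,
      List.mem_map_of_injective edgeVal_injective] at this
    rw [this]
    exact ⟨fun ⟨_, _, h⟩ => h, fun h => ⟨i.2, j.2, h⟩⟩
  · exact storesEdges_of_enc (hl' ▸ he') (by rw [h3', hlen'])
  · rintro ⟨σ, hσ⟩
    have hbip := isBipAdj_foldl_addEdge hlt hnd
    have hrep : Represents (l.foldl (addEdge M) fun _ => []) (ioGraph x y) := fun i j => by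
      rw [mem_foldl_addEdge hlt]
      constructor
      · rintro ⟨e, he, h | h⟩
        · obtain ⟨h₁, h₂, h₃⟩ := (hmem e.1 e.2).1 he
          convert h₃ using 1
          · exact Fin.ext h.1
          · exact Fin.ext (by simp only; omega)
        · omega
      · intro h
        exact ⟨(i, j), (hmem i j).2 ⟨i.2, j.2, h⟩, Or.inl ⟨rfl, rfl⟩⟩
    obtain ⟨l₂, hl₂, hrun⟩ := hpeel.peelRun hbip hrep
    have hrun := hrun [] (.done (not_peelable_of_length_ne_one hbip hrep hterm))
    rw [List.append_nil] at hrun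
    obtain ⟨ha, hb⟩ := hrun.isPerfectMatching_unique hσ
    have hlen₂ : out.length = l₂.length := by rw [← hl₂, List.length_map]
    refine ⟨l₂, hrun, storesEdges_of_enc (hl₂ ▸ henc) (by rw [h5, hlen₂]), ha, ?_⟩
    rw [h6, hlen₂]
    by_cases hM : l₂.length = M
    · rw [if_pos hM, if_pos (hb.1 hM)]
    · rw [if_neg hM, if_neg (fun h => hM (hb.2 h))]

theorem implementsJEDI : ImplementsJEDI step₁ step₂ := by
  intro M n x y hx ⟨π, hπ⟩
  obtain ⟨s₁, s₂, N₁, N₂, -, ⟨t₁, e₁, -⟩, hg, ⟨t₂, e₂, -⟩, ha⟩ := exists_runs hx y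
  exact ⟨s₁, s₂, t₁, t₂, e₁, hg, e₂, ha ⟨π, hπ⟩⟩

/-- The input numbers are at most `increment M n`, which can therefore play the role of both `V` and
`D`. -/
theorem time_le {M n : ℕ} {x : Fin M → BinWord n} (hx : Function.Injective x)
    (y : Fin M → ErasedWord n) : (step₁.seq step₂).time (jediInput x y) ≤
      ((stepCount x y * (1 + 2 * ((stepCount x y + 1) * increment M n).size) : ℕ) : ℝ≥0∞) := by
  obtain ⟨s₁, s₂, N₁, N₂, hN, h₁, -, h₂, -⟩ := exists_runs hx y
  obtain ⟨t, e, b⟩ := (h₁.seq h₂).mono hN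
  have hD : M + n + 2 ≤ increment M n := by
    unfold increment
    nlinarith [Nat.zero_le (M * n)]
  have := (b (increment M n) le_rfl ⟨fun k => ?_, fun k => ?_⟩).2
  · rw [time_eq e, Nat.cast_le]
    convert this using 5
    ring
  · simp only [jediInput]
    split_ifs <;> omega
  · refine le_trans (?_ : _ ≤ 2) (by omega)
    simp only [jediInput]
    split_ifs
    · exact (ZMod.val_lt _).le
    · unfold symbolCode
      split
      · exact le_rfl
      · exact (ZMod.val_lt _).le
    · omega

end Jedi

/-! ## The recursive structure of the Reed-Muller codes -/

namespace ReedMuller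

open MvPolynomial

/-- The polynomials of degree less than `s` in `m` variables. -/
noncomputable def degLT (m s : ℕ) : Submodule (ZMod 2) (MvPolynomial (Fin m) (ZMod 2)) :=
  restrictSupport (ZMod 2) {d | ∑ i, d i < s}

/-- The strict degree bound shifts the order by one, so that `s = 0` gives the zero code, at which
the recursions on the order stop. -/
theorem mem_degLT_succ {m r : ℕ} {f : MvPolynomial (Fin m) (ZMod 2)} :
    f ∈ degLT m (r + 1) ↔ f.totalDegree ≤ r := by
  rw [← mem_restrictTotalDegree, degLT, restrictTotalDegree]
  have : ∀ d : Fin m →₀ ℕ, (d.sum fun _ e => e) = ∑ i, d i := fun d =>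
    d.sum_fintype _ fun _ => rfl
  simp_rw [Nat.lt_succ_iff, this]

theorem degLT_zero {m : ℕ} {f : MvPolynomial (Fin m) (ZMod 2)} : f ∈ degLT m 0 ↔ f = 0 := by
  simp [degLT, mem_restrictSupport_iff]

/-- Substitution of `e` for the last variable. -/
noncomputable def substLast {m : ℕ} (e : ZMod 2) :
    MvPolynomial (Fin (m + 1)) (ZMod 2) →ₐ[ZMod 2] MvPolynomial (Fin m) (ZMod 2) :=
  aeval (Fin.lastCases (C e) X)

theorem eval_substLast {m : ℕ} (e : ZMod 2) (q : Fin m → ZMod 2)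
    (f : MvPolynomial (Fin (m + 1)) (ZMod 2)) :
    eval q (substLast e f) = eval (Fin.snoc q e : Fin (m + 1) → ZMod 2) f := by
  induction f using MvPolynomial.induction_on with
  | C a => simp [substLast]
  | add f g hf hg => simp [hf, hg]
  | mul_X f i hf =>
    rw [map_mul, map_mul, hf, map_mul]
    congr 1
    cases i using Fin.lastCases <;> simp [substLast]

theorem substLast_monomial {m : ℕ} (e : ZMod 2) (d : Fin (m + 1) →₀ ℕ) (c : ZMod 2) :
    substLast e (monomial d c) =
      monomial (Finsupp.equivFunOnFinite.symm fun i : Fin m => d i.castSucc)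
        (c * e ^ d (Fin.last m)) := by
  rw [substLast, aeval_monomial, Finsupp.prod_fintype _ _ fun _ => pow_zero _,
    Fin.prod_univ_castSucc, monomial_eq, Finsupp.prod_fintype _ _ fun _ => pow_zero _]
  simp only [Fin.lastCases_castSucc, Fin.lastCases_last, Finsupp.equivFunOnFinite_symm_apply_apply,
    algebraMap_eq, C_mul, C_pow]
  ring

theorem substLast_mem {m s : ℕ} {f : MvPolynomial (Fin (m + 1)) (ZMod 2)}
    (hf : f ∈ degLT (m + 1) s) (e : ZMod 2) : substLast e f ∈ degLT m s := by
  rw [f.as_sum, map_sum]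
  refine Submodule.sum_mem _ fun d hd => ?_
  rw [substLast_monomial, degLT, monomial_mem_restrictSupport]
  left
  have : ∑ i, d i < s := hf hd
  rw [Fin.sum_univ_castSucc] at this
  simp only [Set.mem_ofPred_eq, Finsupp.equivFunOnFinite_symm_apply_apply]
  omega

/-- Monomials without the last variable cancel in the difference, and all others lose at least one
degree. -/
theorem substLast_sub_mem {m s : ℕ} {f : MvPolynomial (Fin (m + 1)) (ZMod 2)}
    (hf : f ∈ degLT (m + 1) (s + 1)) : substLast 1 f - substLast 0 f ∈ degLT m s := by
  rw [f.as_sum, map_sum, map_sum, ← Finset.sum_sub_distrib]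
  refine Submodule.sum_mem _ fun d hd => ?_
  have : ∑ i, d i < s + 1 := hf hd
  rw [Fin.sum_univ_castSucc] at this
  rw [substLast_monomial, substLast_monomial, ← map_sub, degLT, monomial_mem_restrictSupport]
  by_cases h : d (Fin.last m) = 0
  · right
    simp [h]
  · left
    simp only [Set.mem_ofPred_eq, Finsupp.equivFunOnFinite_symm_apply_apply]
    omega

/-- The polynomial `a + X * b` does it, where `X` is the last variable. -/
theorem exists_substLast {m s : ℕ} {a b : MvPolynomial (Fin m) (ZMod 2)}
    (ha : a ∈ degLT m (s + 1)) (hb : b ∈ degLT m s) : ∃ f ∈ degLT (m + 1) (s + 1),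
      substLast 0 f = a ∧ substLast 1 f - substLast 0 f = b := by
  have hren : ∀ (e : ZMod 2) (a : MvPolynomial (Fin m) (ZMod 2)),
      substLast e (rename Fin.castSucc a) = a := fun e a => by
    rw [substLast, aeval_rename]
    have : (Fin.lastCases (C e) X : Fin (m + 1) → MvPolynomial (Fin m) (ZMod 2)) ∘ Fin.castSucc =
        X := by
      funext i
      simp
    rw [this, aeval_X_left, AlgHom.id_apply]
  have hX : ∀ e : ZMod 2, substLast (m := m) e (X (Fin.last m)) = C e := fun e => by
    simp [substLast]
  refine ⟨rename Fin.castSucc a + X (Fin.last m) * rename Fin.castSucc b, ?_, ?_, ?_⟩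
  · refine Submodule.add_mem _ ?_ ?_
    · rw [mem_degLT_succ] at ha ⊢
      exact (totalDegree_rename_le _ _).trans ha
    · cases s with
      | zero =>
        rw [degLT_zero] at hb
        simp [hb]
      | succ s =>
        rw [mem_degLT_succ] at hb ⊢
        refine (totalDegree_mul _ _).trans ?_
        have := totalDegree_rename_le Fin.castSucc b
        rw [totalDegree_X]
        omega
  · rw [map_add, map_mul, hren, hren, hX]
    simp
  · simp only [map_add, map_mul, hren, hX]
    simp

/-- The concatenation of `a` and `a + b`, words of length `2 ^ m`. -/
def glue (m : ℕ) (a b : ℕ → ZMod 2) (k : ℕ) : ZMod 2 :=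
  if k < 2 ^ m then a k else a (k - 2 ^ m) + b (k - 2 ^ m)

/-- The values of a polynomial at the points of the cube, in their standard order. -/
noncomputable def evalWord (m : ℕ) (f : MvPolynomial (Fin m) (ZMod 2)) (k : ℕ) : ZMod 2 :=
  if h : k < 2 ^ m then eval (cubePoint m ⟨k, h⟩) f else 0

theorem evalWord_of_lt {m : ℕ} (f : MvPolynomial (Fin m) (ZMod 2)) {k : ℕ} (h : k < 2 ^ m) :
    evalWord m f k = eval (cubePoint m ⟨k, h⟩) f := dif_pos h

theorem evalWord_of_le {m : ℕ} (f : MvPolynomial (Fin m) (ZMod 2)) {k : ℕ} (h : 2 ^ m ≤ k) :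
    evalWord m f k = 0 := dif_neg (by omega)

/-- In the standard order the last coordinate is the leading binary digit, so the two halves of the
word are the evaluations at `0` and `1` in this coordinate. -/
theorem evalWord_succ {m : ℕ} (f : MvPolynomial (Fin (m + 1)) (ZMod 2)) :
    evalWord (m + 1) f =
      glue m (evalWord m (substLast 0 f)) (evalWord m (substLast 1 f - substLast 0 f)) := by
  funext k
  have hpow : 2 ^ (m + 1) = 2 ^ m + 2 ^ m := by ring
  unfold glue
  split_ifs with h
  · rw [evalWord_of_lt f (by omega), evalWord_of_lt _ h, eval_substLast]
    congr 2
    funext i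
    cases i using Fin.lastCases with
    | last => simp [cubePoint, Nat.testBit_lt_two_pow h]
    | cast i => simp [cubePoint]
  · obtain ⟨k, rfl⟩ := Nat.exists_eq_add_of_le (not_lt.1 h)
    rw [Nat.add_sub_cancel_left]
    by_cases hk : k < 2 ^ m
    · rw [evalWord_of_lt f (by omega), evalWord_of_lt _ hk, evalWord_of_lt _ hk, map_sub,
        add_sub_cancel, eval_substLast]
      congr 2
      funext i
      cases i using Fin.lastCases with
      | last => simp [cubePoint, Nat.testBit_two_pow_add_eq, Nat.testBit_lt_two_pow hk]
      | cast i => simp [cubePoint, Nat.testBit_two_pow_add_gt i.2]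
    · rw [evalWord_of_le f (by omega), evalWord_of_le _ (by omega), evalWord_of_le _ (by omega),
        add_zero]

open Classical in
/-- The Reed-Muller codes of the polynomials of degree less than `s`, constructed recursively. -/
noncomputable def code : ℕ → ℕ → Finset (ℕ → ZMod 2)
  | _, 0 => {0}
  | 0, _ + 1 => {0, Pi.single 0 1}
  | m + 1, s + 1 => (code m (s + 1) ×ˢ code m s).image fun ab => glue m ab.1 ab.2

theorem code_zero (m : ℕ) : code m 0 = {0} := by cases m <;> rfl

theorem mem_code_succ {m s : ℕ} {g : ℕ → ZMod 2} :
    g ∈ code (m + 1) (s + 1) ↔ ∃ a ∈ code m (s + 1), ∃ b ∈ code m s, glue m a b = g := by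
  simp only [code, Finset.mem_image, Finset.mem_product, Prod.exists]
  constructor
  · rintro ⟨a, b, ⟨ha, hb⟩, h⟩
    exact ⟨a, ha, b, hb, h⟩
  · rintro ⟨a, ha, b, hb, h⟩
    exact ⟨a, b, ⟨ha, hb⟩, h⟩

theorem mem_code_iff {m s : ℕ} {g : ℕ → ZMod 2} :
    g ∈ code m s ↔ ∃ f ∈ degLT m s, evalWord m f = g := by
  induction m generalizing s g with
  | zero =>
    cases s with
    | zero =>
      simp only [code_zero, Finset.mem_singleton, degLT_zero, exists_eq_left]
      rw [eq_comm]
      have : evalWord 0 0 = 0 := by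
        funext k
        simp [evalWord]
      rw [this]
    | succ s =>
      have hC : ∀ c : ZMod 2, evalWord 0 (C c) = Pi.single 0 c := fun c => by
        funext k
        cases k <;> simp [evalWord]
      simp only [code, Finset.mem_insert, Finset.mem_singleton]
      constructor
      · rintro (rfl | rfl)
        · exact ⟨C 0, by rw [mem_degLT_succ]; simp, by rw [hC]; simp⟩
        · exact ⟨C 1, by rw [mem_degLT_succ, totalDegree_C]; omega, hC 1⟩
      · rintro ⟨f, -, rfl⟩
        obtain ⟨c, rfl⟩ := C_surjective (R := ZMod 2) (Fin 0) f
        rw [hC]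
        have : c = 0 ∨ c = 1 := by revert c; decide
        rcases this with rfl | rfl
        · left
          simp
        · right
          rfl
  | succ m ih =>
    cases s with
    | zero =>
      simp only [code_zero, Finset.mem_singleton, degLT_zero, exists_eq_left]
      rw [eq_comm]
      have : evalWord (m + 1) 0 = 0 := by
        funext k
        simp [evalWord]
      rw [this]
    | succ s =>
      rw [mem_code_succ]
      constructor
      · rintro ⟨a, ha, b, hb, rfl⟩
        obtain ⟨fa, hfa, rfl⟩ := ih.1 ha
        obtain ⟨fb, hfb, rfl⟩ := ih.1 hb
        obtain ⟨f, hf, rfl, rfl⟩ := exists_substLast hfa hfb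
        exact ⟨f, hf, evalWord_succ f⟩
      · rintro ⟨f, hf, rfl⟩
        exact ⟨_, ih.2 ⟨_, substLast_mem hf 0, rfl⟩, _, ih.2 ⟨_, substLast_sub_mem hf, rfl⟩,
          (evalWord_succ f).symm⟩

/-- A word as a function on the natural numbers. -/
def extend {n : ℕ} (c : BinWord n) (k : ℕ) : ZMod 2 := if h : k < n then c ⟨k, h⟩ else 0

theorem extend_injective {n : ℕ} : Function.Injective (extend (n := n)) := fun c c' h => by
  funext t
  have := congrFun h t
  simpa [extend] using this

theorem mem_reedMuller_iff {r m : ℕ} {c : BinWord (2 ^ m)} :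
    c ∈ reedMuller r m ↔ extend c ∈ code m (r + 1) := by
  rw [mem_code_iff]
  constructor
  · rintro ⟨f, hf, h⟩
    refine ⟨f, mem_degLT_succ.2 hf, funext fun k => ?_⟩
    unfold evalWord extend
    split_ifs with hk
    · exact (h ⟨k, hk⟩).symm
    · rfl
  · rintro ⟨f, hf, h⟩
    refine ⟨f, mem_degLT_succ.1 hf, fun t => ?_⟩
    have := congrFun h t
    rw [evalWord_of_lt f t.2] at this
    rw [this]
    simp [extend]

theorem code_eq_zero_of_le {m s k : ℕ} {g : ℕ → ZMod 2} (hg : g ∈ code m s) (hk : 2 ^ m ≤ k) :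
    g k = 0 := by
  obtain ⟨f, -, rfl⟩ := mem_code_iff.1 hg
  exact evalWord_of_le f hk

theorem image_extend_reedMuller (r m : ℕ) :
    extend '' reedMuller r m = (code m (r + 1) : Set (ℕ → ZMod 2)) := by
  ext g
  constructor
  · rintro ⟨c, hc, rfl⟩
    exact mem_reedMuller_iff.1 hc
  · intro hg
    have : extend (fun t : Fin (2 ^ m) => g t) = g := by
      funext k
      unfold extend
      split_ifs with hk
      · rfl
      · exact (code_eq_zero_of_le hg (by omega)).symm
    exact ⟨fun t => g t, mem_reedMuller_iff.2 (by rw [this]; exact hg), this⟩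

theorem ncard_reedMuller (r m : ℕ) : (reedMuller r m).ncard = (code m (r + 1)).card := by
  rw [← Set.ncard_image_of_injective _ extend_injective, image_extend_reedMuller,
    Set.ncard_coe_finset]

end ReedMuller

/-! ### Minimum distance, dimension and prefix sums. -/

namespace ReedMuller

open Filter Topology

/-- The number of nonzero symbols among the first `t` symbols. -/
def weight (t : ℕ) (g : ℕ → ZMod 2) : ℕ := ∑ k ∈ Finset.range t, if g k = 0 then 0 else 1

theorem weight_glue (m t : ℕ) (a b : ℕ → ZMod 2) :
    weight (2 ^ m + t) (glue m a b) = weight (2 ^ m) a + weight t (a + b) := by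
  unfold weight
  rw [Finset.sum_range_add]
  congr 1
  · refine Finset.sum_congr rfl fun k hk => ?_
    rw [glue, if_pos (Finset.mem_range.1 hk)]
  · refine Finset.sum_congr rfl fun k _ => ?_
    have h : glue m a b (2 ^ m + k) = (a + b) k := by
      rw [glue, if_neg (Nat.not_lt.2 (Nat.le_add_right _ _)), Nat.add_sub_cancel_left, Pi.add_apply]
    rw [h]

theorem weight_le_add (t : ℕ) (a b : ℕ → ZMod 2) :
    weight t b ≤ weight t a + weight t (a + b) := by
  unfold weight
  rw [← Finset.sum_add_distrib]
  refine Finset.sum_le_sum fun k _ => ?_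
  by_cases ha : a k = 0 <;> by_cases hb : b k = 0 <;> simp [ha, hb]

/-- If `b = 0`, the word is `a` repeated, with `a ≠ 0`. Otherwise each nonzero symbol of `b` is
visible in `a` or in `a + b`, and `b` has order one less in half the length. -/
theorem le_weight {m r : ℕ} {g : ℕ → ZMod 2} (hg : g ∈ code m (r + 1)) (h0 : g ≠ 0) :
    2 ^ (m - r) ≤ weight (2 ^ m) g := by
  induction m generalizing r g with
  | zero =>
    simp only [code, Finset.mem_insert, Finset.mem_singleton] at hg
    rcases hg with rfl | rfl
    · exact absurd rfl h0
    · simp [weight]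
  | succ m ih =>
    obtain ⟨a, ha, b, hb, rfl⟩ := mem_code_succ.1 hg
    rw [pow_succ, mul_two, weight_glue]
    by_cases hb0 : b = 0
    · have ha0 : a ≠ 0 := by
        rintro rfl
        refine h0 (funext fun k => ?_)
        simp [glue, hb0]
      have h₁ := ih ha ha0
      rw [hb0, add_zero]
      calc 2 ^ (m + 1 - r) ≤ 2 ^ (m - r + 1) := Nat.pow_le_pow_right (by omega) (by omega)
        _ = 2 ^ (m - r) + 2 ^ (m - r) := by ring
        _ ≤ _ := add_le_add h₁ h₁
    · cases r with
      | zero => exact absurd (by simpa [code_zero] using hb) hb0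
      | succ r =>
        rw [Nat.add_sub_add_right]
        exact (ih hb hb0).trans (weight_le_add _ a b)

/-- The dimension of the Reed-Muller codes. -/
def dim : ℕ → ℕ → ℕ
  | _, 0 => 0
  | 0, _ + 1 => 1
  | m + 1, s + 1 => dim m (s + 1) + dim m s

theorem dim_zero (m : ℕ) : dim m 0 = 0 := by cases m <;> rfl

theorem glue_injective {m : ℕ} {a b a' b' : ℕ → ZMod 2} (ha : ∀ k, 2 ^ m ≤ k → a k = 0)
    (ha' : ∀ k, 2 ^ m ≤ k → a' k = 0) (h : glue m a b = glue m a' b') : a = a' ∧ b = b' := by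
  have haa : a = a' := by
    funext k
    by_cases hk : k < 2 ^ m
    · simpa [glue, hk] using congrFun h k
    · rw [ha k (by omega), ha' k (by omega)]
  refine ⟨haa, funext fun k => ?_⟩
  simpa [glue, haa] using congrFun h (2 ^ m + k)

theorem card_code (m s : ℕ) : (code m s).card = 2 ^ dim m s := by
  classical
  induction m generalizing s with
  | zero =>
    cases s with
    | zero => simp [code_zero, dim_zero]
    | succ s =>
      have : (0 : ℕ → ZMod 2) ≠ Pi.single 0 1 := fun h => by simpa using congrFun h 0
      rw [code, Finset.card_pair this]
      rfl
  | succ m ih =>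
    cases s with
    | zero => simp [code_zero, dim_zero]
    | succ s =>
      rw [code, Finset.card_image_of_injOn, Finset.card_product, ih, ih, dim, pow_add]
      rintro ⟨a, b⟩ h ⟨a', b'⟩ h' he
      simp only [Finset.coe_product, Set.mem_prod, Finset.mem_coe] at h h'
      obtain ⟨h₁, h₂⟩ := glue_injective (a := a) (a' := a')
        (fun k hk => code_eq_zero_of_le h.1 hk) (fun k hk => code_eq_zero_of_le h'.1 hk) he
      exact Prod.ext h₁ h₂

theorem dim_le (m r : ℕ) : dim m (r + 1) ≤ (m + 1) ^ r := by
  induction m generalizing r with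
  | zero => simp [dim]
  | succ m ih =>
    rw [dim]
    cases r with
    | zero => simpa [dim_zero] using ih 0
    | succ r =>
      have h₁ := ih r
      have h₂ := ih (r + 1)
      have h₃ : (m + 1) ^ r ≤ (m + 2) ^ r := Nat.pow_le_pow_left (by omega) r
      calc dim m (r + 1 + 1) + dim m (r + 1) ≤ (m + 1) ^ (r + 1) + (m + 1) ^ r := add_le_add h₂ h₁
        _ = (m + 1) ^ r * (m + 2) := by ring
        _ ≤ (m + 2) ^ r * (m + 2) := Nat.mul_le_mul_right _ h₃
        _ = _ := by ring

theorem dim_le_succ (m s : ℕ) : dim m s ≤ dim m (s + 1) := by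
  induction m generalizing s with
  | zero => cases s <;> simp [dim]
  | succ m ih =>
    cases s with
    | zero => simp [dim]
    | succ s => exact add_le_add (ih _) (ih _)

theorem dim_mono (m : ℕ) : Monotone (dim m) := monotone_nat_of_le_succ (dim_le_succ m)

theorem dim_one (m : ℕ) : dim m 1 = 1 := by
  induction m with
  | zero => rfl
  | succ m ih => rw [dim, ih, dim_zero]

theorem dim_two (m : ℕ) : dim m 2 = m + 1 := by
  induction m with
  | zero => rfl
  | succ m ih => rw [dim, ih, dim_one]

/-- Quadratic growth of the dimension from order two on is what separates `r ≥ 2` from `r = 1`. -/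
theorem sq_le_dim_three (m : ℕ) : m ^ 2 ≤ 2 * dim m 3 := by
  induction m with
  | zero => simp
  | succ m ih =>
    rw [dim, dim_two]
    nlinarith

/-- The exponential decay beats the size of the codes. -/
theorem tendsto_sq_mul_pow (s : ℕ) {p : ℝ} (hp : 0 ≤ p) (hp1 : p < 1) :
    Tendsto (fun m : ℕ => ((2 : ℝ) ^ (m + 1) ^ s) ^ 2 * p ^ 2 ^ (m - s)) atTop (𝓝 0) := by
  -- With `4 * p ^ L ≤ 1`, the factor `p ^ (L * (m + 1) ^ s)` outweighs the square of the size; a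
  -- further factor `p ^ m` gives convergence to zero.
  obtain ⟨L, hL⟩ := exists_pow_lt_of_lt_one (show (0 : ℝ) < 1 / 4 by norm_num) hp1
  have hlim := (tendsto_pow_const_div_const_pow_of_one_lt (s + 1)
    (show (1 : ℝ) < 2 by norm_num)).comp (tendsto_add_atTop_nat 1)
  have hc : (0 : ℝ) < 1 / ((L + 1) * 2 ^ (s + 1)) := by positivity
  have hev : ∀ᶠ m : ℕ in atTop, L * (m + 1) ^ s + m ≤ 2 ^ (m - s) := by
    filter_upwards [hlim.eventually_le_const hc] with m hm
    simp only [Function.comp_apply] at hm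
    rw [div_le_div_iff₀ (by positivity) (by positivity), one_mul] at hm
    have hm' : (m + 1) ^ (s + 1) * ((L + 1) * 2 ^ (s + 1)) ≤ 2 ^ (m + 1) := by exact_mod_cast hm
    have h₁ : 2 ^ (m + 1) ≤ 2 ^ (m - s) * 2 ^ (s + 1) := by
      rw [← pow_add]
      exact Nat.pow_le_pow_right (by omega) (by omega)
    have h₂ : (m + 1) ^ (s + 1) * (L + 1) ≤ 2 ^ (m - s) := by
      refine Nat.le_of_mul_le_mul_right ?_ (Nat.pow_pos (n := s + 1) (show 0 < 2 by omega))
      rw [mul_assoc]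
      exact hm'.trans h₁
    refine le_trans ?_ h₂
    have h₃ : (m + 1) ^ s ≤ (m + 1) ^ (s + 1) := Nat.pow_le_pow_right (by omega) (by omega)
    have h₄ : m + 1 ≤ (m + 1) ^ (s + 1) := Nat.le_self_pow (by omega) _
    nlinarith
  refine squeeze_zero' (Eventually.of_forall fun m => by positivity) ?_
    (tendsto_pow_atTop_nhds_zero_of_lt_one hp hp1)
  filter_upwards [hev] with m hm
  calc ((2 : ℝ) ^ (m + 1) ^ s) ^ 2 * p ^ 2 ^ (m - s)
      ≤ ((2 : ℝ) ^ (m + 1) ^ s) ^ 2 * p ^ (L * (m + 1) ^ s + m) := by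
        gcongr ?_ * ?_
        exact pow_le_pow_of_le_one hp hp1.le hm
    _ = (4 * p ^ L) ^ (m + 1) ^ s * p ^ m := by
        rw [pow_add, mul_pow, ← pow_mul, ← pow_mul, mul_comm ((m + 1) ^ s) 2, pow_mul]
        norm_num
        ring
    _ ≤ 1 * p ^ m := by
        gcongr
        exact pow_le_one₀ (by positivity) (by linarith)
    _ = p ^ m := one_mul _

/-- The first `t` symbols of a word. -/
def trunc (t : ℕ) (g : ℕ → ZMod 2) (k : ℕ) : ZMod 2 := if k < t then g k else 0

theorem weight_trunc (t : ℕ) (g : ℕ → ZMod 2) : weight t (trunc t g) = weight t g := by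
  refine Finset.sum_congr rfl fun k hk => ?_
  rw [trunc, if_pos (Finset.mem_range.1 hk)]

open Classical in
/-- The prefixes of length `t` of the words of a code. -/
noncomputable def codePrefixes (m s t : ℕ) : Finset (ℕ → ZMod 2) := (code m s).image (trunc t)

/-- The sum of the probabilities that a prefix of the zero word is erased on the support of a
given prefix of a codeword. -/
noncomputable def prefixSum (p : ℝ) (m s t : ℕ) : ℝ :=
  ∑ u ∈ codePrefixes m s t, p ^ weight t u

/-- A prefix within the first half is a prefix of `a`. -/
theorem prefixSum_succ_of_le {p : ℝ} (hp : 0 ≤ p) {m s t : ℕ} (ht : t ≤ 2 ^ m) :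
    prefixSum p (m + 1) (s + 1) t ≤ prefixSum p m (s + 1) t := by
  classical
  refine Finset.sum_le_sum_of_subset_of_nonneg ?_ fun _ _ _ => by positivity
  intro u hu
  simp only [codePrefixes, Finset.mem_image] at hu ⊢
  obtain ⟨g, hg, rfl⟩ := hu
  obtain ⟨a, ha, b, -, rfl⟩ := mem_code_succ.1 hg
  refine ⟨a, ha, funext fun k => ?_⟩
  unfold trunc glue
  split_ifs with h₁ h₂
  · rfl
  · omega
  · rfl

/-- Such a prefix contains `a` completely. If `a ≠ 0`, its weight is at least the minimum distance,
and the number of pairs `(a, b)` is at most the square of the size bound. If `a = 0`, it is a block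
of zeros followed by a prefix of `b`, which has the same weight. -/
theorem prefixSum_succ_of_ge {p : ℝ} (hp : 0 ≤ p) (hp1 : p ≤ 1) {m s t : ℕ} :
    prefixSum p (m + 1) (s + 1) (2 ^ m + t) ≤
      ((2 : ℝ) ^ (m + 1) ^ s) ^ 2 * p ^ 2 ^ (m - s) + prefixSum p m s t := by
  classical
  set U₁ := (((code m (s + 1)).filter (· ≠ 0)) ×ˢ code m s).image
    (fun ab => trunc (2 ^ m + t) (glue m ab.1 ab.2)) with hU₁
  set U₂ := (codePrefixes m s t).image (glue m 0) with hU₂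
  have hsub : codePrefixes (m + 1) (s + 1) (2 ^ m + t) ⊆ U₁ ∪ U₂ := by
    intro u hu
    simp only [codePrefixes, Finset.mem_image] at hu
    obtain ⟨g, hg, rfl⟩ := hu
    obtain ⟨a, ha, b, hb, rfl⟩ := mem_code_succ.1 hg
    rw [Finset.mem_union]
    by_cases ha0 : a = 0
    · right
      rw [hU₂, Finset.mem_image]
      refine ⟨trunc t b, Finset.mem_image_of_mem _ hb, funext fun k => ?_⟩
      rw [ha0]
      unfold trunc glue
      simp only [Pi.zero_apply, zero_add]
      split_ifs <;> first | rfl | omega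
    · left
      rw [hU₁, Finset.mem_image]
      exact ⟨(a, b), by simp [ha, hb, ha0], rfl⟩
  have h₁ : ∑ u ∈ U₁, p ^ weight (2 ^ m + t) u ≤ ((2 : ℝ) ^ (m + 1) ^ s) ^ 2 * p ^ 2 ^ (m - s) := by
    calc ∑ u ∈ U₁, p ^ weight (2 ^ m + t) u ≤ ∑ u ∈ U₁, p ^ 2 ^ (m - s) := by
          refine Finset.sum_le_sum fun u hu => pow_le_pow_of_le_one hp hp1 ?_
          rw [hU₁, Finset.mem_image] at hu
          obtain ⟨⟨a, b⟩, hab, rfl⟩ := hu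
          simp only [Finset.mem_product, Finset.mem_filter] at hab
          rw [weight_trunc, weight_glue]
          exact (le_weight hab.1.1 hab.1.2).trans (Nat.le_add_right _ _)
      _ = U₁.card * p ^ 2 ^ (m - s) := by rw [Finset.sum_const, nsmul_eq_mul]
      _ ≤ _ := by
          gcongr
          have : U₁.card ≤ (2 ^ (m + 1) ^ s) ^ 2 := by
            refine Finset.card_image_le.trans ?_
            rw [Finset.card_product, sq]
            refine Nat.mul_le_mul ((Finset.card_filter_le _ _).trans ?_) ?_
            · rw [card_code]
              exact Nat.pow_le_pow_right (by omega) (dim_le m s)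
            · rw [card_code]
              exact Nat.pow_le_pow_right (by omega) ((dim_le_succ m s).trans (dim_le m s))
          exact_mod_cast this
  have h₂ : ∑ u ∈ U₂, p ^ weight (2 ^ m + t) u = prefixSum p m s t := by
    rw [hU₂, Finset.sum_image]
    · refine Finset.sum_congr rfl fun u _ => ?_
      rw [weight_glue, zero_add]
      simp [weight]
    · intro u _ v _ h
      exact (glue_injective (by simp) (by simp) h).2
  calc prefixSum p (m + 1) (s + 1) (2 ^ m + t)
      ≤ ∑ u ∈ U₁ ∪ U₂, p ^ weight (2 ^ m + t) u :=
        Finset.sum_le_sum_of_subset_of_nonneg hsub fun _ _ _ => by positivity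
    _ ≤ ∑ u ∈ U₁, p ^ weight (2 ^ m + t) u + ∑ u ∈ U₂, p ^ weight (2 ^ m + t) u := by
        rw [← Finset.sum_union_inter]
        exact le_add_of_nonneg_right (Finset.sum_nonneg fun _ _ => by positivity)
    _ ≤ _ := add_le_add h₁ h₂.le

/-- The prefix sums are bounded uniformly in the length of the code and of the prefixes. -/
theorem exists_prefixSum_le {p : ℝ} (hp : 0 ≤ p) (hp1 : p < 1) (s : ℕ) :
    ∃ C, ∀ m t, t ≤ 2 ^ m → prefixSum p m s t ≤ C := by
  classical
  induction s with
  | zero =>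
    refine ⟨1, fun m t _ => ?_⟩
    have : trunc t 0 = 0 := by
      funext k
      simp [trunc]
    simp [prefixSum, codePrefixes, code_zero, this, weight]
  | succ s ih =>
    obtain ⟨C, hC⟩ := ih
    obtain ⟨A, hA⟩ := (tendsto_sq_mul_pow s hp hp1).bddAbove_range
    -- The constant does not grow with `m`: prefixes within the first half inherit the bound, and
    -- for longer ones `A + C` bounds the sum outright. The `2` is for the code of length one.
    refine ⟨max 2 (A + C), fun m => ?_⟩
    induction m with
    | zero =>
      intro t _
      refine le_trans ?_ (le_max_left _ _)
      calc prefixSum p 0 (s + 1) t ≤ ∑ u ∈ codePrefixes 0 (s + 1) t, 1 :=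
            Finset.sum_le_sum fun u _ => pow_le_one₀ hp hp1.le
        _ = (codePrefixes 0 (s + 1) t).card := by simp
        _ ≤ 2 := by
            have : (codePrefixes 0 (s + 1) t).card ≤ 2 :=
              Finset.card_image_le.trans (by rw [card_code]; simp [dim])
            exact_mod_cast this
    | succ m ihm =>
      intro t ht
      by_cases htm : t ≤ 2 ^ m
      · exact (prefixSum_succ_of_le hp htm).trans (ihm t htm)
      · obtain ⟨t, rfl⟩ := Nat.exists_eq_add_of_le (not_le.1 htm).le
        rw [pow_succ] at ht
        refine (prefixSum_succ_of_ge hp hp1.le).trans (le_trans ?_ (le_max_right _ _))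
        exact add_le_add (hA ⟨m, rfl⟩) (hC m t (by omega))

theorem sub_mem_reedMuller {r m : ℕ} {c c' : BinWord (2 ^ m)} (hc : c ∈ reedMuller r m)
    (hc' : c' ∈ reedMuller r m) : c - c' ∈ reedMuller r m := by
  obtain ⟨f, hf, h⟩ := hc
  obtain ⟨f', hf', h'⟩ := hc'
  refine ⟨f - f', ?_, fun t => by simp [h, h']⟩
  rw [← mem_degLT_succ] at hf hf' ⊢
  exact Submodule.sub_mem _ hf hf'

theorem le_codeMinDist (r m : ℕ) : 2 ^ (m - r) ≤ codeMinDist (reedMuller r m) := by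
  refine le_csInf ?_ ?_
  -- Two distinct codewords are needed, since the infimum of the empty set is `0`.
  · refine ⟨_, fun _ => 0, ⟨0, by simp, by simp⟩, fun _ => 1, ⟨1, by simp, by simp⟩, ?_, rfl⟩
    intro h
    have := congrFun h ⟨0, by positivity⟩
    simp at this
  · rintro d ⟨a, ha, b, hb, hab, rfl⟩
    have hmem := mem_reedMuller_iff.1 (sub_mem_reedMuller ha hb)
    have hne : extend (a - b) ≠ 0 := fun h => by
      refine hab (sub_eq_zero.1 (extend_injective (h.trans ?_)))
      funext k
      simp [extend]
    refine (le_weight hmem hne).trans (le_of_eq ?_)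
    unfold weight hammingDist
    rw [Finset.card_filter, Finset.sum_range]
    refine Finset.sum_congr rfl fun t _ => ?_
    simp [extend, sub_eq_zero]

theorem tendsto_choose_mul_pow (r : ℕ) {p : ℝ} (hp : 0 ≤ p) (hp1 : p < 1) :
    Tendsto (fun m : ℕ => (((reedMuller r m).ncard.choose 2 : ℕ) : ℝ) *
      p ^ codeMinDist (reedMuller r m)) atTop (𝓝 0) := by
  refine squeeze_zero (fun m => by positivity) (fun m => ?_) (tendsto_sq_mul_pow r hp hp1)
  refine mul_le_mul ?_ (pow_le_pow_of_le_one hp hp1.le (le_codeMinDist r m)) (by positivity)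
    (by positivity)
  have h₁ : (reedMuller r m).ncard ≤ 2 ^ (m + 1) ^ r := by
    rw [ncard_reedMuller, card_code]
    exact Nat.pow_le_pow_right (by omega) (dim_le m r)
  have : (reedMuller r m).ncard.choose 2 ≤ (2 ^ (m + 1) ^ r) ^ 2 :=
    (Nat.choose_le_pow _ _).trans (Nat.pow_le_pow_left h₁ 2)
  exact_mod_cast this

end ReedMuller

/-! ## The expected number of candidates -/

namespace Jedi

open ReedMuller

theorem sum_becSymbolProb {p : ℝ} (hp : 0 ≤ p) (hp1 : p ≤ 1) (a : ZMod 2) :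
    ∑ b, becSymbolProb p a b = 1 := by
  rw [Fintype.sum_option]
  simp only [becSymbolProb, Finset.sum_ite_eq', Finset.mem_univ, if_true]
  rw [← ENNReal.ofReal_add hp (by linarith)]
  simp

theorem sum_becProb {p : ℝ} (hp : 0 ≤ p) (hp1 : p ≤ 1) {n : ℕ} (c : BinWord n) :
    ∑ z, becProb p c z = 1 := by
  unfold becProb
  rw [← Fintype.prod_sum]
  simp [sum_becSymbolProb hp hp1]

open Classical in
/-- Indicator of the event that the output symbol `b` matches the symbol `a`, if the position `k`
is among the first `t`. -/
noncomputable def symbolMatch (t k : ℕ) (a : ZMod 2) (b : Option (ZMod 2)) : ℕ :=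
  if k < t → b = none ∨ b = some a then 1 else 0

/-- Indicator of the event that the output `z` matches the word `u` in the first `t` positions. -/
noncomputable def prefixMatch {n : ℕ} (t : ℕ) (u : ℕ → ZMod 2) (z : ErasedWord n) : ℕ :=
  ∏ k : Fin n, symbolMatch t k (u k) (z k)

theorem prefixMatch_le_one {n : ℕ} (t : ℕ) (u : ℕ → ZMod 2) (z : ErasedWord n) :
    prefixMatch t u z ≤ 1 := by
  refine Finset.prod_le_one' fun k _ => ?_
  unfold symbolMatch
  split_ifs <;> omega

theorem prefixMatch_eq_one {n t : ℕ} {u : ℕ → ZMod 2} {z : ErasedWord n}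
    (h : ∀ k : Fin n, (k : ℕ) < t → z k = none ∨ z k = some (u k)) : prefixMatch t u z = 1 :=
  Finset.prod_eq_one fun k _ => if_pos (h k)

/-- An output symbol matches the sent symbol surely, and the other one only if it is erased. -/
theorem sum_becSymbolProb_mul {p : ℝ} (hp : 0 ≤ p) (hp1 : p ≤ 1) (t k : ℕ) (a c : ZMod 2) :
    ∑ b, becSymbolProb p c b * (symbolMatch t k a b : ℝ≥0∞) =
      if k < t then ENNReal.ofReal p ^ (if a - c = 0 then 0 else 1) else 1 := by
  by_cases hk : k < t
  · rw [if_pos hk, Fintype.sum_option]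
    by_cases hac : a = c
    · have h := sum_becSymbolProb hp hp1 c
      rw [Fintype.sum_option] at h
      rw [if_pos (sub_eq_zero.2 hac), pow_zero, ← h]
      congr 1
      · simp [symbolMatch]
      · refine Finset.sum_congr rfl fun b _ => ?_
        by_cases hb : b = c
        · simp [symbolMatch, hb, hac]
        · simp [becSymbolProb, hb]
    · rw [if_neg (sub_ne_zero.2 hac), pow_one, Finset.sum_eq_zero, add_zero]
      · simp [symbolMatch, becSymbolProb]
      · intro b _
        by_cases hb : b = c
        · have : symbolMatch t k a (some b) = 0 := by
            have hca : ¬ c = a := fun h => hac h.symm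
            simp [symbolMatch, hk, hb, hca]
          simp [this]
        · simp [becSymbolProb, hb]
  · rw [if_neg hk, ← sum_becSymbolProb hp hp1 c]
    simp [symbolMatch, hk]

theorem sum_becProb_mul_prefixMatch {p : ℝ} (hp : 0 ≤ p) (hp1 : p ≤ 1) {n t : ℕ} (ht : t ≤ n)
    (c : BinWord n) (u : ℕ → ZMod 2) :
    ∑ z, becProb p c z * (prefixMatch t u z : ℝ≥0∞) =
      ENNReal.ofReal p ^ weight t (u - extend c) := by
  have h₁ : ∀ z : ErasedWord n, becProb p c z * (prefixMatch t u z : ℝ≥0∞) =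
      ∏ k, becSymbolProb p (c k) (z k) * (symbolMatch t k (u k) (z k) : ℝ≥0∞) := fun z => by
    rw [becProb, prefixMatch, Nat.cast_prod, Finset.prod_mul_distrib]
  have h₂ : ∀ k ∈ Finset.range n, k ∉ Finset.range t → (if h : k < n then
      (if k < t then ENNReal.ofReal p ^ (if u k - c ⟨k, h⟩ = 0 then 0 else 1) else 1) else 1) =
        (1 : ℝ≥0∞) := by
    intro k hk hkt
    simp only [Finset.mem_range] at hk hkt
    simp [hk, hkt]
  rw [Finset.sum_congr rfl fun z _ => h₁ z,
    ← Fintype.prod_sum fun (k : Fin n) b =>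
      becSymbolProb p (c k) b * (symbolMatch t k (u k) b : ℝ≥0∞),
    weight, ← Finset.prod_pow_eq_pow_sum]
  simp_rw [sum_becSymbolProb_mul hp hp1]
  have h₃ := Finset.prod_subset (Finset.range_subset_range.2 ht) h₂
  rw [Finset.prod_range (n := n)] at h₃
  simp only [Fin.is_lt, dif_pos, Fin.eta] at h₃
  rw [← h₃]
  refine Finset.prod_congr rfl fun k hk => ?_
  have hk := Finset.mem_range.1 hk
  have hkn : k < n := by omega
  simp [hk, hkn, extend]

/-- Marginalization: the other outputs sum to probability one. -/
theorem sum_prod_becProb_mul {p : ℝ} (hp : 0 ≤ p) (hp1 : p ≤ 1) {M n : ℕ} (x : Fin M → BinWord n)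
    (j : Fin M) (f : ErasedWord n → ℝ≥0∞) :
    ∑ y : Fin M → ErasedWord n, (∏ i, becProb p (x i) (y i)) * f (y j) =
      ∑ z, becProb p (x j) z * f z := by
  have h : ∀ y : Fin M → ErasedWord n, (∏ i, becProb p (x i) (y i)) * f (y j) =
      ∏ i, becProb p (x i) (y i) * if i = j then f (y i) else 1 := fun y => by
    rw [Finset.prod_mul_distrib, Finset.prod_ite_eq' Finset.univ j fun i => f (y i)]
    simp
  rw [Finset.sum_congr rfl fun y _ => h y,
    ← Fintype.prod_sum fun i z => becProb p (x i) z * if i = j then f z else 1,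
    Finset.prod_eq_single j]
  · simp
  · intro i _ hij
    simp [hij, sum_becProb hp hp1]
  · simp

open Classical in
/-- The prefixes of length `t` of the codewords. -/
noncomputable def wordPrefixes {M n : ℕ} (x : Fin M → BinWord n) (t : ℕ) : Finset (ℕ → ZMod 2) :=
  Finset.univ.image fun i => trunc t (extend (x i))

theorem candidateCount_le {M n t : ℕ} (x : Fin M → BinWord n) (y : Fin M → ErasedWord n)
    (ht : t ≤ n) :
    candidateCount x y t ≤ ∑ j, ∑ u ∈ wordPrefixes x t, prefixMatch t u (y j) := by
  classical
  have hsub : (candidates (prefixes (wordVal x) n M) (outVal y) M t).toFinset ⊆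
      ((Finset.univ ×ˢ wordPrefixes x t).filter fun ju => prefixMatch t ju.2 (y ju.1) = 1).image
        fun ju => (pref (fun k => (ju.2 k).val) t, (ju.1 : ℕ)) := by
    rintro ⟨v, j⟩ hv
    rw [List.mem_toFinset, mem_candidates (fun i _ t _ => wordVal_lt x i t) ht] at hv
    obtain ⟨hj, i, hi, hv, hm⟩ := hv
    rw [Finset.mem_image]
    refine ⟨(⟨j, hj⟩, trunc t (extend (x ⟨i, hi⟩))), ?_, ?_⟩
    · rw [Finset.mem_filter, Finset.mem_product]
      refine ⟨⟨Finset.mem_univ _, Finset.mem_image_of_mem _ (Finset.mem_univ _)⟩,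
        prefixMatch_eq_one fun k hk => ?_⟩
      have := hm k hk
      rw [wordVal_eq x ⟨i, hi⟩ k, outVal_eq y ⟨j, hj⟩ k, symbolCode_ne_iff] at this
      simpa [trunc, hk, extend] using this
    · refine Prod.ext ?_ rfl
      simp only at hv ⊢
      rw [hv, pref_inj]
      intro k hk
      have hkn : k < n := by omega
      rw [wordVal_eq x ⟨i, hi⟩ ⟨k, hkn⟩]
      simp [trunc, hk, extend, hkn]
  calc candidateCount x y t
      = (candidates (prefixes (wordVal x) n M) (outVal y) M t).toFinset.card :=
        (List.toFinset_card_of_nodup (nodup_candidates _ _ _ _)).symm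
    _ ≤ _ := (Finset.card_le_card hsub).trans Finset.card_image_le
    _ = ∑ ju ∈ Finset.univ ×ˢ wordPrefixes x t, if prefixMatch t ju.2 (y ju.1) = 1 then 1 else 0 :=
        Finset.card_filter _ _
    _ ≤ ∑ ju ∈ Finset.univ ×ˢ wordPrefixes x t, prefixMatch t ju.2 (y ju.1) := by
        refine Finset.sum_le_sum fun ju _ => ?_
        split_ifs with h
        · exact h.ge
        · omega
    _ = _ := Finset.sum_product _ _ _

/-- A worst-case bound, used only for bit lengths, where a polynomial bound suffices. -/
theorem candidateCount_le_sq {M n t : ℕ} (x : Fin M → BinWord n) (y : Fin M → ErasedWord n)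
    (ht : t ≤ n) : candidateCount x y t ≤ M * M := by
  classical
  calc candidateCount x y t ≤ ∑ j, ∑ u ∈ wordPrefixes x t, prefixMatch t u (y j) :=
        candidateCount_le x y ht
    _ ≤ ∑ j : Fin M, ∑ u ∈ wordPrefixes x t, 1 :=
        Finset.sum_le_sum fun j _ => Finset.sum_le_sum fun u _ => prefixMatch_le_one _ _ _
    _ = M * (wordPrefixes x t).card := by simp
    _ ≤ M * M := Nat.mul_le_mul_left _ (Finset.card_image_le.trans (by simp))

theorem wordPrefixes_eq {M m r : ℕ} {x : Fin M → BinWord (2 ^ m)}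
    (hx : Set.range x = reedMuller r m) (t : ℕ) : wordPrefixes x t = codePrefixes m (r + 1) t := by
  classical
  ext u
  simp only [wordPrefixes, codePrefixes, Finset.mem_image, Finset.mem_univ, true_and]
  constructor
  · rintro ⟨i, rfl⟩
    exact ⟨_, mem_reedMuller_iff.1 (hx ▸ ⟨i, rfl⟩), rfl⟩
  · rintro ⟨g, hg, rfl⟩
    have : g ∈ extend '' reedMuller r m := by
      rw [image_extend_reedMuller]
      exact hg
    obtain ⟨c, hc, rfl⟩ := this
    rw [← hx] at hc
    obtain ⟨i, rfl⟩ := hc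
    exact ⟨i, rfl⟩

/-- By linearity, subtracting the sent codeword maps the prefixes injectively to prefixes of
codewords, which reduces every sent word to the zero word. -/
theorem sum_pow_weight_sub_le {p : ℝ} (hp : 0 ≤ p) {M m r : ℕ} {x : Fin M → BinWord (2 ^ m)}
    (hx : Set.range x = reedMuller r m) (t : ℕ) (j : Fin M) :
    ∑ u ∈ wordPrefixes x t, ENNReal.ofReal p ^ weight t (u - extend (x j)) ≤
      ENNReal.ofReal (prefixSum p m (r + 1) t) := by
  classical
  have hφ : ∀ i, ∃ k, trunc t (trunc t (extend (x i)) - extend (x j)) =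
      trunc t (extend (x k)) := fun i => by
    have h : x i - x j ∈ Set.range x := by
      rw [hx]
      exact sub_mem_reedMuller (hx ▸ ⟨i, rfl⟩) (hx ▸ ⟨j, rfl⟩)
    obtain ⟨k, hk⟩ := h
    refine ⟨k, funext fun q => ?_⟩
    by_cases h₁ : q < t <;> by_cases h₂ : q < 2 ^ m <;> simp [trunc, extend, h₁, h₂, hk]
  calc ∑ u ∈ wordPrefixes x t, ENNReal.ofReal p ^ weight t (u - extend (x j))
      = ∑ u ∈ wordPrefixes x t, ENNReal.ofReal p ^ weight t (trunc t (u - extend (x j))) :=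
        Finset.sum_congr rfl fun u _ => by rw [weight_trunc]
    _ = ∑ w ∈ (wordPrefixes x t).image fun u => trunc t (u - extend (x j)),
          ENNReal.ofReal p ^ weight t w := by
        rw [Finset.sum_image]
        intro u hu v hv huv
        simp only [wordPrefixes, Finset.coe_image, Set.mem_image] at hu hv
        obtain ⟨i, -, rfl⟩ := hu
        obtain ⟨k, -, rfl⟩ := hv
        funext q
        have := congrFun huv q
        by_cases h₁ : q < t
        · simpa [trunc, h₁] using this
        · simp [trunc, h₁]
    _ ≤ ∑ w ∈ wordPrefixes x t, ENNReal.ofReal p ^ weight t w := by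
        refine Finset.sum_le_sum_of_subset fun w hw => ?_
        simp only [wordPrefixes, Finset.mem_image, Finset.mem_univ, true_and] at hw ⊢
        obtain ⟨u, ⟨i, rfl⟩, rfl⟩ := hw
        obtain ⟨k, hk⟩ := hφ i
        exact ⟨k, hk.symm⟩
    _ = ENNReal.ofReal (prefixSum p m (r + 1) t) := by
        rw [wordPrefixes_eq hx, prefixSum, ENNReal.ofReal_sum_of_nonneg fun _ _ => by positivity]
        exact Finset.sum_congr rfl fun _ _ => (ENNReal.ofReal_pow hp _).symm

theorem expected_candidateCount_le {p : ℝ} (hp : 0 ≤ p) (hp1 : p ≤ 1) {M m r : ℕ}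
    {x : Fin M → BinWord (2 ^ m)} (hx : Set.range x = reedMuller r m)
    (order : (Fin M → ErasedWord (2 ^ m)) → Equiv.Perm (Fin M)) {t : ℕ} (ht : t ≤ 2 ^ m) {C : ℝ}
    (hC : prefixSum p m (r + 1) t ≤ C) :
    ∑ y : Fin M → ErasedWord (2 ^ m), (∏ i, becProb p (x i) (y i)) *
      (candidateCount x (fun j => y (order y j)) t : ℝ≥0∞) ≤ M * ENNReal.ofReal C := by
  calc ∑ y : Fin M → ErasedWord (2 ^ m), (∏ i, becProb p (x i) (y i)) *
        (candidateCount x (fun j => y (order y j)) t : ℝ≥0∞)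
      ≤ ∑ y : Fin M → ErasedWord (2 ^ m), (∏ i, becProb p (x i) (y i)) *
        ∑ j, ∑ u ∈ wordPrefixes x t, (prefixMatch t u (y j) : ℝ≥0∞) := by
        refine Finset.sum_le_sum fun y _ => mul_le_mul_right ?_ _
        -- For fixed `y` the sum over all received outputs does not depend on their order, so an
        -- order that depends on `y` does no harm.
        rw [← Equiv.sum_comp (order y)]
        exact_mod_cast candidateCount_le x (fun j => y (order y j)) ht
    _ = ∑ j, ∑ u ∈ wordPrefixes x t, ∑ y : Fin M → ErasedWord (2 ^ m),
          (∏ i, becProb p (x i) (y i)) * (prefixMatch t u (y j) : ℝ≥0∞) := by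
        simp_rw [Finset.mul_sum]
        rw [Finset.sum_comm]
        exact Finset.sum_congr rfl fun j _ => Finset.sum_comm
    _ = ∑ j, ∑ u ∈ wordPrefixes x t, ENNReal.ofReal p ^ weight t (u - extend (x j)) := by
        refine Finset.sum_congr rfl fun j _ => Finset.sum_congr rfl fun u _ => ?_
        rw [sum_prod_becProb_mul hp hp1 x j fun z => (prefixMatch t u z : ℝ≥0∞),
          sum_becProb_mul_prefixMatch hp hp1 ht]
    _ ≤ ∑ _j : Fin M, ENNReal.ofReal C := Finset.sum_le_sum fun j _ =>
        (sum_pow_weight_sub_le hp hx t j).trans (ENNReal.ofReal_le_ofReal hC)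
    _ = M * ENNReal.ofReal C := by simp

theorem sum_prod_becProb {p : ℝ} (hp : 0 ≤ p) (hp1 : p ≤ 1) {M n : ℕ} (x : Fin M → BinWord n) :
    ∑ y : Fin M → ErasedWord n, ∏ i, becProb p (x i) (y i) = 1 := by
  rw [← Fintype.prod_sum fun i z => becProb p (x i) z]
  simp [sum_becProb hp hp1]

theorem expected_stepCount_le {p : ℝ} (hp : 0 ≤ p) (hp1 : p ≤ 1) {M m r : ℕ}
    {x : Fin M → BinWord (2 ^ m)} (hx : Set.range x = reedMuller r m)
    (order : (Fin M → ErasedWord (2 ^ m)) → Equiv.Perm (Fin M)) {C : ℝ} (hC0 : 0 ≤ C)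
    (hC : ∀ t ≤ 2 ^ m, prefixSum p m (r + 1) t ≤ C) :
    ∑ y : Fin M → ErasedWord (2 ^ m), (∏ i, becProb p (x i) (y i)) *
      (stepCount x (fun j => y (order y j)) : ℝ≥0∞) ≤
      ENNReal.ofReal (11 * (M * 2 ^ m) + 67 * M + 4 * 2 ^ m + 51 +
        147 * ((2 ^ m + 1) * (M * C))) := by
  have h₁ : ∀ y : Fin M → ErasedWord (2 ^ m), (∏ i, becProb p (x i) (y i)) *
      (stepCount x (fun j => y (order y j)) : ℝ≥0∞) =
      (∏ i, becProb p (x i) (y i)) * ((11 * (M * 2 ^ m) + 67 * M + 4 * 2 ^ m + 51 : ℕ) : ℝ≥0∞) +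
        147 * ∑ t ∈ Finset.range (2 ^ m + 1), (∏ i, becProb p (x i) (y i)) *
          (candidateCount x (fun j => y (order y j)) t : ℝ≥0∞) := fun y => by
    rw [stepCount, Nat.cast_add, mul_add, ← Finset.mul_sum]
    push_cast
    ring
  rw [Finset.sum_congr rfl fun y _ => h₁ y, Finset.sum_add_distrib, ← Finset.sum_mul,
    sum_prod_becProb hp hp1, one_mul, ← Finset.mul_sum, Finset.sum_comm,
    ENNReal.ofReal_add (by positivity) (by positivity)]
  refine add_le_add (le_of_eq ?_) ?_
  · rw [← ENNReal.ofReal_natCast]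
    push_cast
    rfl
  · rw [ENNReal.ofReal_mul (by norm_num), ENNReal.ofReal_ofNat]
    refine mul_le_mul_right ?_ _
    calc _ ≤ ∑ _t ∈ Finset.range (2 ^ m + 1), (M : ℝ≥0∞) * ENNReal.ofReal C :=
          Finset.sum_le_sum fun t ht => by
            have ht : t ≤ 2 ^ m := by simpa [Nat.lt_succ_iff] using ht
            exact expected_candidateCount_le hp hp1 hx order ht (hC t ht)
      _ = _ := by
          rw [Finset.sum_const, Finset.card_range, nsmul_eq_mul,
            ENNReal.ofReal_mul (by positivity), ENNReal.ofReal_mul (by positivity),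
            ENNReal.ofReal_natCast]
          congr 1
          rw [← ENNReal.ofReal_natCast]
          push_cast
          rfl

end Jedi

/-! ### From instruction counts to the running time. -/

namespace Jedi

open ReedMuller

theorem size_le_log {N : ℕ} (hN : N ≠ 0) : (N.size : ℝ) ≤ 1 + 2 * Real.log N := by
  obtain ⟨s, hs⟩ : ∃ s, N.size = s + 1 :=
    Nat.exists_eq_succ_of_ne_zero fun h => hN (Nat.size_eq_zero.1 h)
  have h : 2 ^ s ≤ N := Nat.lt_size.1 (by omega)
  have h₁ : (s : ℝ) * Real.log 2 ≤ Real.log N := by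
    rw [← Real.log_pow]
    exact Real.log_le_log (by positivity) (by exact_mod_cast h)
  have h₂ := Real.log_two_gt_d9
  have h₃ : (s : ℝ) * (1 / 2) ≤ s * Real.log 2 := by
    gcongr
    linarith
  rw [hs]
  push_cast
  linarith

/-- The left side is at most `3 + 52 log 2 + 20 log M`, and `log M ≤ M ^ δ / δ`. -/
theorem exists_size_le_rpow {δ : ℝ} (hδ : 0 < δ) : ∃ K : ℝ, 0 ≤ K ∧ ∀ M : ℕ, 1 ≤ M →
    ((1 + 2 * (2 ^ 13 * M ^ 5).size : ℕ) : ℝ) ≤ K * (M : ℝ) ^ δ := by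
  refine ⟨3 + 52 * Real.log 2 + 20 / δ, by positivity, fun M hM => ?_⟩
  have hM' : (1 : ℝ) ≤ M := by exact_mod_cast hM
  have h₁ := size_le_log (N := 2 ^ 13 * M ^ 5) (by positivity)
  have h₂ : Real.log ((2 ^ 13 * M ^ 5 : ℕ) : ℝ) = 13 * Real.log 2 + 5 * Real.log M := by
    rw [Nat.cast_mul, Nat.cast_pow, Nat.cast_pow, Real.log_mul (by positivity) (by positivity),
      Real.log_pow, Real.log_pow]
    norm_num
  have h₃ := Real.log_le_rpow_div (x := (M : ℝ)) (by positivity) hδ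
  have h₄ : (1 : ℝ) ≤ (M : ℝ) ^ δ := Real.one_le_rpow hM' hδ.le
  have h₅ : (3 + 52 * Real.log 2) * 1 ≤ (3 + 52 * Real.log 2) * (M : ℝ) ^ δ := by gcongr
  have h₆ : (20 / δ) * (M : ℝ) ^ δ = 20 * ((M : ℝ) ^ δ / δ) := by ring
  rw [h₂] at h₁
  rw [Nat.cast_add, Nat.cast_mul, Nat.cast_one, Nat.cast_two, add_mul, h₆]
  clear h₂
  generalize (2 ^ 13 * M ^ 5).size = s at h₁ ⊢
  linarith

theorem stepCount_le {M n : ℕ} (hn : 1 ≤ n) (hnM : n ≤ M) (x : Fin M → BinWord n)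
    (y : Fin M → ErasedWord n) : stepCount x y ≤ 427 * M ^ 3 := by
  have hM : 1 ≤ M := hn.trans hnM
  have h₁ : ∑ t ∈ Finset.range (n + 1), candidateCount x y t ≤ 2 * M ^ 3 :=
    calc ∑ t ∈ Finset.range (n + 1), candidateCount x y t
        ≤ ∑ _t ∈ Finset.range (n + 1), M * M := Finset.sum_le_sum fun t ht =>
          candidateCount_le_sq x y (Nat.lt_succ_iff.1 (Finset.mem_range.1 ht))
      _ = (n + 1) * (M * M) := by simp
      _ ≤ (2 * M) * (M * M) := Nat.mul_le_mul_right _ (by omega)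
      _ = 2 * M ^ 3 := by ring
  have h₂ : M * n ≤ M ^ 3 := calc
    M * n ≤ M * M := Nat.mul_le_mul_left _ hnM
    _ = M ^ 2 := by ring
    _ ≤ M ^ 3 := Nat.pow_le_pow_right hM (by norm_num)
  have h₃ : M ≤ M ^ 3 := Nat.le_self_pow (by norm_num) M
  unfold stepCount
  omega

theorem size_stepCount_le {M n : ℕ} (hn : 1 ≤ n) (hnM : n ≤ M) (x : Fin M → BinWord n)
    (y : Fin M → ErasedWord n) :
    ((stepCount x y + 1) * increment M n).size ≤ (2 ^ 13 * M ^ 5).size := by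
  have hM : 1 ≤ M := hn.trans hnM
  refine Nat.size_le_size ?_
  have h₁ : stepCount x y + 1 ≤ 428 * M ^ 3 := by
    have := stepCount_le hn hnM x y
    have : 1 ≤ M ^ 3 := Nat.one_le_pow _ _ hM
    omega
  have h₂ : increment M n ≤ 2 * ((3 * M) * (2 * M)) := by
    unfold increment
    gcongr <;> omega
  calc _ ≤ 428 * M ^ 3 * (2 * ((3 * M) * (2 * M))) := Nat.mul_le_mul h₁ h₂
    _ = 5136 * M ^ 5 := by ring
    _ ≤ 2 ^ 13 * M ^ 5 := Nat.mul_le_mul_right _ (by norm_num)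

theorem card_eq_two_pow_dim {M m r : ℕ} {x : Fin M → BinWord (2 ^ m)}
    (hinj : Function.Injective x) (hx : Set.range x = reedMuller r m) :
    M = 2 ^ dim m (r + 1) := by
  rw [← card_code, ← ncard_reedMuller, ← hx, ← Set.image_univ,
    Set.ncard_image_of_injective _ hinj, Set.ncard_univ, Nat.card_eq_fintype_card, Fintype.card_fin]

theorem two_pow_le_two_pow_dim {r : ℕ} (hr : 1 ≤ r) (m : ℕ) : 2 ^ m ≤ 2 ^ dim m (r + 1) := by
  refine Nat.pow_le_pow_right (by norm_num) ?_
  have h := dim_mono m (show 2 ≤ r + 1 by omega)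
  rw [dim_two] at h
  omega

/-- For codes of order at least two the length grows more slowly than any power of the size. -/
theorem two_pow_le_rpow {r : ℕ} (hr : 2 ≤ r) {δ : ℝ} (hδ : 0 < δ) (m : ℕ) :
    (2 : ℝ) ^ m ≤ (2 : ℝ) ^ (1 / (2 * δ)) * ((2 ^ dim m (r + 1) : ℕ) : ℝ) ^ δ := by
  have h₁ : (m : ℝ) ^ 2 ≤ 2 * dim m (r + 1) := by
    have h := (sq_le_dim_three (m := m)).trans
      (Nat.mul_le_mul_left 2 (dim_mono m (show 3 ≤ r + 1 by omega)))
    exact_mod_cast h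
  push_cast
  rw [← Real.rpow_natCast, ← Real.rpow_natCast, ← Real.rpow_mul (by norm_num),
    ← Real.rpow_add (by norm_num)]
  refine Real.rpow_le_rpow_of_exponent_le (by norm_num) ?_
  -- This is `(δ m - 1)² ≥ 0`; it trades the linear exponent for a small multiple of the quadratic
  -- dimension plus a constant.
  have h₂ : (m : ℝ) ≤ 1 / (2 * δ) + δ * m ^ 2 / 2 := by
    have h : 0 ≤ (δ * m - 1) ^ 2 / (2 * δ) := by positivity
    have h' : (δ * m - 1) ^ 2 / (2 * δ) = 1 / (2 * δ) + δ * m ^ 2 / 2 - m := by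
      field_simp
      ring
    linarith
  nlinarith [mul_le_mul_of_nonneg_left h₁ hδ.le]

/-- Up to an arbitrarily small power of the size, the expected running time on a Reed-Muller code
is at most the product of its size and its length. -/
theorem exists_expectedTime_le {r : ℕ} (hr : 1 ≤ r) {p : ℝ} (hp : 0 ≤ p) (hp1 : p < 1)
    {δ : ℝ} (hδ : 0 < δ) : ∃ K : ℝ, 0 ≤ K ∧ ∀ (m M : ℕ) (x : Fin M → BinWord (2 ^ m)),
      Function.Injective x → Set.range x = reedMuller r m →
      ∀ order : (Fin M → ErasedWord (2 ^ m)) → Equiv.Perm (Fin M),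
        expectedTime (step₁.seq step₂) p x order ≤
          ENNReal.ofReal (K * (M * 2 ^ m * (M : ℝ) ^ δ)) := by
  obtain ⟨C, hC⟩ := exists_prefixSum_le hp hp1 (r + 1)
  obtain ⟨K, hK, hsize⟩ := exists_size_le_rpow hδ
  have hC0 : 0 ≤ max C 0 := le_max_right _ _
  set B := max C 0 with hB
  refine ⟨(133 + 294 * B) * K, by positivity, fun m M x hinj hx order => ?_⟩
  have hM := card_eq_two_pow_dim hinj hx
  have hn : 1 ≤ 2 ^ m := Nat.one_le_two_pow
  have hnM : 2 ^ m ≤ M := hM ▸ two_pow_le_two_pow_dim hr m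
  have hM1 : 1 ≤ M := hn.trans hnM
  -- A bound for the cost of one instruction that does not depend on the outputs and can be taken
  -- out of the expectation.
  set L : ℕ := 1 + 2 * (2 ^ 13 * M ^ 5).size with hL
  have htime : ∀ y : Fin M → ErasedWord (2 ^ m),
      (step₁.seq step₂).time (jediInput x y) ≤ (stepCount x y : ℝ≥0∞) * (L : ℝ≥0∞) := fun y => by
    refine (time_le hinj y).trans ?_
    rw [← Nat.cast_mul]
    refine Nat.cast_le.2 (Nat.mul_le_mul_left _ ?_)
    have := size_stepCount_le hn hnM x y
    omega
  have hn' : (1 : ℝ) ≤ 2 ^ m := one_le_pow₀ (by norm_num)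
  have hM' : (1 : ℝ) ≤ M := by exact_mod_cast hM1
  have hbound : (11 * (M * 2 ^ m) + 67 * M + 4 * 2 ^ m + 51 +
      147 * ((2 ^ m + 1) * (M * B)) : ℝ) ≤ (133 + 294 * B) * (M * 2 ^ m) := by
    have h₁ : (M : ℝ) ≤ M * 2 ^ m := le_mul_of_one_le_right (by positivity) hn'
    have h₂ : (2 : ℝ) ^ m ≤ M * 2 ^ m := le_mul_of_one_le_left (by positivity) hM'
    have h₃ : ((2 : ℝ) ^ m + 1) * (M * B) ≤ (2 * 2 ^ m) * (M * B) := by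
      gcongr
      linarith
    have h₄ : ((2 : ℝ) * 2 ^ m) * (M * B) = 2 * (B * (M * 2 ^ m)) := by ring
    have h₅ : (133 + 294 * B) * (M * 2 ^ m) = 133 * (M * 2 ^ m) + 294 * (B * (M * 2 ^ m)) := by
      ring
    linarith
  calc expectedTime (step₁.seq step₂) p x order
      ≤ ∑ y : Fin M → ErasedWord (2 ^ m), (∏ i, becProb p (x i) (y i)) *
          (stepCount x (fun j => y (order y j)) : ℝ≥0∞) * (L : ℝ≥0∞) := by
        refine Finset.sum_le_sum fun y _ => ?_
        rw [mul_assoc]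
        gcongr
        exact htime _
    _ = (∑ y : Fin M → ErasedWord (2 ^ m), (∏ i, becProb p (x i) (y i)) *
          (stepCount x (fun j => y (order y j)) : ℝ≥0∞)) * (L : ℝ≥0∞) :=
        (Finset.sum_mul _ _ _).symm
    _ ≤ ENNReal.ofReal ((133 + 294 * B) * (M * 2 ^ m)) * ENNReal.ofReal (K * (M : ℝ) ^ δ) := by
        refine mul_le_mul' ?_ ?_
        · exact (expected_stepCount_le hp hp1.le hx order hC0
            fun t ht => (hC m t ht).trans (le_max_left _ _)).trans
              (ENNReal.ofReal_le_ofReal hbound)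
        · rw [← ENNReal.ofReal_natCast]
          exact ENNReal.ofReal_le_ofReal (hsize M hM1)
    _ = ENNReal.ofReal ((133 + 294 * B) * K * (M * 2 ^ m * (M : ℝ) ^ δ)) := by
        rw [← ENNReal.ofReal_mul (by positivity)]
        congr 1
        ring

end Jedi

theorem mainTheorem1 :
    ∃ step₁ step₂ : RamProg, ImplementsJEDI step₁ step₂ ∧
      ∀ (r : ℕ), 1 ≤ r → ∀ (p : ℝ), 0 ≤ p → p < 1 →
        Filter.Tendsto
          (fun m : ℕ => (((reedMuller r m).ncard.choose 2 : ℕ) : ℝ) * p ^ codeMinDist (reedMuller r m))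
          Filter.atTop (nhds 0) ∧
        ∀ (ε : ℝ), 0 < ε → ∃ K : ℝ, ∀ (m : ℕ), r ≤ m →
          ∀ (M : ℕ) (x : Fin M → BinWord (2 ^ m)), Function.Injective x →
            Set.range x = reedMuller r m →
            ∀ order : (Fin M → ErasedWord (2 ^ m)) → Equiv.Perm (Fin M),
              (2 ≤ r → expectedTime (step₁.seq step₂) p x order
                ≤ ENNReal.ofReal (K * (M : ℝ) ^ (1 + ε))) ∧
              (r = 1 → expectedTime (step₁.seq step₂) p x order
                ≤ ENNReal.ofReal (K * (M : ℝ) ^ (2 + ε))) := by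
  refine ⟨Jedi.step₁, Jedi.step₂, Jedi.implementsJEDI, fun r hr p hp hp1 =>
    ⟨ReedMuller.tendsto_choose_mul_pow r hp hp1, fun ε hε => ?_⟩⟩
  rcases hr.eq_or_lt with rfl | hr2
  -- For order one the length is estimated by `M`, which costs the second factor `M`.
  · obtain ⟨K, hK, h⟩ := Jedi.exists_expectedTime_le le_rfl hp hp1 hε
    refine ⟨K, fun m _ M x hinj hx order => ⟨fun h2 => absurd h2 (by norm_num), fun _ =>
      (h m M x hinj hx order).trans (ENNReal.ofReal_le_ofReal ?_)⟩⟩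
    have hM := Jedi.card_eq_two_pow_dim hinj hx
    have hnM : 2 ^ m ≤ M := hM ▸ Jedi.two_pow_le_two_pow_dim le_rfl m
    have hM0 : (0 : ℝ) < M := by exact_mod_cast (Nat.two_pow_pos m).trans_le hnM
    have hnM' : (2 : ℝ) ^ m ≤ M := by exact_mod_cast hnM
    rw [Real.rpow_add hM0, Real.rpow_two, sq]
    gcongr
  -- One half of `ε` pays for the cost of an instruction, the other half for the length.
  · have hε2 : 0 < ε / 2 := half_pos hε
    obtain ⟨K, hK, h⟩ := Jedi.exists_expectedTime_le hr hp hp1 hε2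
    refine ⟨K * (2 : ℝ) ^ (1 / (2 * (ε / 2))), fun m _ M x hinj hx order => ⟨fun _ =>
      (h m M x hinj hx order).trans (ENNReal.ofReal_le_ofReal ?_), fun h1 => by omega⟩⟩
    have hM := Jedi.card_eq_two_pow_dim hinj hx
    have hM0 : (0 : ℝ) < M := by
      rw [hM]
      positivity
    have hn := Jedi.two_pow_le_rpow hr2 hε2 m
    rw [← hM] at hn
    have hsplit : (M : ℝ) ^ (1 + ε) = M * ((M : ℝ) ^ (ε / 2) * (M : ℝ) ^ (ε / 2)) := by
      rw [← Real.rpow_add hM0, add_halves, Real.rpow_add hM0, Real.rpow_one]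
    calc K * (M * 2 ^ m * (M : ℝ) ^ (ε / 2))
        ≤ K * (M * ((2 : ℝ) ^ (1 / (2 * (ε / 2))) * (M : ℝ) ^ (ε / 2)) * (M : ℝ) ^ (ε / 2)) := by
          gcongr
      _ = K * (2 : ℝ) ^ (1 / (2 * (ε / 2))) * (M : ℝ) ^ (1 + ε) := by
          rw [hsplit]
          ring
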